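/- Let $G$ be a locally compact (Hausdorff) group. A $G$-algebra is a $C^*$-algebra with a point-norm continuous action of $G$ by $*$-automorphisms. A crossed-product functor $\rtimes_\mu$ for $G$ assigns to every $G$-algebra $A$ a completion $A\rtimes_\mu G$ of the convolution $*$-algebra $C_c(G,A)$ in a $C^*$-norm $\|\cdot\|_\mu$ with $\|\cdot\|_r\le\|\cdot\|_\mu\le\|\cdot\|_{\max}$ (the reduced and the maximal norm), such that for every equivariant $*$-homomorphism $\varphi:A\to B$ the map $f\mapsto\varphi\circ f$ extends to a $*$-homomorphism $A\rtimes_\mu G\to B\rtimes_\mu G$. It has the ideal property if $I\rtimes_\mu G\to A\rtimes_\mu G$ is injective for every $G$-invariant closed two-sided ideal $I$ of a $G$-algebra $A$; it is exact if it maps every short exact sequence of $G$-algebras to a short exact sequence. It is the smallest exact crossed-product functor if it is exact and $\|f\|_\mu\le\|f\|_\nu$ for every exact crossed-product functor $\rtimes_\nu$, every $G$-algebra $A$ and every $f\in C_c(G,A)$. For an equivariant surjection $\pi:C\to A$ of $G$-algebras with kernel $I$, let $I\rtimes_{\mu,C}G$ be the closure of $C_c(G,I)$ in $C\rtimes_\mu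 G$, and let $\|\cdot\|_\pi$ be the norm on $C_c(G,A)=C_c(G,C)/C_c(G,I)$ induced by the inclusion into $(C\rtimes_\mu G)/(I\rtimes_{\mu,C}G)$. Let $A\rtimes_{\mathcal E(\mu)}G$ be the completion of $C_c(G,A)$ in the norm $\|f\|_{\mathcal E(\mu)}=\sup_\pi\|f\|_\pi$, where $\pi$ runs over all equivariant surjections from $G$-algebras onto $A$. Let $\mathbb C$ carry the trivial action. Proposition 2.5. Let $\rtimes_\mu$ be a crossed-product functor for $G$ with the ideal property. Then the canonical quotient map $\mathbb C\rtimes_{\mathcal E(\mu)}G\to\mathbb C\rtimes_\mu G$, which extends the identity of $C_c(G)$, is an isomorphism. In particular, for the reduced crossed-product functor $\rtimes_r$, the canonical map $\mathbb C\rtimes_{\mathcal E(r)}G\to\mathbb C\rtimes_r G=C_r^*(G)$ is an isomorphism. Moreover, if $\rtimes_{\mathcal E}$ is the smallest exact crossed-product functor for $G$, then the canonical map $\mathbb C\rtimes_{\mathcal E}G\to C_r^*(G)$ is an isomorphism, that is, the group algebra of the smallest exact crossed product is $C_r^*(G)$. -/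

import Mathlib

open MeasureTheory Topology
open scoped CompactlySupported Pointwise

universe u

noncomputable section

namespace CrossedProducts

/-! ### `G`-algebras and equivariant homomorphisms -/

/-- A `G`-algebra: a (not necessarily unital) C⋆-algebra with a point-norm continuous action of `G`
by ⋆-automorphisms. -/
structure GAlgebra (G : Type u) [Group G] [TopologicalSpace G] where
  carrier : Type u
  [cstar : NonUnitalCStarAlgebra carrier]
  act : G →* (carrier ≃⋆ₐ[ℂ] carrier)
  continuous_act : ∀ a : carrier, Continuous fun g : G => act g a

attribute [instance] GAlgebra.cstar

instance (G : Type u) [Group G] [TopologicalSpace G] : CoeSort (GAlgebra G) (Type u) :=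
  ⟨GAlgebra.carrier⟩

/-- An equivariant ⋆-homomorphism of `G`-algebras. -/
structure GHom {G : Type u} [Group G] [TopologicalSpace G] (A B : GAlgebra G) where
  toHom : A →⋆ₙₐ[ℂ] B
  map_act : ∀ (g : G) (a : A), toHom (A.act g a) = B.act g (toHom a)

/-- The one-dimensional C⋆-algebra `ℂ` with the trivial action of `G`. To have it in every universe,
`ℂ` is realised as the algebra of functions on a one-point space. -/
def scalars (G : Type u) [Group G] [TopologicalSpace G] : GAlgebra G where
  carrier := PUnit.{u + 1} → ℂ
  act := 1
  continuous_act _ := continuous_const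

lemma continuous_modularCharacterFun {G : Type u} [Group G] [TopologicalSpace G]
    [IsTopologicalGroup G] [LocallyCompactSpace G] :
    Continuous (fun g : G => (Measure.modularCharacterFun g : ℝ)) := by
  borelize G
  let ν : Measure G := Measure.haar
  obtain ⟨⟨f, f_cont⟩, f_comp, f_nonneg, f_one⟩ :
    ∃ f : C(G, ℝ), HasCompactSupport f ∧ 0 ≤ f ∧ f 1 ≠ 0 := exists_continuous_nonneg_pos 1
  replace f_comp : HasCompactSupport f := f_comp
  have hne : ∫ x, f x ∂ν ≠ 0 :=
    ne_of_gt (f_cont.integral_pos_of_hasCompactSupport_nonneg_nonzero f_comp f_nonneg f_one)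
  have key : (fun g : G => (Measure.modularCharacterFun g : ℝ)) =
      fun g => (∫ x, f (x * g) ∂ν) / ∫ x, f x ∂ν := by
    funext g
    rw [Measure.modularCharacterFun_eq_haarScalarFactor ν g,
      Measure.haarScalarFactor_eq_integral_div _ _ f_cont f_comp hne,
      integral_map (AEMeasurable.mul_const aemeasurable_id' _) f_cont.aestronglyMeasurable]
  rw [key]
  refine Continuous.div_const ?_ _
  refine continuous_iff_continuousAt.2 fun g₀ => ?_
  obtain ⟨t, t_comp, ht⟩ : ∃ t, IsCompact t ∧ t ∈ 𝓝 g₀ := exists_compact_mem_nhds g₀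
  refine ContinuousOn.continuousAt (s := t) ?_ ht
  refine continuousOn_integral_of_compact_support (k := tsupport f * t⁻¹)
    (f_comp.isCompact.mul t_comp.inv) ?_ ?_
  · exact (f_cont.comp (continuous_snd.mul continuous_fst)).continuousOn
  · intro p x hp hx
    by_contra h
    exact hx ⟨x * p, subset_tsupport _ h, p⁻¹, Set.inv_mem_inv.2 hp, by simp⟩

section Convolution

variable {G : Type u} [Group G] [TopologicalSpace G]

lemma GAlgebra.continuous_act_comp {A : GAlgebra G} {X : Type*} [TopologicalSpace X] {g : X → G}
    {a : X → A} (hg : Continuous g) (ha : Continuous a) :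
    Continuous fun x => A.act (g x) (a x) := by
  refine continuous_iff_continuousAt.2 fun x₀ => ?_
  have h1 : Filter.Tendsto (fun x => A.act (g x) (a x) - A.act (g x) (a x₀)) (𝓝 x₀) (𝓝 0) := by
    rw [tendsto_zero_iff_norm_tendsto_zero]
    have h : ∀ x, ‖A.act (g x) (a x) - A.act (g x) (a x₀)‖ = ‖a x - a x₀‖ := fun x => by
      rw [← map_sub, StarAlgEquiv.norm_map]
    simp only [h]
    have := (ha.sub (continuous_const (y := a x₀))).norm.tendsto x₀
    simpa using this
  have h2 : Filter.Tendsto (fun x => A.act (g x) (a x₀)) (𝓝 x₀) (𝓝 (A.act (g x₀) (a x₀))) :=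
    ((A.continuous_act (a x₀)).comp hg).tendsto x₀
  have := h1.add h2
  simpa [ContinuousAt] using this

lemma GHom.continuous_toHom {A B : GAlgebra G} (φ : GHom A B) : Continuous φ.toHom :=
  AddMonoidHomClass.continuous_of_bound φ.toHom 1 fun a => by
    simpa using NonUnitalStarAlgHom.norm_apply_le φ.toHom a

/-- `φ ∘ f` for an equivariant ⋆-homomorphism `φ : A → B` and `f ∈ C_c(G, A)`. -/
def GHom.compCc {A B : GAlgebra G} (φ : GHom A B) (f : C_c(G, A)) : C_c(G, B) where
  toFun s := φ.toHom (f s)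
  continuous_toFun := (φ.continuous_toHom).comp f.continuous
  hasCompactSupport' := f.hasCompactSupport.comp_left (map_zero φ.toHom)

variable [IsTopologicalGroup G] [LocallyCompactSpace G] [MeasurableSpace G] [BorelSpace G]

/-- The twisted convolution `(f * g)(s) = ∫ f(t) α_t(g(t⁻¹ s)) dt` on `C_c(G, A)`. -/
def conv (m : Measure G) [m.IsHaarMeasure] {A : GAlgebra G} (f g : C_c(G, A)) : C_c(G, A) where
  toFun s := ∫ t, f t * A.act t (g (t⁻¹ * s)) ∂m
  continuous_toFun := by
    rw [← continuousOn_univ]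
    refine continuousOn_integral_of_compact_support (k := tsupport f) f.hasCompactSupport ?_ ?_
    · refine Continuous.continuousOn ?_
      exact (f.continuous.comp continuous_snd).mul (GAlgebra.continuous_act_comp continuous_snd
        (g.continuous.comp (continuous_snd.inv.mul continuous_fst)))
    · intro s t _ ht
      simp [image_eq_zero_of_notMem_tsupport ht]
  hasCompactSupport' := by
    refine HasCompactSupport.intro' (K := closure (tsupport f * tsupport g))
      (f.hasCompactSupport.isCompact.mul g.hasCompactSupport.isCompact).closure isClosed_closure ?_
    intro s hs
    rw [integral_eq_zero_of_ae]
    refine Filter.Eventually.of_forall fun t => ?_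
    by_cases ht : t ∈ tsupport f
    · have : t⁻¹ * s ∉ tsupport g := fun h =>
        hs (subset_closure ⟨t, ht, t⁻¹ * s, h, by simp⟩)
      simp [image_eq_zero_of_notMem_tsupport this]
    · simp [image_eq_zero_of_notMem_tsupport ht]

/-- The involution `f⋆(s) = Δ(s)⁻¹ α_s(f(s⁻¹)⋆)` on `C_c(G, A)`. Here `Δ(s) = m(E s) / m(E)` is the
modular function; `Measure.modularCharacterFun s = m(E s⁻¹) / m(E)` is `Δ(s)⁻¹`. -/
def invol {A : GAlgebra G} (f : C_c(G, A)) : C_c(G, A) where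
  toFun s := (Measure.modularCharacterFun s : ℝ) • A.act s (star (f s⁻¹))
  continuous_toFun := continuous_modularCharacterFun.smul
    (GAlgebra.continuous_act_comp continuous_id (f.continuous.comp continuous_inv).star)
  hasCompactSupport' := by
    refine HasCompactSupport.intro' (K := (tsupport f)⁻¹) f.hasCompactSupport.isCompact.inv
      (isClosed_tsupport f).inv fun s hs => ?_
    have : f s⁻¹ = 0 := image_eq_zero_of_notMem_tsupport fun h => hs h
    simp [this]

end Convolution

section CrossedProducts

variable {G : Type u} [Group G] [TopologicalSpace G] [IsTopologicalGroup G] [LocallyCompactSpace G]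
  [MeasurableSpace G] [BorelSpace G]

/-! ### The maximal and the reduced norm on `C_c(G, A)` -/

/-- A covariant representation `(π, U)` of a `G`-algebra on a Hilbert space. -/
structure CovariantRep (A : GAlgebra G) (H : Type u) [NormedAddCommGroup H] [InnerProductSpace ℂ H]
    [CompleteSpace H] where
  rep : A →⋆ₙₐ[ℂ] (H →L[ℂ] H)
  U : G →* unitary (H →L[ℂ] H)
  continuous_U : ∀ ξ : H, Continuous fun g : G => (U g : H →L[ℂ] H) ξ
  covariant : ∀ (g : G) (a : A),
    rep (A.act g a) = (U g : H →L[ℂ] H) * rep a * star (U g : H →L[ℂ] H)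

/-- The integrated form `(π ⋊ U)(f) ξ = ∫ π(f(t)) U_t ξ dt`. -/
def CovariantRep.integrated (m : Measure G) {A : GAlgebra G} {H : Type u} [NormedAddCommGroup H]
    [InnerProductSpace ℂ H] [CompleteSpace H] (V : CovariantRep A H) (f : C_c(G, A)) (ξ : H) : H :=
  ∫ t, V.rep (f t) ((V.U t : H →L[ℂ] H) ξ) ∂m

/-- The maximal norm: the supremum of the operator norms `‖(π ⋊ U)(f)‖` over all covariant
representations `(π, U)` on Hilbert spaces. -/
def maxNorm (m : Measure G) (A : GAlgebra G) (f : C_c(G, A)) : ℝ :=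
  sSup {r : ℝ | ∃ (H : Type u) (_ : NormedAddCommGroup H) (_ : InnerProductSpace ℂ H)
    (_ : CompleteSpace H) (V : CovariantRep A H) (ξ : H), ‖ξ‖ ≤ 1 ∧ r = ‖V.integrated m f ξ‖}

/-- For a representation `π` of `A` on `H`, the regular covariant representation `(π̃, λ)` on
`L²(G, H)` is `(π̃(a) ξ)(s) = π(α_{s⁻¹}(a)) ξ(s)` and `(λ_t ξ)(s) = ξ(t⁻¹ s)`. This is its integrated
form at `f`, applied to a vector `ξ` of the dense subspace `C_c(G, H)` of `L²(G, H)`. -/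
def regularRep (m : Measure G) {A : GAlgebra G} {H : Type u} [NormedAddCommGroup H]
    [InnerProductSpace ℂ H] [CompleteSpace H] (π : A →⋆ₙₐ[ℂ] (H →L[ℂ] H)) (f : C_c(G, A))
    (ξ : C_c(G, H)) (s : G) : H :=
  ∫ t, π (A.act s⁻¹ (f t)) (ξ (t⁻¹ * s)) ∂m

/-- The `L²(G, H)`-norm of an `H`-valued function. -/
def l2Norm (m : Measure G) {H : Type u} [NormedAddCommGroup H] (ξ : G → H) : ℝ :=
  Real.sqrt (∫ s, ‖ξ s‖ ^ 2 ∂m)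

/-- The reduced norm: the supremum, over all representations `π` of `A` on Hilbert spaces, of the
operator norm of `f` in the regular covariant representation induced from `π`. -/
def redNorm (m : Measure G) (A : GAlgebra G) (f : C_c(G, A)) : ℝ :=
  sSup {r : ℝ | ∃ (H : Type u) (_ : NormedAddCommGroup H) (_ : InnerProductSpace ℂ H)
    (_ : CompleteSpace H) (π : A →⋆ₙₐ[ℂ] (H →L[ℂ] H)) (ξ : C_c(G, H)),
    l2Norm m ξ ≤ 1 ∧ r = l2Norm m (regularRep m π f ξ)}

/-! ### Completions of `C_c(G, A)` and crossed-product functors -/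

/-- A C⋆-algebra with a ⋆-homomorphism of the convolution algebra `C_c(G, A)` onto a dense
⋆-subalgebra of it, that is, the completion of `C_c(G, A)` in the C⋆-seminorm `f ↦ ‖ι f‖`. -/
structure Completion (m : Measure G) [m.IsHaarMeasure] (A : GAlgebra G) where
  carrier : Type u
  [cstar : NonUnitalCStarAlgebra carrier]
  ι : C_c(G, A) →ₗ[ℂ] carrier
  ι_conv : ∀ f g : C_c(G, A), ι (conv m f g) = ι f * ι g
  ι_invol : ∀ f : C_c(G, A), ι (invol f) = star (ι f)
  dense_ι : DenseRange ι

attribute [instance] Completion.cstar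

instance (m : Measure G) [m.IsHaarMeasure] (A : GAlgebra G) : CoeSort (Completion m A) (Type u) :=
  ⟨Completion.carrier⟩

/-- `D` is the completion of `C_c(G, A)` in the norm `N`. -/
def Completion.IsFor {m : Measure G} [m.IsHaarMeasure] {A : GAlgebra G} (D : Completion m A)
    (N : C_c(G, A) → ℝ) : Prop :=
  ∀ f, ‖D.ι f‖ = N f

/-- The identity of `C_c(G, A)` extends to a ⋆-homomorphism `D → D'` (unique by density, the
canonical quotient map), and this map is an isomorphism. -/
def Completion.CanonicalMapIsIso {m : Measure G} [m.IsHaarMeasure] {A : GAlgebra G}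
    (D D' : Completion m A) : Prop :=
  ∃ q : D →⋆ₙₐ[ℂ] D', (∀ f, q (D.ι f) = D'.ι f) ∧ Function.Bijective q

/-- A crossed-product functor for `G`: to every `G`-algebra `A` it assigns a completion `A ⋊_μ G` of
`C_c(G, A)` in a C⋆-norm between the reduced and the maximal norm, in such a way that for every
equivariant ⋆-homomorphism `φ : A → B` the map `f ↦ φ ∘ f` extends to a ⋆-homomorphism
`A ⋊_μ G → B ⋊_μ G`. (By density the extension is unique, so functoriality is automatic.) -/
structure CrossedProductFunctor (m : Measure G) [m.IsHaarMeasure] where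
  obj : ∀ A : GAlgebra G, Completion m A
  map : ∀ {A B : GAlgebra G}, GHom A B → (obj A →⋆ₙₐ[ℂ] obj B)
  map_ι : ∀ {A B : GAlgebra G} (φ : GHom A B) (f : C_c(G, A)),
    map φ ((obj A).ι f) = (obj B).ι (φ.compCc f)
  redNorm_le : ∀ (A : GAlgebra G) (f : C_c(G, A)), redNorm m A f ≤ ‖(obj A).ι f‖
  le_maxNorm : ∀ (A : GAlgebra G) (f : C_c(G, A)), ‖(obj A).ι f‖ ≤ maxNorm m A f

/-- `j : I → A` identifies the `G`-algebra `I` with a (closed, two-sided, `G`-invariant) ideal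
of `A`. -/
def GHom.IsIdealInclusion {I A : GAlgebra G} (j : GHom I A) : Prop :=
  Function.Injective j.toHom ∧
    ∀ (a : A) (x : I), (∃ y, j.toHom y = a * j.toHom x) ∧ ∃ y, j.toHom y = j.toHom x * a

/-- `0 → I → A → B → 0` is a short exact sequence of `G`-algebras. -/
def IsShortExact {I A B : GAlgebra G} (j : GHom I A) (p : GHom A B) : Prop :=
  Function.Injective j.toHom ∧ (∀ a : A, p.toHom a = 0 ↔ a ∈ Set.range j.toHom) ∧
    Function.Surjective p.toHom

namespace CrossedProductFunctor

variable {m : Measure G} [m.IsHaarMeasure]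

/-- The ideal property: `I ⋊_μ G → A ⋊_μ G` is injective for every `G`-invariant ideal `I` of a
`G`-algebra `A`. -/
def IdealProperty (μ : CrossedProductFunctor m) : Prop :=
  ∀ {I A : GAlgebra G} (j : GHom I A), j.IsIdealInclusion → Function.Injective (μ.map j)

/-- Exactness: `0 → I ⋊_μ G → A ⋊_μ G → B ⋊_μ G → 0` is exact for every short exact sequence
`0 → I → A → B → 0` of `G`-algebras. -/
def IsExact (μ : CrossedProductFunctor m) : Prop :=
  ∀ {I A B : GAlgebra G} (j : GHom I A) (p : GHom A B), IsShortExact j p →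
    Function.Injective (μ.map j) ∧ (∀ x, μ.map p x = 0 ↔ x ∈ Set.range (μ.map j)) ∧
      Function.Surjective (μ.map p)

/-- `μ` is the reduced crossed-product functor `A ↦ A ⋊_r G`. -/
def IsReduced (μ : CrossedProductFunctor m) : Prop :=
  ∀ A : GAlgebra G, (μ.obj A).IsFor (redNorm m A)

/-- `μ` is the smallest exact crossed-product functor. -/
def IsSmallestExact (μ : CrossedProductFunctor m) : Prop :=
  μ.IsExact ∧ ∀ ν : CrossedProductFunctor m, ν.IsExact →
    ∀ (A : GAlgebra G) (f : C_c(G, A)), ‖(μ.obj A).ι f‖ ≤ ‖(ν.obj A).ι f‖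

/-- `I ⋊_{μ,C} G` for `I = ker π`: the closure of `C_c(G, I)` in `C ⋊_μ G`. -/
def kernelClosure (μ : CrossedProductFunctor m) {C A : GAlgebra G} (π : GHom C A) :
    Submodule ℂ (μ.obj C) :=
  (Submodule.span ℂ ((μ.obj C).ι '' {k | ∀ s, π.toHom (k s) = 0})).topologicalClosure

/-- The `π`-norm of `f ∈ C_c(G, A)`, for an equivariant surjection `π : C → A` with kernel `I`: the
norm in `(C ⋊_μ G) / (I ⋊_{μ,C} G)` of the class of a lift `F ∈ C_c(G, C)` of `f`. Lifts exist, and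
two of them differ by an element of `C_c(G, I)`, so that the infimum is over a single number. -/
def piNorm (μ : CrossedProductFunctor m) {C A : GAlgebra G} (π : GHom C A) (f : C_c(G, A)) : ℝ :=
  sInf {r : ℝ | ∃ F : C_c(G, C), π.compCc F = f ∧
    r = ‖(Submodule.Quotient.mk ((μ.obj C).ι F) : μ.obj C ⧸ μ.kernelClosure π)‖}

/-- The `E(μ)`-norm on `C_c(G, A)`: the supremum of the `π`-norms over all equivariant surjections
`π : C → A`. The completion of `C_c(G, A)` in this norm is `A ⋊_{E(μ)} G`. -/
def epsNorm (μ : CrossedProductFunctor m) (A : GAlgebra G) (f : C_c(G, A)) : ℝ :=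
  sSup {r : ℝ | ∃ (C : GAlgebra G) (π : GHom C A),
    Function.Surjective π.toHom ∧ r = μ.piNorm π f}

end CrossedProductFunctor

end CrossedProducts

end CrossedProducts

end

open MeasureTheory Topology
open scoped CompactlySupported Pointwise

noncomputable section

namespace CrossedProducts

open Filter

set_option linter.unusedSectionVars false

/-! Scalars. An equivariant surjection `π : C → ℂ` extends to the unitization `C~`, where it is
split by the unit. For `F ∈ C_c(G, C)` let `S` be `π ∘ F` viewed as a function with values in the
multiples of `1 ∈ C~`. Then `F - S` has values in the kernel of the extended character, so `(F - S)
* e ∈ C_c(G, ker π)` for every `e ∈ C_c(G, C)`. Hence the class of `F` modulo `ker π ⋊ G` has norm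
at most `‖F - (F - S) * e‖ ≤ ‖F - F * e‖ + ‖S‖ ‖e‖`. These norms may be taken in `C~ ⋊_μ G`, which
contains `C ⋊_μ G` by the ideal property. Along an approximate unit the bound becomes `‖S‖ ≤ ‖π ∘
F‖_μ`; the identity of `ℂ`, as one of the surjections, gives the converse (`epsNorm_scalars`). The
reduced functor has the ideal property because representations of an ideal extend to the whole
algebra (`exists_rep_extension`).

Smallest exact functor. The reduced norm is a lower bound for every functor, so one exact functor
whose norm on `C_c(G)` is at most the reduced norm suffices. In the role of `E(r)` stands the
functor of the supremum norm over `epsReps A`, the covariant representations of `A` dominated by the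
reduced norm of some `C` that surjects onto `A`. Fibre products make it functorial
(`pullback_mem_epsReps`). On `ℂ` such a representation kills `C_c(G, ker π)`, so the splitting
argument bounds it by the reduced norm (`norm_op_le_redNorm_of_mem_epsReps`).

Exactness. For an ideal `I` of `A`, a representation of `I` dominated through `C → I` is extended to
`A`; it is dominated through the algebra of bounded families in `C` whose images converge strictly
to an element of `A` (`extension_mem_epsReps`). In the middle, suppose that `f ∈ C_c(G, A)` is far
from `I ⋊ G`. Representations that detect `f - f * e`, for `e` in an approximate unit of `I ⋊ G`,
have an ultraproduct containing a vector on which `f⋆` is large, in a part annihilated by `I`; that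
part is a representation of `A / I` in `epsReps` (`exists_norm_ι_sub_lt`). The same estimate gives
surjectivity by successive approximation. -/

/-! ### Convergence of bounded families of linear maps on compact sets -/

/-- A uniformly bounded family of additive maps which tends to zero pointwise on a compact set does
so uniformly. -/
lemma eventually_forall_norm_lt_of_isCompact {Λ E F : Type*} [SeminormedAddCommGroup E]
    [SeminormedAddCommGroup F] {l : Filter Λ} {L : Λ → E → F} {M : ℝ}
    (hL : ∀ i x y, ‖L i x - L i y‖ ≤ M * ‖x - y‖) {K : Set E} (hK : IsCompact K)
    (h : ∀ x ∈ K, Tendsto (fun i => L i x) l (𝓝 0)) {ε : ℝ} (hε : 0 < ε) :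
    ∀ᶠ i in l, ∀ x ∈ K, ‖L i x‖ < ε := by
  refine hK.induction_on (p := fun S => ∀ᶠ i in l, ∀ x ∈ S, ‖L i x‖ < ε) (by simp)
    (fun s t hst ht => ht.mono fun i hi x hx => hi x (hst hx))
    (fun s t hs ht => (hs.and ht).mono fun i hi x hx => hx.elim (hi.1 x) (hi.2 x)) fun x hx => ?_
  have hM : 0 < |M| + 1 := by positivity
  refine ⟨Metric.ball x (ε / 2 / (|M| + 1)), mem_nhdsWithin_of_mem_nhds
    (Metric.ball_mem_nhds x (by positivity)), ?_⟩
  filter_upwards [(tendsto_zero_iff_norm_tendsto_zero.1 (h x hx)).eventually_lt_const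
    (half_pos hε)] with i hi y hy
  have h1 : ‖L i y - L i x‖ < ε / 2 := by
    rw [Metric.mem_ball, dist_eq_norm, lt_div_iff₀ hM] at hy
    calc _ ≤ M * ‖y - x‖ := hL i y x
      _ ≤ |M| * ‖y - x‖ := by gcongr; exact le_abs_self M
      _ ≤ ‖y - x‖ * (|M| + 1) := by nlinarith [norm_nonneg (y - x)]
      _ < _ := hy
  calc ‖L i y‖ = ‖(L i y - L i x) + L i x‖ := by simp
    _ ≤ ‖L i y - L i x‖ + ‖L i x‖ := norm_add_le _ _
    _ < ε := by linarith

/-! ### Elementary operations on `C_c(G, A)` and the modular substitution. -/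

section Functions

variable {G : Type u} [Group G] [TopologicalSpace G]

@[simp]
lemma GHom.compCc_apply {A B : GAlgebra G} (φ : GHom A B) (f : C_c(G, A)) (s : G) :
    φ.compCc f s = φ.toHom (f s) := rfl

lemma GHom.norm_apply_le {A B : GAlgebra G} (φ : GHom A B) (a : A) : ‖φ.toHom a‖ ≤ ‖a‖ :=
  NonUnitalStarAlgHom.norm_apply_le φ.toHom a

@[simp]
lemma GAlgebra.norm_act (A : GAlgebra G) (g : G) (a : A) : ‖A.act g a‖ = ‖a‖ :=
  StarAlgEquiv.norm_map _ a

@[simp]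
lemma GAlgebra.act_inv_act (A : GAlgebra G) (g : G) (a : A) : A.act g⁻¹ (A.act g a) = a := by
  have : (A.act g⁻¹ * A.act g) a = a := by rw [← map_mul]; simp
  exact this

@[simp]
lemma GAlgebra.act_act_inv (A : GAlgebra G) (g : G) (a : A) : A.act g (A.act g⁻¹ a) = a := by
  have : (A.act g * A.act g⁻¹) a = a := by rw [← map_mul]; simp
  exact this

lemma GAlgebra.act_mul_apply (A : GAlgebra G) (g h : G) (a : A) :
    A.act (g * h) a = A.act g (A.act h a) := by
  rw [map_mul]; rfl

@[simp]
lemma GAlgebra.act_one_apply (A : GAlgebra G) (a : A) : A.act 1 a = a := by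
  rw [map_one]; rfl

/-- Identity homomorphism. -/
def GHom.id (A : GAlgebra G) : GHom A A := ⟨NonUnitalStarAlgHom.id ℂ A, fun _ _ => rfl⟩

/-- Composition of equivariant homomorphisms. -/
def GHom.comp {A B C : GAlgebra G} (ψ : GHom B C) (φ : GHom A B) : GHom A C :=
  ⟨ψ.toHom.comp φ.toHom, fun g a => by simp [φ.map_act, ψ.map_act]⟩

@[simp]
lemma GHom.id_apply (A : GAlgebra G) (a : A) : (GHom.id A).toHom a = a := rfl

@[simp]
lemma GHom.comp_apply {A B C : GAlgebra G} (ψ : GHom B C) (φ : GHom A B) (a : A) :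
    (ψ.comp φ).toHom a = ψ.toHom (φ.toHom a) := rfl

lemma GHom.compCc_comp {A B C : GAlgebra G} (ψ : GHom B C) (φ : GHom A B) (f : C_c(G, A)) :
    (ψ.comp φ).compCc f = ψ.compCc (φ.compCc f) := rfl

@[simp]
lemma GHom.compCc_id {A : GAlgebra G} (f : C_c(G, A)) : (GHom.id A).compCc f = f := rfl

lemma GHom.compCc_add {A B : GAlgebra G} (φ : GHom A B) (f g : C_c(G, A)) :
    φ.compCc (f + g) = φ.compCc f + φ.compCc g := by ext; simp

lemma GHom.compCc_sub {A B : GAlgebra G} (φ : GHom A B) (f g : C_c(G, A)) :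
    φ.compCc (f - g) = φ.compCc f - φ.compCc g := by ext; simp

lemma GHom.compCc_smul {A B : GAlgebra G} (φ : GHom A B) (c : ℂ) (f : C_c(G, A)) :
    φ.compCc (c • f) = c • φ.compCc f := by ext; simp

/-- Composition with an equivariant homomorphism as a linear map. -/
def GHom.compCcL {A B : GAlgebra G} (φ : GHom A B) : C_c(G, A) →ₗ[ℂ] C_c(G, B) where
  toFun := φ.compCc
  map_add' := φ.compCc_add
  map_smul' := φ.compCc_smul

/-- Left multiplication of `f ∈ C_c(G, A)` by an element of `A`. -/
def lmul {A : GAlgebra G} (a : A) (f : C_c(G, A)) : C_c(G, A) where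
  toFun s := a * f s
  continuous_toFun := continuous_const.mul f.continuous
  hasCompactSupport' := f.hasCompactSupport.mul_left

@[simp]
lemma lmul_apply {A : GAlgebra G} (a : A) (f : C_c(G, A)) (s : G) : lmul a f s = a * f s := rfl

/-- The function `s ↦ φ(s) a`. -/
def tensor {E : Type*} [NormedAddCommGroup E] [NormedSpace ℂ E] (φ : C_c(G, ℂ)) (a : E) :
    C_c(G, E) where
  toFun s := φ s • a
  continuous_toFun := φ.continuous.smul continuous_const
  hasCompactSupport' := φ.hasCompactSupport.smul_right

variable [IsTopologicalGroup G]

/-- The left translation `(λ_g f)(s) = α_g(f(g⁻¹ s))` on `C_c(G, A)`. -/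
def transl {A : GAlgebra G} (g : G) (f : C_c(G, A)) : C_c(G, A) where
  toFun s := A.act g (f (g⁻¹ * s))
  continuous_toFun := GAlgebra.continuous_act_comp continuous_const
    (f.continuous.comp (continuous_const.mul continuous_id))
  hasCompactSupport' := by
    have : HasCompactSupport fun s => f (g⁻¹ * s) :=
      f.hasCompactSupport.comp_homeomorph (Homeomorph.mulLeft g⁻¹)
    exact this.comp_left (g := A.act g) (map_zero _)

@[simp]
lemma transl_apply {A : GAlgebra G} (g : G) (f : C_c(G, A)) (s : G) :
    transl g f s = A.act g (f (g⁻¹ * s)) := rfl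

variable [MeasurableSpace G] [BorelSpace G] (m : Measure G) [m.IsHaarMeasure]

lemma integrable_Cc {E : Type*} [NormedAddCommGroup E] (f : C_c(G, E)) : Integrable f m :=
  f.continuous.integrable_of_hasCompactSupport f.hasCompactSupport

/-- The `L¹`-norm. -/
def l1 {E : Type*} [NormedAddCommGroup E] (f : C_c(G, E)) : ℝ := ∫ t, ‖f t‖ ∂m

lemma l1_nonneg {E : Type*} [NormedAddCommGroup E] (f : C_c(G, E)) : 0 ≤ l1 m f :=
  integral_nonneg fun _ => norm_nonneg _

/-- Substitution `s ↦ s⁻¹` in the Haar integral. -/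
lemma integral_modular_inv [LocallyCompactSpace G] {h : G → ℂ} (hc : Continuous h)
    (hs : HasCompactSupport h) :
    ∫ s, (Measure.modularCharacterFun s : ℝ) • h s⁻¹ ∂m = ∫ s, h s ∂m := by
  obtain ⟨⟨g, g_cont⟩, g_comp, g_nonneg, g_one⟩ :
    ∃ f : C(G, ℝ), HasCompactSupport f ∧ 0 ≤ f ∧ f 1 ≠ 0 := exists_continuous_nonneg_pos 1
  replace g_comp : HasCompactSupport g := g_comp
  have hne : ∫ x, g x ∂m ≠ 0 :=
    ne_of_gt (g_cont.integral_pos_of_hasCompactSupport_nonneg_nonzero g_comp g_nonneg g_one)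
  have hD : ∀ y, ∫ x, g (x * y) ∂m = Measure.modularCharacterFun y * ∫ x, g x ∂m := fun y => by
    rw [Measure.modularCharacterFun_eq_haarScalarFactor m y,
      Measure.haarScalarFactor_eq_integral_div _ _ g_cont g_comp hne,
      integral_map (AEMeasurable.mul_const aemeasurable_id' _) g_cont.aestronglyMeasurable]
    field_simp
  have real : ∀ f : G → ℝ, Continuous f → HasCompactSupport f →
      ∫ s, (Measure.modularCharacterFun s : ℝ) * f s⁻¹ ∂m = ∫ s, f s ∂m := fun f fc fs => by
    -- `m.inv` is right invariant. Written over `m`, the inner integral is one of a right translate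
    -- of `g`, which `hD` evaluates; this is where the modular function enters.
    have key := Measure.integral_isMulLeftInvariant_isMulRightInvariant_combo (μ := m)
      (ν := m.inv) fc fs g_cont g_comp g_nonneg g_one
    have h1 : ∀ F : G → ℝ, ∫ x, F x ∂m.inv = ∫ x, F x⁻¹ ∂m := fun F => by
      rw [Measure.inv_def]
      exact (Homeomorph.inv G).measurableEmbedding.integral_map F
    simp only [h1, inv_inv, hD] at key
    rw [key, ← integral_mul_const]
    congr 1
    ext y
    have h2 : (Measure.modularCharacterFun y : ℝ) * Measure.modularCharacterFun y⁻¹ = 1 := by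
      have := Measure.modularCharacterFun_map_mul y y⁻¹
      rw [mul_inv_cancel, Measure.modularCharacterFun_map_one] at this
      exact_mod_cast this.symm
    have h3 : (Measure.modularCharacterFun y⁻¹ : ℝ) ≠ 0 := right_ne_zero_of_mul_eq_one h2
    field_simp
    linear_combination f y⁻¹ * h2
  have hi : Integrable h m := hc.integrable_of_hasCompactSupport hs
  have hj : Integrable (fun s => (Measure.modularCharacterFun s : ℝ) • h s⁻¹) m := by
    refine (continuous_modularCharacterFun.smul (hc.comp
      continuous_inv)).integrable_of_hasCompactSupport ?_
    exact (hs.comp_homeomorph (Homeomorph.inv G)).smul_left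
  apply Complex.ext
  · have h1 := real (fun s => (h s).re) (Complex.continuous_re.comp hc)
      (hs.comp_left Complex.zero_re)
    have h2 := integral_re hi
    have h3 := integral_re hj
    simp only [RCLike.re_eq_complex_re, Complex.smul_re, smul_eq_mul] at h2 h3
    rw [← h2, ← h3, h1]
  · have h1 := real (fun s => (h s).im) (Complex.continuous_im.comp hc)
      (hs.comp_left Complex.zero_im)
    have h2 := integral_im hi
    have h3 := integral_im hj
    simp only [RCLike.im_eq_complex_im, Complex.smul_im, smul_eq_mul] at h2 h3
    rw [← h2, ← h3, h1]

end Functions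

/-! ### The integrated form of a covariant representation -/

section Integrated

variable {G : Type u} [Group G] [TopologicalSpace G] [IsTopologicalGroup G] [LocallyCompactSpace G]
  [MeasurableSpace G] [BorelSpace G]
  {A : GAlgebra G} {H : Type u} [NormedAddCommGroup H] [InnerProductSpace ℂ H] [CompleteSpace H]

/-- A ⋆-homomorphism of C⋆-algebras as a continuous linear map. -/
def homCLM {A B : Type*} [NonUnitalCStarAlgebra A] [NonUnitalCStarAlgebra B] (φ : A →⋆ₙₐ[ℂ] B) :
    A →L[ℂ] B :=
  LinearMap.mkContinuous ⟨⟨φ, map_add φ⟩, map_smul φ⟩ 1 fun a => by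
    simpa using NonUnitalStarAlgHom.norm_apply_le φ a

@[simp]
lemma homCLM_apply {A B : Type*} [NonUnitalCStarAlgebra A] [NonUnitalCStarAlgebra B]
    (φ : A →⋆ₙₐ[ℂ] B) (a : A) : homCLM φ a = φ a := rfl

namespace CovariantRep

variable (V : CovariantRep A H)

@[simp]
lemma norm_U_apply (g : G) (ξ : H) : ‖(V.U g : H →L[ℂ] H) ξ‖ = ‖ξ‖ :=
  Unitary.norm_map (V.U g) ξ

lemma U_mul_apply (g h : G) (ξ : H) :
    (V.U (g * h) : H →L[ℂ] H) ξ = (V.U g : H →L[ℂ] H) ((V.U h : H →L[ℂ] H) ξ) := by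
  rw [map_mul]; rfl

lemma star_U (g : G) : star (V.U g : H →L[ℂ] H) = (V.U g⁻¹ : H →L[ℂ] H) := by
  rw [map_inv, ← Unitary.star_eq_inv, Unitary.coe_star]

@[simp]
lemma U_inv_U_apply (g : G) (ξ : H) : (V.U g⁻¹ : H →L[ℂ] H) ((V.U g : H →L[ℂ] H) ξ) = ξ := by
  rw [← U_mul_apply]; simp

lemma norm_rep_apply_le (a : A) (ξ : H) : ‖V.rep a ξ‖ ≤ ‖a‖ * ‖ξ‖ :=
  ((V.rep a).le_opNorm ξ).trans (by gcongr; exact NonUnitalStarAlgHom.norm_apply_le V.rep a)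

lemma rep_act_apply (g : G) (a : A) (ξ : H) :
    V.rep (A.act g a) ((V.U g : H →L[ℂ] H) ξ) = (V.U g : H →L[ℂ] H) (V.rep a ξ) := by
  rw [V.covariant, V.star_U]
  exact congrArg (fun x => (V.U g : H →L[ℂ] H) (V.rep a x)) (V.U_inv_U_apply g ξ)

lemma continuous_rep_comp {X : Type*} [TopologicalSpace X] {a : X → A} {ξ : X → H}
    (ha : Continuous a) (hξ : Continuous ξ) : Continuous fun x => V.rep (a x) (ξ x) :=
  ((homCLM V.rep).continuous.comp ha).clm_apply hξ

lemma continuous_integrand (f : C_c(G, A)) (ξ : H) :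
    Continuous fun t => V.rep (f t) ((V.U t : H →L[ℂ] H) ξ) :=
  V.continuous_rep_comp f.continuous (V.continuous_U ξ)

lemma hasCompactSupport_integrand (f : C_c(G, A)) (ξ : H) :
    HasCompactSupport fun t => V.rep (f t) ((V.U t : H →L[ℂ] H) ξ) :=
  HasCompactSupport.intro' f.hasCompactSupport.isCompact (isClosed_tsupport f) fun t ht => by
    simp [image_eq_zero_of_notMem_tsupport ht]

variable (m : Measure G) [m.IsHaarMeasure]

lemma integrable_integrand (f : C_c(G, A)) (ξ : H) :
    Integrable (fun t => V.rep (f t) ((V.U t : H →L[ℂ] H) ξ)) m :=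
  (V.continuous_integrand f ξ).integrable_of_hasCompactSupport (V.hasCompactSupport_integrand f ξ)

lemma norm_integrated_le (f : C_c(G, A)) (ξ : H) : ‖V.integrated m f ξ‖ ≤ l1 m f * ‖ξ‖ := by
  rw [l1, ← integral_mul_const]
  refine norm_integral_le_of_norm_le ((integrable_Cc m f).norm.mul_const _)
    (Eventually.of_forall fun t => ?_)
  simpa using V.norm_rep_apply_le (f t) ((V.U t : H →L[ℂ] H) ξ)

/-- The integrated form as a bounded operator, depending linearly on `f`. -/
def op : C_c(G, A) →ₗ[ℂ] (H →L[ℂ] H) where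
  toFun f := LinearMap.mkContinuous
    { toFun := V.integrated m f
      map_add' := fun ξ η => by
        simp only [integrated, map_add]
        exact integral_add (V.integrable_integrand m f ξ) (V.integrable_integrand m f η)
      map_smul' := fun c ξ => by
        simp only [integrated, map_smul]
        exact integral_smul c _ } (l1 m f) (V.norm_integrated_le m f)
  map_add' f g := by
    ext ξ
    simp only [LinearMap.mkContinuous_apply, LinearMap.coe_mk, AddHom.coe_mk, integrated,
      CompactlySupportedContinuousMap.add_apply, map_add, add_apply]
    exact integral_add (V.integrable_integrand m f ξ) (V.integrable_integrand m g ξ)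
  map_smul' c f := by
    ext ξ
    simp only [LinearMap.mkContinuous_apply, LinearMap.coe_mk, AddHom.coe_mk, integrated,
      CompactlySupportedContinuousMap.smul_apply, map_smul, smul_apply,
      RingHom.id_apply]
    exact integral_smul c _

lemma op_apply (f : C_c(G, A)) (ξ : H) :
    V.op m f ξ = ∫ t, V.rep (f t) ((V.U t : H →L[ℂ] H) ξ) ∂m := rfl

lemma norm_op_le (f : C_c(G, A)) : ‖V.op m f‖ ≤ l1 m f :=
  LinearMap.mkContinuous_norm_le _ (l1_nonneg m f) (V.norm_integrated_le m f)

lemma inner_op (f : C_c(G, A)) (η ξ : H) :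
    inner ℂ η (V.op m f ξ) = ∫ t, inner ℂ η (V.rep (f t) ((V.U t : H →L[ℂ] H) ξ)) ∂m :=
  (integral_inner (V.integrable_integrand m f ξ) η).symm

/-- Fubini and left invariance: after the swap and the substitution `s ↦ t s`, covariance pulls
`U_t` out of the inner integral. -/
lemma op_conv (f g : C_c(G, A)) : V.op m (conv m f g) = V.op m f * V.op m g := by
  ext ξ
  have h1 : ∀ s, V.rep (conv m f g s) ((V.U s : H →L[ℂ] H) ξ) =
      ∫ t, V.rep (f t) (V.rep (A.act t (g (t⁻¹ * s))) ((V.U s : H →L[ℂ] H) ξ)) ∂m := fun s => by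
    have hint : Integrable (fun t => f t * A.act t (g (t⁻¹ * s))) m := by
      refine Continuous.integrable_of_hasCompactSupport ?_ ?_
      · exact f.continuous.mul (GAlgebra.continuous_act_comp continuous_id
          (g.continuous.comp (continuous_inv.mul continuous_const)))
      · exact f.hasCompactSupport.mul_right
    have := ((ContinuousLinearMap.apply ℂ H ((V.U s : H →L[ℂ] H) ξ)).comp
      (homCLM V.rep)).integral_comp_comm hint
    simp only [ContinuousLinearMap.comp_apply, ContinuousLinearMap.apply_apply, homCLM_apply,
      map_mul, mul_apply_eq_comp] at this
    rw [this]; rfl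
  rw [mul_apply_eq_comp, op_apply, op_apply]
  simp only [h1]
  rw [integral_integral_swap_of_hasCompactSupport]
  · congr 1
    ext t
    rw [← integral_mul_left_eq_self _ t]
    simp only [inv_mul_cancel_left, U_mul_apply, rep_act_apply]
    exact ((V.rep (f t)).comp (V.U t : H →L[ℂ] H)).integral_comp_comm (V.integrable_integrand m g ξ)
  · refine V.continuous_rep_comp (f.continuous.comp continuous_snd) (V.continuous_rep_comp
      (GAlgebra.continuous_act_comp continuous_snd (g.continuous.comp
        (continuous_snd.inv.mul continuous_fst))) ((V.continuous_U ξ).comp continuous_fst))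
  · refine HasCompactSupport.intro (K := (tsupport f * tsupport g) ×ˢ tsupport f)
      ((f.hasCompactSupport.isCompact.mul g.hasCompactSupport.isCompact).prod
        f.hasCompactSupport.isCompact) ?_
    rintro ⟨s, t⟩ hst
    by_cases ht : t ∈ tsupport f
    · have : t⁻¹ * s ∉ tsupport g := fun h => hst ⟨⟨t, ht, t⁻¹ * s, h, by simp⟩, ht⟩
      simp [image_eq_zero_of_notMem_tsupport this]
    · simp [image_eq_zero_of_notMem_tsupport ht]

/-- Tested against inner products; the factor `Δ⁻¹` of the involution is exactly absorbed by the
substitution `t ↦ t⁻¹`. -/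
lemma op_invol (f : C_c(G, A)) : V.op m (invol f) = star (V.op m f) := by
  refine ContinuousLinearMap.ext fun ξ => ext_inner_left ℂ fun η => ?_
  rw [ContinuousLinearMap.star_eq_adjoint, ContinuousLinearMap.adjoint_inner_right, inner_op]
  have h1 : inner ℂ (V.op m f η) ξ =
      ∫ t, inner ℂ (V.rep (f t) ((V.U t : H →L[ℂ] H) η)) ξ ∂m := by
    rw [← inner_conj_symm, inner_op, ← integral_conj]
    simp only [inner_conj_symm]
  rw [h1]
  refine Eq.trans ?_ (integral_modular_inv m ?_ ?_)
  · congr 1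
    ext t
    have h2 : V.rep (invol f t) ((V.U t : H →L[ℂ] H) ξ) = (Measure.modularCharacterFun t : ℝ) •
        (V.U t : H →L[ℂ] H) (star (V.rep (f t⁻¹)) ξ) := by
      rw [← map_star, ← rep_act_apply]
      have : invol f t = ((Measure.modularCharacterFun t : ℝ) : ℂ) • A.act t (star (f t⁻¹)) := rfl
      rw [this, map_smul]; rfl
    have h3 : ∀ x y : H, inner ℂ x ((V.U t : H →L[ℂ] H) y) =
        inner ℂ ((V.U t⁻¹ : H →L[ℂ] H) x) y := fun x y => by
      rw [← V.star_U, ContinuousLinearMap.star_eq_adjoint, ContinuousLinearMap.adjoint_inner_left]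
    rw [h2, inner_smul_right_eq_smul, h3, ContinuousLinearMap.star_eq_adjoint,
      ContinuousLinearMap.adjoint_inner_right]
  · exact (V.continuous_integrand f η).inner continuous_const
  · exact (V.hasCompactSupport_integrand f η).comp_left (g := fun x => inner ℂ x ξ)
      (inner_zero_left ξ)

/-- Translating a vector `V.op m f ζ` amounts to translating `f`, so its orbit map is controlled by
the `L¹`-norm uniformly in the representation. -/
lemma U_mul_op (g : G) (f : C_c(G, A)) :
    (V.U g : H →L[ℂ] H) * V.op m f = V.op m (transl g f) := by
  ext ξ
  rw [mul_apply_eq_comp, op_apply, op_apply, ← integral_mul_left_eq_self (fun t => V.rep (transl g f t) _) g]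
  simp only [transl_apply, inv_mul_cancel_left, U_mul_apply, rep_act_apply]
  exact ((V.U g : H →L[ℂ] H).integral_comp_comm (V.integrable_integrand m f ξ)).symm

lemma rep_mul_op (a : A) (f : C_c(G, A)) : V.rep a * V.op m f = V.op m (lmul a f) := by
  ext ξ
  rw [mul_apply_eq_comp, op_apply, op_apply]
  simp only [lmul_apply, map_mul, mul_apply_eq_comp]
  exact ((V.rep a).integral_comp_comm (V.integrable_integrand m f ξ)).symm

/-- The covariant representation of `A` induced by one of `B` and a homomorphism `A → B`. -/
def pullback {B : GAlgebra G} (V : CovariantRep B H) (φ : GHom A B) : CovariantRep A H where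
  rep := V.rep.comp φ.toHom
  U := V.U
  continuous_U := V.continuous_U
  covariant g a := by simp [φ.map_act, V.covariant]

lemma op_pullback {B : GAlgebra G} (V : CovariantRep B H) (φ : GHom A B) (f : C_c(G, A)) :
    (V.pullback φ).op m f = V.op m (φ.compCc f) := rfl

end CovariantRep

end Integrated

/-! ### Completions of `C_c(G, A)` -/

section Completions

open scoped ENNReal

variable {G : Type u} [Group G] [TopologicalSpace G] [IsTopologicalGroup G] [LocallyCompactSpace G]
  [MeasurableSpace G] [BorelSpace G] {m : Measure G} [m.IsHaarMeasure]

lemma integrable_conv {A : GAlgebra G} (f g : C_c(G, A)) (s : G) :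
    Integrable (fun t => f t * A.act t (g (t⁻¹ * s))) m := by
  refine Continuous.integrable_of_hasCompactSupport ?_ ?_
  · exact f.continuous.mul (GAlgebra.continuous_act_comp continuous_id
      (g.continuous.comp (continuous_inv.mul continuous_const)))
  · exact f.hasCompactSupport.mul_right

lemma conv_apply {A : GAlgebra G} (f g : C_c(G, A)) (s : G) :
    conv m f g s = ∫ t, f t * A.act t (g (t⁻¹ * s)) ∂m := rfl

lemma GHom.compCc_conv {A B : GAlgebra G} (φ : GHom A B) (f g : C_c(G, A)) :
    φ.compCc (conv m f g) = conv m (φ.compCc f) (φ.compCc g) := by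
  ext s
  have := (homCLM φ.toHom).integral_comp_comm (integrable_conv (m := m) f g s)
  simp only [homCLM_apply, map_mul, φ.map_act] at this
  rw [GHom.compCc_apply, conv_apply, conv_apply, ← this]
  rfl

lemma GHom.compCc_invol {A B : GAlgebra G} (φ : GHom A B) (f : C_c(G, A)) :
    φ.compCc (invol f) = invol (φ.compCc f) := by
  ext s
  have h : ∀ {C : GAlgebra G} (k : C_c(G, C)), invol k s =
      ((Measure.modularCharacterFun s : ℝ) : ℂ) • C.act s (star (k s⁻¹)) := fun k => rfl
  rw [GHom.compCc_apply, h, h, map_smul, φ.map_act, map_star, GHom.compCc_apply]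

/-- A ⋆-homomorphism on `C_c(G, A)` which is bounded for the norm of a completion extends to it. -/
lemma Completion.exists_extension {A : GAlgebra G} (D : Completion m A) {X : Type*}
    [NonUnitalCStarAlgebra X] (T : C_c(G, A) →ₗ[ℂ] X)
    (hmul : ∀ f g, T (conv m f g) = T f * T g) (hstar : ∀ f, T (invol f) = star (T f))
    (hT : ∀ f, ‖T f‖ ≤ ‖D.ι f‖) : ∃ q : D →⋆ₙₐ[ℂ] X, ∀ f, q (D.ι f) = T f := by
  have hb : ∀ f, ‖T f‖ ≤ 1 * ‖D.ι f‖ := fun f => by simpa using hT f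
  let Q : D →L[ℂ] X := T.extendOfNorm D.ι
  have hQ : ∀ f, Q (D.ι f) = T f := LinearMap.extendOfNorm_eq D.dense_ι ⟨1, hb⟩
  refine ⟨{ toFun := Q, map_smul' := map_smul Q, map_zero' := map_zero Q, map_add' := map_add Q,
            map_mul' := ?_, map_star' := ?_ }, hQ⟩
  · intro x y
    refine D.dense_ι.induction_on₂ (p := fun x y => Q (x * y) = Q x * Q y) ?_ ?_ x y
    · exact isClosed_eq (by fun_prop) (by fun_prop)
    · intro f g
      rw [← D.ι_conv, hQ, hQ, hQ, hmul]
  · intro x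
    refine D.dense_ι.induction_on (p := fun x => Q (star x) = star (Q x)) x ?_ ?_
    · exact isClosed_eq (by fun_prop) (by fun_prop)
    · intro f
      rw [← D.ι_invol, hQ, hQ, hstar]

lemma Completion.exists_map {A B : GAlgebra G} (D : Completion m A) (D' : Completion m B)
    (φ : GHom A B) (h : ∀ f, ‖D'.ι (φ.compCc f)‖ ≤ ‖D.ι f‖) :
    ∃ q : D →⋆ₙₐ[ℂ] D', ∀ f, q (D.ι f) = D'.ι (φ.compCc f) :=
  D.exists_extension (D'.ι ∘ₗ φ.compCcL)
    (fun f g => by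
      change D'.ι (φ.compCc _) = D'.ι (φ.compCc _) * D'.ι (φ.compCc _)
      rw [φ.compCc_conv, D'.ι_conv])
    (fun f => by
      change D'.ι (φ.compCc _) = star (D'.ι (φ.compCc _))
      rw [φ.compCc_invol, D'.ι_invol]) h

lemma Completion.canonicalMapIsIso_of_norm_eq {A : GAlgebra G} {D D' : Completion m A}
    (h : ∀ f, ‖D.ι f‖ = ‖D'.ι f‖) : D.CanonicalMapIsIso D' := by
  obtain ⟨q, hq⟩ := D.exists_map D' (GHom.id A) fun f => by simp [h]
  simp only [GHom.compCc_id] at hq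
  have hqc : Continuous q := (homCLM q).continuous
  have hn : ∀ x, ‖q x‖ = ‖x‖ := fun x => by
    refine D.dense_ι.induction_on (p := fun x => ‖q x‖ = ‖x‖) x ?_ ?_
    · exact isClosed_eq (by fun_prop) (by fun_prop)
    · intro f
      rw [hq, h]
  have hiso : Isometry q := AddMonoidHomClass.isometry_of_norm q hn
  refine ⟨q, hq, hiso.injective, fun y => ?_⟩
  have h1 : IsClosed (Set.range q) := hiso.isClosedEmbedding.isClosed_range
  have h2 : Set.range D'.ι ⊆ Set.range q := by
    rintro _ ⟨f, rfl⟩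
    exact ⟨_, hq f⟩
  have h3 := closure_minimal h2 h1
  rw [D'.dense_ι.closure_range] at h3
  exact h3 trivial

/-- A covariant representation together with its Hilbert space. -/
structure Rep (A : GAlgebra G) where
  H : Type u
  [normed : NormedAddCommGroup H]
  [inner : InnerProductSpace ℂ H]
  [complete : CompleteSpace H]
  V : CovariantRep A H

attribute [instance] Rep.normed Rep.inner Rep.complete

/-- The completion of `C_c(G, A)` in the norm pulled back from a C⋆-algebra. -/
lemma exists_completion_of_hom {A : GAlgebra G} {X : Type u} [NonUnitalCStarAlgebra X]
    (T : C_c(G, A) →ₗ[ℂ] X) (hmul : ∀ f g, T (conv m f g) = T f * T g)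
    (hstar : ∀ f, T (invol f) = star (T f)) :
    ∃ D : Completion m A, ∀ f, ‖D.ι f‖ = ‖T f‖ := by
  let S₀ : NonUnitalStarSubalgebra ℂ X :=
    { carrier := Set.range T
      add_mem' := by rintro _ _ ⟨f, rfl⟩ ⟨g, rfl⟩; exact ⟨f + g, map_add T f g⟩
      zero_mem' := ⟨0, map_zero T⟩
      mul_mem' := by rintro _ _ ⟨f, rfl⟩ ⟨g, rfl⟩; exact ⟨conv m f g, hmul f g⟩
      smul_mem' := by rintro c _ ⟨f, rfl⟩; exact ⟨c • f, map_smul T c f⟩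
      star_mem' := by rintro _ ⟨f, rfl⟩; exact ⟨invol f, hstar f⟩ }
  have hcl : IsClosed (S₀.topologicalClosure : Set X) := S₀.isClosed_topologicalClosure
  let D : Completion m A :=
    { carrier := S₀.topologicalClosure
      ι := { toFun := fun f => ⟨T f, subset_closure ⟨f, rfl⟩⟩
             map_add' := fun f g => Subtype.ext (map_add T f g)
             map_smul' := fun c f => Subtype.ext (map_smul T c f) }
      ι_conv := fun f g => Subtype.ext (hmul f g)
      ι_invol := fun f => Subtype.ext (hstar f)
      dense_ι := by
        rintro ⟨x, hx⟩
        refine closure_subtype.2 ?_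
        convert (show x ∈ closure (Set.range T) from hx)
        ext y
        constructor
        · rintro ⟨_, ⟨f, rfl⟩, rfl⟩; exact ⟨f, rfl⟩
        · rintro ⟨f, rfl⟩; exact ⟨_, ⟨f, rfl⟩, rfl⟩ }
  exact ⟨D, fun f => rfl⟩

/-- The `L¹` bound puts `f ↦ (T i f)_i` into the `ℓ^∞`-product of the algebras, where the norm is
the supremum of the coordinate norms. -/
lemma exists_completion_of_family {A : GAlgebra G} {I : Type u} {E : I → Type u}
    [∀ i, NonUnitalCStarAlgebra (E i)] (T : ∀ i, C_c(G, A) →ₗ[ℂ] E i)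
    (hmul : ∀ i f g, T i (conv m f g) = T i f * T i g)
    (hstar : ∀ i f, T i (invol f) = star (T i f)) (hb : ∀ i f, ‖T i f‖ ≤ l1 m f) :
    ∃ D : Completion m A, (∀ i f, ‖T i f‖ ≤ ‖D.ι f‖) ∧
      ∀ f c, 0 ≤ c → (∀ i, ‖T i f‖ ≤ c) → ‖D.ι f‖ ≤ c := by
  have hmem : ∀ f, Memℓp (E := E) (fun i => T i f) ∞ := fun f => by
    refine memℓp_infty ⟨l1 m f, ?_⟩
    rintro _ ⟨i, rfl⟩
    exact hb i f
  let R : C_c(G, A) →ₗ[ℂ] lp E ∞ :=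
    { toFun := fun f => ⟨fun i => T i f, hmem f⟩
      map_add' := fun f g => by ext1; funext i; exact map_add (T i) f g
      map_smul' := fun c f => by ext1; funext i; exact map_smul (T i) c f }
  obtain ⟨D, hD⟩ := exists_completion_of_hom (m := m) R
    (fun f g => by ext1; funext i; exact hmul i f g) (fun f => by ext1; funext i; exact hstar i f)
  refine ⟨D, fun i f => ?_, fun f c hc h => ?_⟩
  · rw [hD]
    exact lp.norm_apply_le_norm ENNReal.top_ne_zero (R f) i
  · rw [hD]
    exact lp.norm_le_of_forall_le hc h

/-- The completion of `C_c(G, A)` in the supremum of the operator norms over a class of covariant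
representations. -/
lemma exists_completion (m : Measure G) [m.IsHaarMeasure] {A : GAlgebra G} (S : Set (Rep A)) :
    ∃ D : Completion m A, (∀ ρ ∈ S, ∀ f, ‖ρ.V.op m f‖ ≤ ‖D.ι f‖) ∧
      ∀ f c, 0 ≤ c → (∀ ρ ∈ S, ‖ρ.V.op m f‖ ≤ c) → ‖D.ι f‖ ≤ c := by
  -- `Rep A` is one universe too large to index a product. Only the norm function of a
  -- representation matters, and norm functions form a type in `Type u`.
  let I : Type u := {N : C_c(G, A) → ℝ // ∃ ρ ∈ S, ∀ f, N f = ‖ρ.V.op m f‖}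
  let ρ : I → Rep A := fun i => i.2.choose
  have hρ : ∀ i, ρ i ∈ S := fun i => i.2.choose_spec.1
  obtain ⟨D, hD, hD'⟩ := exists_completion_of_family (m := m) (fun i => (ρ i).V.op m)
    (fun i f g => (ρ i).V.op_conv m f g) (fun i f => (ρ i).V.op_invol m f)
    (fun i f => (ρ i).V.norm_op_le m f)
  refine ⟨D, fun σ hσ f => ?_, fun f c hc h => hD' f c hc fun i => h _ (hρ i)⟩
  let i : I := ⟨fun f => ‖σ.V.op m f‖, σ, hσ, fun _ => rfl⟩
  have h1 : ‖σ.V.op m f‖ = ‖(ρ i).V.op m f‖ := i.2.choose_spec.2 f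
  rw [h1]
  exact hD i f

end Completions

/-! ### Covariant representations on completions of pre-Hilbert spaces -/

section DenseConstruction

/-- The form may be degenerate, so `b` need not be injective. For this reason the relations in
`exists_covariantRep_of_dense` are only demanded after applying `b`. -/
lemma exists_hilbert_of_core {X : Type u} [AddCommGroup X] [Module ℂ X]
    (c : PreInnerProductSpace.Core ℂ X) :
    ∃ (H : Type u) (_ : NormedAddCommGroup H) (_ : InnerProductSpace ℂ H) (_ : CompleteSpace H)
      (b : X →ₗ[ℂ] H), DenseRange b ∧ ∀ x y, inner ℂ (b x) (b y) = c.inner x y := by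
  let _ : SeminormedAddCommGroup X := InnerProductSpace.Core.toSeminormedAddCommGroup (c := c)
  let _ : InnerProductSpace ℂ X := InnerProductSpace.ofCore c
  refine ⟨UniformSpace.Completion X, inferInstance, inferInstance, inferInstance,
    (UniformSpace.Completion.toComplₗᵢ (𝕜 := ℂ) (E := X)).toLinearMap,
    UniformSpace.Completion.denseRange_coe, fun x y => ?_⟩
  exact UniformSpace.Completion.inner_coe x y

variable {G : Type u} [Group G] [TopologicalSpace G] [IsTopologicalGroup G]
  {A : GAlgebra G} {H : Type u} [NormedAddCommGroup H] [InnerProductSpace ℂ H] [CompleteSpace H]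

/-- Operators on a dense subspace of a Hilbert space which satisfy the relations of a covariant
representation extend to one. -/
lemma exists_covariantRep_of_dense {X : Type u} [AddCommGroup X] [Module ℂ X] (b : X →ₗ[ℂ] H)
    (hb : DenseRange b) (R : A → X →ₗ[ℂ] X) (U : G → X →ₗ[ℂ] X)
    (R_add : ∀ a a' x, b (R (a + a') x) = b (R a x) + b (R a' x))
    (R_smul : ∀ (z : ℂ) a x, b (R (z • a) x) = z • b (R a x))
    (R_mul : ∀ a a' x, b (R (a * a') x) = b (R a (R a' x)))
    (R_star : ∀ a x y, inner ℂ (b (R (star a) x)) (b y) = inner ℂ (b x) (b (R a y)))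
    (R_bound : ∀ a x, ‖b (R a x)‖ ≤ ‖a‖ * ‖b x‖)
    (U_one : ∀ x, b (U 1 x) = b x) (U_mul : ∀ g h x, b (U (g * h) x) = b (U g (U h x)))
    (U_norm : ∀ g x, ‖b (U g x)‖ = ‖b x‖)
    (U_cont : ∀ x, Tendsto (fun g => ‖b (U g x) - b x‖) (𝓝 1) (𝓝 0))
    (cov : ∀ g a x, b (R (A.act g a) (U g x)) = b (U g (R a x))) :
    ∃ V : CovariantRep A H, (∀ a x, V.rep a (b x) = b (R a x)) ∧
      ∀ g x, (V.U g : H →L[ℂ] H) (b x) = b (U g x) := by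
  let R' : A → H →L[ℂ] H := fun a => (b ∘ₗ R a).extendOfNorm b
  have hR : ∀ a x, R' a (b x) = b (R a x) := fun a x =>
    LinearMap.extendOfNorm_eq hb ⟨‖a‖, R_bound a⟩ x
  let U' : G → H →L[ℂ] H := fun g => (b ∘ₗ U g).extendOfNorm b
  have hU : ∀ g x, U' g (b x) = b (U g x) := fun g x =>
    LinearMap.extendOfNorm_eq hb ⟨1, fun x => by simp [U_norm]⟩ x
  have ext : ∀ {S T : H →L[ℂ] H}, (∀ x, S (b x) = T (b x)) → S = T := fun {S T} h =>
    ContinuousLinearMap.ext fun ξ => congrFun (hb.equalizer S.continuous T.continuous (funext h)) ξ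
  have hU1 : U' 1 = 1 := ext fun x => by simp [hU, U_one]
  have hUm : ∀ g h, U' (g * h) = U' g * U' h := fun g h => ext fun x => by simp [hU, U_mul]
  have hUn : ∀ g ξ, ‖U' g ξ‖ = ‖ξ‖ := fun g ξ =>
    hb.induction_on (p := fun ξ => ‖U' g ξ‖ = ‖ξ‖) ξ (isClosed_eq (by fun_prop) (by fun_prop))
      fun x => by rw [hU, U_norm]
  have hUs : ∀ g, star (U' g) = U' g⁻¹ := fun g => by
    have h1 : star (U' g) * U' g = 1 :=
      (ContinuousLinearMap.norm_map_iff_adjoint_comp_self (U' g)).1 (hUn g)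
    calc star (U' g) = star (U' g) * (U' g * U' g⁻¹) := by rw [← hUm, mul_inv_cancel, hU1, mul_one]
      _ = U' g⁻¹ := by rw [← mul_assoc, h1, one_mul]
  have hU'U : ∀ g, star (U' g) * U' g = 1 ∧ U' g * star (U' g) = 1 := fun g => by
    rw [hUs, ← hUm, ← hUm]; simp [hU1]
  have hRs : ∀ a, R' (star a) = star (R' a) := fun a => by
    refine ContinuousLinearMap.ext fun ξ => ext_inner_right ℂ fun η => ?_
    rw [ContinuousLinearMap.star_eq_adjoint, ContinuousLinearMap.adjoint_inner_left]
    refine hb.induction_on₂ (p := fun ξ η => inner ℂ (R' (star a) ξ) η = inner ℂ ξ (R' a η)) ?_ ?_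
      ξ η
    · exact isClosed_eq (by fun_prop) (by fun_prop)
    · intro x y
      rw [hR, hR, R_star]
  let rep : A →⋆ₙₐ[ℂ] (H →L[ℂ] H) :=
    { toFun := R'
      map_smul' := fun z a => ext fun x => by simp [hR, R_smul]
      map_zero' := ext fun x => by
        have := R_smul 0 0 x
        simpa [hR] using this
      map_add' := fun a a' => ext fun x => by simp [hR, R_add]
      map_mul' := fun a a' => ext fun x => by simp [hR, R_mul]
      map_star' := hRs }
  let Uhom : G →* unitary (H →L[ℂ] H) :=
    { toFun := fun g => ⟨U' g, hU'U g⟩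
      map_one' := Subtype.ext hU1
      map_mul' := fun g h => Subtype.ext (hUm g h) }
  have cont1 : ∀ ξ, Tendsto (fun g => U' g ξ - ξ) (𝓝 1) (𝓝 0) := fun ξ => by
    rw [Metric.tendsto_nhds]
    intro ε hε
    obtain ⟨x, hx⟩ := hb.exists_dist_lt ξ (show 0 < ε / 3 by positivity)
    filter_upwards [(U_cont x).eventually_lt_const (show 0 < ε / 3 by positivity)] with g hg
    rw [dist_zero_right]
    rw [dist_eq_norm] at hx
    calc ‖U' g ξ - ξ‖ = ‖U' g (ξ - b x) + (b (U g x) - b x) - (ξ - b x)‖ := by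
          rw [map_sub, hU]; congr 1; abel
      _ ≤ ‖U' g (ξ - b x)‖ + ‖b (U g x) - b x‖ + ‖ξ - b x‖ :=
          (norm_sub_le _ _).trans (by gcongr; exact norm_add_le _ _)
      _ < ε := by rw [hUn]; linarith
  refine ⟨⟨rep, Uhom, fun ξ => ?_, fun g a => ?_⟩, hR, hU⟩
  · change Continuous fun g => U' g ξ
    refine continuous_iff_continuousAt.2 fun g₀ => ?_
    have h1 : Tendsto (fun g => g₀⁻¹ * g) (𝓝 g₀) (𝓝 1) := by
      have : Continuous fun g : G => g₀⁻¹ * g := by fun_prop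
      simpa using this.tendsto g₀
    have h2 := ((U' g₀).continuous.tendsto _).comp ((cont1 ξ).comp h1)
    have h3 : ∀ g, U' g₀ (U' (g₀⁻¹ * g) ξ - ξ) = U' g ξ - U' g₀ ξ := fun g => by
      rw [map_sub, ← mul_apply_eq_comp, ← hUm, mul_inv_cancel_left]
    simp only [Function.comp_def, h3, map_zero] at h2
    simpa [ContinuousAt] using h2.add_const (U' g₀ ξ)
  · change R' (A.act g a) = U' g * R' a * star (U' g)
    have : R' (A.act g a) * U' g = U' g * R' a := ext fun x => by simp [hR, hU, cov]
    rw [← this, mul_assoc, (hU'U g).2, mul_one]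

end DenseConstruction

/-! ### The regular representations and the reduced norm -/

section Regular

variable {G : Type u} [Group G] [TopologicalSpace G] [IsTopologicalGroup G] [LocallyCompactSpace G]
  [MeasurableSpace G] [BorelSpace G] (m : Measure G) [m.IsHaarMeasure]
  {A : GAlgebra G} {H : Type u} [NormedAddCommGroup H] [InnerProductSpace ℂ H] [CompleteSpace H]

lemma integrable_inner_Cc (ξ η : C_c(G, H)) : Integrable (fun s => inner ℂ (ξ s) (η s)) m := by
  refine (ξ.continuous.inner η.continuous).integrable_of_hasCompactSupport ?_
  exact HasCompactSupport.intro' ξ.hasCompactSupport.isCompact (isClosed_tsupport ξ) fun t ht => by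
    simp [image_eq_zero_of_notMem_tsupport ht]

lemma integrable_norm_sq_Cc {E : Type*} [NormedAddCommGroup E] (ξ : C_c(G, E)) :
    Integrable (fun s => ‖ξ s‖ ^ 2) m := by
  refine (ξ.continuous.norm.pow 2).integrable_of_hasCompactSupport ?_
  exact HasCompactSupport.intro' ξ.hasCompactSupport.isCompact (isClosed_tsupport ξ) fun t ht => by
    simp [image_eq_zero_of_notMem_tsupport ht]

/-- The `L²` inner product on `C_c(G, H)`. -/
@[reducible]
def l2Core (H : Type u) [NormedAddCommGroup H] [InnerProductSpace ℂ H] [CompleteSpace H] :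
    PreInnerProductSpace.Core ℂ C_c(G, H) where
  inner ξ η := ∫ s, inner ℂ (ξ s) (η s) ∂m
  conj_inner_symm ξ η := by
    rw [← integral_conj]
    simp only [inner_conj_symm]
  re_inner_nonneg ξ := by
    rw [← integral_re (integrable_inner_Cc m ξ ξ)]
    exact integral_nonneg fun s => inner_self_nonneg
  add_left ξ η ζ := by
    simp only [CompactlySupportedContinuousMap.add_apply, inner_add_left]
    exact integral_add (integrable_inner_Cc m ξ ζ) (integrable_inner_Cc m η ζ)
  smul_left ξ η z := by
    simp only [CompactlySupportedContinuousMap.smul_apply, inner_smul_left]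
    exact integral_const_mul _ _

/-- The action of `a ∈ A` in the regular representation induced from `π`, on `C_c(G, H)`. -/
def regRep (π : A →⋆ₙₐ[ℂ] (H →L[ℂ] H)) (a : A) : C_c(G, H) →ₗ[ℂ] C_c(G, H) where
  toFun ξ :=
    { toFun := fun s => π (A.act s⁻¹ a) (ξ s)
      continuous_toFun := ((homCLM π).continuous.comp ((A.continuous_act a).comp
        continuous_inv)).clm_apply ξ.continuous
      hasCompactSupport' := HasCompactSupport.intro' ξ.hasCompactSupport.isCompact
        (isClosed_tsupport ξ) fun t ht => by simp [image_eq_zero_of_notMem_tsupport ht] }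
  map_add' ξ η := by ext s; simp
  map_smul' z ξ := by ext s; simp

lemma regRep_apply (π : A →⋆ₙₐ[ℂ] (H →L[ℂ] H)) (a : A) (ξ : C_c(G, H)) (s : G) :
    regRep π a ξ s = π (A.act s⁻¹ a) (ξ s) := rfl

/-- Left translation on `C_c(G, H)`. -/
def regU (H : Type u) [NormedAddCommGroup H] [InnerProductSpace ℂ H] (g : G) :
    C_c(G, H) →ₗ[ℂ] C_c(G, H) where
  toFun ξ :=
    { toFun := fun s => ξ (g⁻¹ * s)
      continuous_toFun := ξ.continuous.comp (continuous_const.mul continuous_id)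
      hasCompactSupport' := ξ.hasCompactSupport.comp_homeomorph (Homeomorph.mulLeft g⁻¹) }
  map_add' _ _ := rfl
  map_smul' _ _ := rfl

@[simp]
lemma regU_apply (g : G) (ξ : C_c(G, H)) (s : G) : regU H g ξ s = ξ (g⁻¹ * s) := rfl

/-- Continuity of `x ↦ ∫ ‖F x s‖ ^ p` at a zero of `F`, for functions `F x` supported in translates
of a compact set. -/
lemma tendsto_integral_transl {E : Type*} [NormedAddCommGroup E] {X : Type*} [TopologicalSpace X]
    [LocallyCompactSpace X] {x₀ : X} {F : X → G → E} (hF : Continuous (Function.uncurry F))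
    {c : X → G} (hc : Continuous c) {K : Set G} (hK : IsCompact K)
    (hs : ∀ x s, (c x)⁻¹ * s ∉ K → s ∉ K → F x s = 0) (h0 : ∀ s, F x₀ s = 0) {p : ℕ} (hp : p ≠ 0) :
    Tendsto (fun x => ∫ s, ‖F x s‖ ^ p ∂m) (𝓝 x₀) (𝓝 0) := by
  obtain ⟨N, hN, hNm⟩ := exists_compact_mem_nhds x₀
  have h1 : ContinuousOn (fun x => ∫ s, ‖F x s‖ ^ p ∂m) N := by
    refine continuousOn_integral_of_compact_support (k := c '' N * K ∪ K)
      (((hN.image hc).mul hK).union hK) ((hF.norm.pow p).continuousOn) ?_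
    intro x s hx hs'
    rw [Set.mem_union, not_or] at hs'
    rw [hs x s (fun h => hs'.1 ⟨c x, ⟨x, hx, rfl⟩, _, h, by simp⟩) hs'.2]
    simp [hp]
  have h2 := (h1.continuousAt hNm).tendsto
  simpa [h0, hp] using h2

/-- The covariant representation `(π̃, λ)` on (the completion of) `C_c(G, H)`. -/
lemma exists_regular (π : A →⋆ₙₐ[ℂ] (H →L[ℂ] H)) :
    ∃ (ρ : Rep A) (b : C_c(G, H) →ₗ[ℂ] ρ.H), DenseRange b ∧ (∀ ξ, ‖b ξ‖ = l2Norm m ξ) ∧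
      ∀ f ξ, ∃ ζ : C_c(G, H), (∀ s, ζ s = regularRep m π f ξ s) ∧ ρ.V.op m f (b ξ) = b ζ := by
  obtain ⟨L, i1, i2, i3, b, hb, hin⟩ := exists_hilbert_of_core (l2Core m H)
  have hin' : ∀ ξ η : C_c(G, H), inner ℂ (b ξ) (b η) = ∫ s, inner ℂ (ξ s) (η s) ∂m := hin
  have hnorm2 : ∀ ξ, ‖b ξ‖ ^ 2 = ∫ s, ‖ξ s‖ ^ 2 ∂m := fun ξ => by
    rw [← inner_self_eq_norm_sq (𝕜 := ℂ), hin', ← integral_re (integrable_inner_Cc m ξ ξ)]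
    simp only [inner_self_eq_norm_sq]
  have hnorm : ∀ ξ, ‖b ξ‖ = l2Norm m ξ := fun ξ => by
    rw [l2Norm, ← hnorm2, Real.sqrt_sq (norm_nonneg _)]
  obtain ⟨V, hR, hU⟩ := exists_covariantRep_of_dense (A := A) b hb (regRep π) (regU H)
    (fun a a' x => by rw [← map_add]; congr 1; ext s; simp [regRep_apply])
    (fun z a x => by rw [← map_smul]; congr 1; ext s; simp [regRep_apply])
    (fun a a' x => by congr 1; ext s; simp [regRep_apply])
    (fun a x y => by
      rw [hin', hin']
      congr 1; ext s
      rw [regRep_apply, regRep_apply, map_star, map_star, ContinuousLinearMap.star_eq_adjoint,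
        ContinuousLinearMap.adjoint_inner_left])
    (fun a x => by
      rw [← abs_of_nonneg (norm_nonneg (b _)), ← abs_of_nonneg (mul_nonneg (norm_nonneg a)
        (norm_nonneg (b x))), ← sq_le_sq, mul_pow, hnorm2, hnorm2, ← integral_const_mul]
      refine integral_mono (integrable_norm_sq_Cc m _) ((integrable_norm_sq_Cc m x).const_mul _)
        fun s => ?_
      rw [← mul_pow, regRep_apply]
      gcongr
      refine ((π _).le_opNorm _).trans ?_
      gcongr
      exact (NonUnitalStarAlgHom.norm_apply_le π _).trans (A.norm_act _ _).le)
    (fun x => by congr 1; ext s; simp)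
    (fun g h x => by congr 1; ext s; simp [mul_assoc])
    (fun g x => by
      rw [← sq_eq_sq₀ (norm_nonneg _) (norm_nonneg _), hnorm2, hnorm2]
      exact integral_mul_left_eq_self (fun s => ‖x s‖ ^ 2) g⁻¹)
    (fun x => by
      have h1 : ∀ g, ‖b (regU H g x) - b x‖ = √(∫ s, ‖x (g⁻¹ * s) - x s‖ ^ 2 ∂m) := fun g => by
        rw [← map_sub, hnorm]; rfl
      simp only [h1]
      rw [← Real.sqrt_zero]
      refine (Real.continuous_sqrt.tendsto 0).comp (tendsto_integral_transl m (x₀ := (1 : G))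
        (F := fun g s => x (g⁻¹ * s) - x s) ?_ continuous_id x.hasCompactSupport.isCompact ?_ ?_ two_ne_zero)
      · exact (x.continuous.comp (continuous_fst.inv.mul continuous_snd)).sub
          (x.continuous.comp continuous_snd)
      · intro g s h h'
        rw [id_eq] at h
        rw [image_eq_zero_of_notMem_tsupport h, image_eq_zero_of_notMem_tsupport (f := x) h',
          sub_zero]
      · intro s; simp)
    (fun g a x => by
      congr 1; ext s
      rw [regRep_apply, regU_apply, regU_apply, regRep_apply, mul_inv_rev, inv_inv,
        A.act_mul_apply])
  refine ⟨⟨L, V⟩, b, hb, hnorm, fun f ξ => ?_⟩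
  have hc : Continuous (Function.uncurry fun s t : G => π (A.act s⁻¹ (f t)) (ξ (t⁻¹ * s))) :=
    ((homCLM π).continuous.comp (GAlgebra.continuous_act_comp continuous_fst.inv
      (f.continuous.comp continuous_snd))).clm_apply
      (ξ.continuous.comp (continuous_snd.inv.mul continuous_fst))
  let ζ : C_c(G, H) :=
    { toFun := regularRep m π f ξ
      continuous_toFun := by
        rw [← continuousOn_univ]
        refine continuousOn_integral_of_compact_support (k := tsupport f)
          f.hasCompactSupport.isCompact hc.continuousOn ?_
        intro s t _ ht
        simp [image_eq_zero_of_notMem_tsupport ht]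
      hasCompactSupport' := by
        refine HasCompactSupport.intro' (K := closure (tsupport f * tsupport ξ))
          (f.hasCompactSupport.isCompact.mul ξ.hasCompactSupport.isCompact).closure isClosed_closure ?_
        intro s hs
        rw [regularRep, integral_eq_zero_of_ae]
        refine Filter.Eventually.of_forall fun t => ?_
        by_cases ht : t ∈ tsupport f
        · have : t⁻¹ * s ∉ tsupport ξ := fun h =>
            hs (subset_closure ⟨t, ht, t⁻¹ * s, h, by simp⟩)
          simp [image_eq_zero_of_notMem_tsupport this]
        · simp [image_eq_zero_of_notMem_tsupport ht] }
  refine ⟨ζ, fun s => rfl, ?_⟩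
  -- Both sides are compared by inner products with the dense vectors `b η`; the two resulting
  -- double integrals agree by Fubini.
  refine ext_inner_left ℂ fun w => ?_
  refine hb.induction_on (p := fun w => inner ℂ w (V.op m f (b ξ)) = inner ℂ w (b ζ)) w
    (isClosed_eq (by fun_prop) (by fun_prop)) fun η => ?_
  have h1 : ∀ t, inner ℂ (b η) (V.rep (f t) ((V.U t : L →L[ℂ] L) (b ξ))) =
      ∫ s, inner ℂ (η s) (π (A.act s⁻¹ (f t)) (ξ (t⁻¹ * s))) ∂m := fun t => by
    rw [hU, hR, hin']
    rfl
  have h2 : ∀ s, inner ℂ (η s) (ζ s) =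
      ∫ t, inner ℂ (η s) (π (A.act s⁻¹ (f t)) (ξ (t⁻¹ * s))) ∂m := fun s => by
    refine (integral_inner (𝕜 := ℂ) ?_ (η s)).symm
    refine (hc.comp (Continuous.prodMk_right s)).integrable_of_hasCompactSupport ?_
    exact HasCompactSupport.intro' f.hasCompactSupport.isCompact (isClosed_tsupport f)
      fun t ht => by simp [image_eq_zero_of_notMem_tsupport ht]
  rw [CovariantRep.inner_op, hin']
  simp only [h1, h2]
  refine integral_integral_swap_of_hasCompactSupport ?_ ?_
  · exact (η.continuous.comp continuous_snd).inner (hc.comp (continuous_snd.prodMk continuous_fst))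
  · refine HasCompactSupport.intro' (K := tsupport f ×ˢ tsupport η)
      (f.hasCompactSupport.isCompact.prod η.hasCompactSupport.isCompact)
      ((isClosed_tsupport f).prod (isClosed_tsupport η)) ?_
    rintro ⟨t, s⟩ hst
    by_cases ht : t ∈ tsupport f
    · have : s ∉ tsupport η := fun h => hst ⟨ht, h⟩
      simp [image_eq_zero_of_notMem_tsupport this]
    · simp [image_eq_zero_of_notMem_tsupport ht]

/-- The regular covariant representations of `A`. -/
def regularReps (A : GAlgebra G) : Set (Rep A) :=
  {ρ | ∃ (H : Type u) (_ : NormedAddCommGroup H) (_ : InnerProductSpace ℂ H) (_ : CompleteSpace H)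
    (π : A →⋆ₙₐ[ℂ] (H →L[ℂ] H)) (b : C_c(G, H) →ₗ[ℂ] ρ.H), DenseRange b ∧
      (∀ ξ, ‖b ξ‖ = l2Norm m ξ) ∧
      ∀ f ξ, ∃ ζ : C_c(G, H), (∀ s, ζ s = regularRep m π f ξ s) ∧ ρ.V.op m f (b ξ) = b ζ}

lemma bddAbove_redNorm_set (A : GAlgebra G) (f : C_c(G, A)) :
    BddAbove {r : ℝ | ∃ (H : Type u) (_ : NormedAddCommGroup H) (_ : InnerProductSpace ℂ H)
      (_ : CompleteSpace H) (π : A →⋆ₙₐ[ℂ] (H →L[ℂ] H)) (ξ : C_c(G, H)),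
      l2Norm m ξ ≤ 1 ∧ r = l2Norm m (regularRep m π f ξ)} := by
  refine ⟨l1 m f, ?_⟩
  rintro _ ⟨H, _, _, _, π, ξ, hξ, rfl⟩
  obtain ⟨ρ, b, hb, hn, h⟩ := exists_regular m π
  obtain ⟨ζ, hζ, hζ'⟩ := h f ξ
  rw [← funext hζ, ← hn ζ, ← hζ']
  refine ((ρ.V.op m f).le_opNorm _).trans ?_
  calc _ ≤ l1 m f * 1 := by
        gcongr
        · exact l1_nonneg m f
        · exact ρ.V.norm_op_le m f
        · rwa [hn]
    _ = _ := mul_one _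

lemma redNorm_nonneg (A : GAlgebra G) (f : C_c(G, A)) : 0 ≤ redNorm m A f :=
  Real.sSup_nonneg (by rintro _ ⟨H, _, _, _, π, ξ, hξ, rfl⟩; exact Real.sqrt_nonneg _)

lemma norm_op_le_redNorm {ρ : Rep A} (hρ : ρ ∈ regularReps m A) (f : C_c(G, A)) :
    ‖ρ.V.op m f‖ ≤ redNorm m A f := by
  obtain ⟨H, _, _, _, π, b, hb, hn, h⟩ := hρ
  refine ContinuousLinearMap.opNorm_le_bound _ (redNorm_nonneg m A f) fun w => ?_
  refine hb.induction_on (p := fun w => ‖ρ.V.op m f w‖ ≤ redNorm m A f * ‖w‖) w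
    (isClosed_le (by fun_prop) (by fun_prop)) fun ξ => ?_
  have key : ∀ ξ, ‖b ξ‖ ≤ 1 → ‖ρ.V.op m f (b ξ)‖ ≤ redNorm m A f := fun ξ hξ => by
    obtain ⟨ζ, hζ, hζ'⟩ := h f ξ
    refine le_csSup (bddAbove_redNorm_set m A f) ⟨H, _, _, _, π, ξ, by rwa [← hn], ?_⟩
    rw [hζ', hn, funext hζ]
  rcases eq_or_ne (‖b ξ‖) 0 with h0 | h0
  · rw [norm_eq_zero] at h0
    simp [h0]
  · have := key (((‖b ξ‖⁻¹ : ℝ) : ℂ) • ξ) (by rw [map_smul, norm_smul]; simp [h0])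
    rw [map_smul, map_smul, norm_smul] at this
    simp only [Complex.norm_real, norm_inv, norm_norm] at this
    rwa [inv_mul_le_iff₀ (lt_of_le_of_ne (norm_nonneg _) h0.symm), mul_comm] at this

/-- Together with `norm_op_le_redNorm` this presents `redNorm` as the supremum of the operator norms
over `regularReps`, the form that `exists_functor` needs. -/
lemma redNorm_le_of_forall {f : C_c(G, A)} {c : ℝ} (hc : 0 ≤ c)
    (h : ∀ ρ ∈ regularReps m A, ‖ρ.V.op m f‖ ≤ c) : redNorm m A f ≤ c := by
  refine Real.sSup_le ?_ hc
  rintro _ ⟨H, _, _, _, π, ξ, hξ, rfl⟩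
  obtain ⟨ρ, b, hb, hn, hρ⟩ := exists_regular m π
  obtain ⟨ζ, hζ, hζ'⟩ := hρ f ξ
  rw [← funext hζ, ← hn ζ, ← hζ']
  refine ((ρ.V.op m f).le_of_opNorm_le (h ρ ⟨H, _, _, _, π, b, hb, hn, hρ⟩) _).trans ?_
  calc _ ≤ c * 1 := by gcongr; rwa [hn]
    _ = c := mul_one c

lemma bddAbove_maxNorm_set (A : GAlgebra G) (f : C_c(G, A)) :
    BddAbove {r : ℝ | ∃ (H : Type u) (_ : NormedAddCommGroup H) (_ : InnerProductSpace ℂ H)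
      (_ : CompleteSpace H) (V : CovariantRep A H) (ξ : H), ‖ξ‖ ≤ 1 ∧
        r = ‖V.integrated m f ξ‖} := by
  refine ⟨l1 m f, ?_⟩
  rintro _ ⟨H, _, _, _, V, ξ, hξ, rfl⟩
  calc _ ≤ l1 m f * ‖ξ‖ := V.norm_integrated_le m f ξ
    _ ≤ l1 m f * 1 := by gcongr; exact l1_nonneg m f
    _ = _ := mul_one _

lemma norm_op_le_maxNorm (ρ : Rep A) (f : C_c(G, A)) : ‖ρ.V.op m f‖ ≤ maxNorm m A f := by
  refine ContinuousLinearMap.opNorm_le_of_unit_norm (Real.sSup_nonneg ?_) fun ξ hξ => ?_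
  · rintro _ ⟨H, _, _, _, V, ξ, hξ, rfl⟩; exact norm_nonneg _
  · exact le_csSup (bddAbove_maxNorm_set m A f) ⟨ρ.H, _, _, _, ρ.V, ξ, hξ.le, rfl⟩

lemma maxNorm_nonneg (A : GAlgebra G) (f : C_c(G, A)) : 0 ≤ maxNorm m A f :=
  Real.sSup_nonneg (by rintro _ ⟨H, _, _, _, V, ξ, hξ, rfl⟩; exact norm_nonneg _)

/-- Composing a representation of `B` with `φ` gives a representation of `A` whose regular
representation at `f` is that of the original at `φ ∘ f`. -/
lemma redNorm_compCc_le {A B : GAlgebra G} (φ : GHom A B) (f : C_c(G, A)) :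
    redNorm m B (φ.compCc f) ≤ redNorm m A f := by
  refine Real.sSup_le ?_ (redNorm_nonneg m A f)
  rintro _ ⟨H, _, _, _, π, ξ, hξ, rfl⟩
  refine le_csSup (bddAbove_redNorm_set m A f) ⟨H, _, _, _, π.comp φ.toHom, ξ, hξ, ?_⟩
  refine congrArg (l2Norm m) (funext fun s => ?_)
  simp only [regularRep, GHom.compCc_apply, ← φ.map_act]
  rfl

end Regular

/-! ### Crossed-product functors from classes of covariant representations -/

section Functors

variable {G : Type u} [Group G] [TopologicalSpace G] [IsTopologicalGroup G] [LocallyCompactSpace G]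
  [MeasurableSpace G] [BorelSpace G] (m : Measure G) [m.IsHaarMeasure]

/-- A class of covariant representations which contains the regular ones and is stable under
pullback defines a crossed-product functor. -/
lemma exists_functor (S : ∀ A : GAlgebra G, Set (Rep A))
    (hreg : ∀ (A : GAlgebra G) f c, 0 ≤ c → (∀ ρ ∈ S A, ‖ρ.V.op m f‖ ≤ c) → redNorm m A f ≤ c)
    (hpull : ∀ {A B : GAlgebra G} (φ : GHom A B) (f : C_c(G, A)) (c : ℝ), 0 ≤ c →
      (∀ ρ ∈ S A, ‖ρ.V.op m f‖ ≤ c) → ∀ ρ ∈ S B, ‖ρ.V.op m (φ.compCc f)‖ ≤ c) :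
    ∃ μ : CrossedProductFunctor m, ∀ A, (∀ ρ ∈ S A, ∀ f, ‖ρ.V.op m f‖ ≤ ‖(μ.obj A).ι f‖) ∧
      ∀ f c, 0 ≤ c → (∀ ρ ∈ S A, ‖ρ.V.op m f‖ ≤ c) → ‖(μ.obj A).ι f‖ ≤ c := by
  choose D hD hD' using fun A => exists_completion m (S A)
  have hmap : ∀ {A B : GAlgebra G} (φ : GHom A B), ∃ q : D A →⋆ₙₐ[ℂ] D B,
      ∀ f, q ((D A).ι f) = (D B).ι (φ.compCc f) := fun {A B} φ =>
    (D A).exists_map (D B) φ fun f => hD' B _ _ (norm_nonneg _)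
      (hpull φ f _ (norm_nonneg _) fun ρ hρ => hD A ρ hρ f)
  exact ⟨{ obj := D, map := fun φ => (hmap φ).choose, map_ι := fun φ => (hmap φ).choose_spec
           redNorm_le := fun A f => hreg A f _ (norm_nonneg _) fun ρ hρ => hD A ρ hρ f
           le_maxNorm := fun A f => hD' A f _ (maxNorm_nonneg m A f)
            fun ρ _ => norm_op_le_maxNorm m ρ f }, fun A => ⟨hD A, hD' A⟩⟩

lemma exists_reduced : ∃ r : CrossedProductFunctor m, r.IsReduced := by
  obtain ⟨r, hr⟩ := exists_functor m (regularReps m) (fun A f c hc h => redNorm_le_of_forall m hc h)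
    (fun {A B} φ f c hc h ρ hρ => (norm_op_le_redNorm m hρ _).trans
      ((redNorm_compCc_le m φ f).trans (redNorm_le_of_forall m hc h)))
  refine ⟨r, fun A f => le_antisymm ((hr A).2 f _ (redNorm_nonneg m A f) fun ρ hρ =>
    norm_op_le_redNorm m hρ f) (r.redNorm_le A f)⟩

end Functors

/-! ### Extension of representations from ideals -/

lemma exists_approximateUnit (B : Type*) [NonUnitalCStarAlgebra B] :
    ∃ l : Filter B, l.NeBot ∧ (∀ᶠ e in l, ‖e‖ ≤ 1) ∧ (∀ x, Tendsto (fun e => e * x) l (𝓝 x)) ∧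
      ∀ x, Tendsto (fun e => x * e) l (𝓝 x) := by
  let _ := CStarAlgebra.spectralOrder B
  have := CStarAlgebra.spectralOrderedRing B
  have h := CStarAlgebra.increasingApproximateUnit B
  exact ⟨CStarAlgebra.approximateUnit B, h.neBot, h.eventually_norm, h.tendsto_mul_right,
    h.tendsto_mul_left⟩

section IdealExtension

variable {G : Type u} [Group G] [TopologicalSpace G] {I A : GAlgebra G} {j : GHom I A}

lemma GHom.IsIdealInclusion.norm_apply (hj : j.IsIdealInclusion) (x : I) :
    ‖j.toHom x‖ = ‖x‖ :=
  NonUnitalStarAlgHom.norm_map j.toHom hj.1 x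

/-- Left multiplication by elements of `A` on an ideal `I`. -/
lemma GHom.IsIdealInclusion.exists_leftMul (hj : j.IsIdealInclusion) :
    ∃ α : A → I →ₗ[ℂ] I, ∀ a x, j.toHom (α a x) = a * j.toHom x := by
  choose y hy using fun a x => (hj.2 a x).1
  exact ⟨fun a => { toFun := y a
                    map_add' := fun x x' => hj.1 (by simp [hy, mul_add])
                    map_smul' := fun c x => hj.1 (by simp [hy, mul_smul_comm]) }, hy⟩

variable {H : Type u} [NormedAddCommGroup H] [InnerProductSpace ℂ H] [CompleteSpace H]

/-- Operators are determined by their values on the essential subspace of a representation and on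
its orthogonal complement. -/
lemma ext_of_rep {F : Type*} [NormedAddCommGroup F] [NormedSpace ℂ F]
    {π : I →⋆ₙₐ[ℂ] (H →L[ℂ] H)} {S T : H →L[ℂ] F}
    (h1 : ∀ x ξ, S (π x ξ) = T (π x ξ)) (h2 : ∀ k, (∀ x, π x k = 0) → S k = T k) : S = T := by
  let W : Submodule ℂ H := (Submodule.span ℂ {η | ∃ x ξ, η = π x ξ}).topologicalClosure
  have hW : W ≤ LinearMap.eqLocus S.toLinearMap T.toLinearMap := by
    refine Submodule.topologicalClosure_minimal _ (Submodule.span_le.2 ?_)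
      (isClosed_eq S.continuous T.continuous)
    rintro _ ⟨x, ξ, rfl⟩
    exact h1 x ξ
  have : CompleteSpace W := (Submodule.isClosed_topologicalClosure _).completeSpace_coe
  refine ContinuousLinearMap.ext fun ξ => ?_
  obtain ⟨u, hu, k, hk, rfl⟩ := Submodule.exists_add_mem_mem_orthogonal (K := W) ξ
  have h3 : ∀ x, π x k = 0 := fun x => by
    refine ext_inner_left ℂ fun η => ?_
    rw [inner_zero_right, ← star_star x, map_star, ContinuousLinearMap.star_eq_adjoint,
      ContinuousLinearMap.adjoint_inner_right]
    exact hk _ (Submodule.le_topologicalClosure _ (Submodule.subset_span ⟨_, _, rfl⟩))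
  have h4 : S u = T u := hW hu
  rw [map_add, map_add, h2 k h3, h4]

/-- The extension of a representation of an ideal. -/
lemma exists_rep_extension (hj : j.IsIdealInclusion) (π : I →⋆ₙₐ[ℂ] (H →L[ℂ] H)) :
    ∃ σ : A →⋆ₙₐ[ℂ] (H →L[ℂ] H), (∀ x, σ (j.toHom x) = π x) ∧
      (∀ a k, (∀ x, π x k = 0) → σ a k = 0) ∧
      ∀ a x y ξ, j.toHom y = a * j.toHom x → σ a (π x ξ) = π y ξ := by
  obtain ⟨α, hα⟩ := hj.exists_leftMul
  obtain ⟨l, hl, hl1, hll, -⟩ := exists_approximateUnit I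
  -- `K` is the orthogonal complement of the essential subspace. Vectors are represented by formal
  -- sums of pairs `(x, ξ)`, standing for `π x ξ`, plus an element of `K`; on these the extension
  -- can be written down before it is known to be well defined.
  let K : Submodule ℂ H := ⨅ x, LinearMap.ker (π x).toLinearMap
  have hK : ∀ k : H, k ∈ K ↔ ∀ x, π x k = 0 := fun k => by simp [K, Submodule.mem_iInf]
  let s : (I →₀ H) →ₗ[ℂ] H := Finsupp.lsum ℂ fun x => (π x).toLinearMap
  let b : ((I →₀ H) × K) →ₗ[ℂ] H := s.coprod K.subtype
  let t : A → (I →₀ H) →ₗ[ℂ] H := fun a => Finsupp.lsum ℂ fun x => (π (α a x)).toLinearMap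
  have hαmul : ∀ a x y, α a (x * y) = α a x * y := fun a x y => hj.1 (by simp [hα, mul_assoc])
  have hπs : ∀ a e u, π (α a e) (s u) = t a (Finsupp.mapDomain (fun x => e * x) u) := by
    intro a e u
    induction u using Finsupp.induction_linear with
    | zero => simp
    | add u v hu hv => simp only [map_add, hu, hv, Finsupp.mapDomain_add]
    | single x ξ => simp [s, t, Finsupp.mapDomain_single, hαmul]
  have hlim : ∀ a u, Tendsto (fun e => π (α a e) (s u)) l (𝓝 (t a u)) := by
    intro a u
    induction u using Finsupp.induction_linear with
    | zero => simp
    | add u v hu hv => simpa only [map_add] using hu.add hv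
    | single x ξ =>
      have hcont : Continuous (α a) := by
        refine AddMonoidHomClass.continuous_of_bound (α a) ‖a‖ fun x => ?_
        rw [← hj.norm_apply, hα, ← hj.norm_apply x]
        exact norm_mul_le _ _
      have h1 : Tendsto (fun e => π (α a (e * x)) ξ) l (𝓝 (π (α a x) ξ)) := by
        have : Continuous fun y : I => π (α a y) ξ :=
          ((homCLM π).continuous.comp hcont).clm_apply continuous_const
        exact (this.tendsto x).comp (hll x)
      simpa [s, t, hαmul] using h1
  -- `∑ π(a xᵢ) ξᵢ` is the limit of `π(a e) (∑ π(xᵢ) ξᵢ)` along the approximate unit, and `‖a e‖ ≤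
  -- ‖a‖`. This yields well-definedness and boundedness at once.
  have hbound : ∀ a u (k : K), ‖t a u‖ ≤ ‖a‖ * ‖b (u, k)‖ := fun a u k => by
    refine le_of_tendsto (hlim a u).norm ?_
    filter_upwards [hl1] with e he
    have h1 : π (α a e) (s u) = π (α a e) (b (u, k)) := by
      have : b (u, k) = s u + (k : H) := rfl
      rw [this, map_add, (hK _).1 k.2, add_zero]
    rw [h1]
    refine ((π (α a e)).le_opNorm _).trans ?_
    gcongr
    refine (NonUnitalStarAlgHom.norm_apply_le π _).trans ?_
    rw [← hj.norm_apply, hα]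
    refine (norm_mul_le _ _).trans ?_
    rw [hj.norm_apply]
    exact mul_le_of_le_one_right (norm_nonneg _) he
  have hdense : DenseRange b := by
    have h1 : Submodule.topologicalClosure (LinearMap.range b) = ⊤ := by
      rw [Submodule.topologicalClosure_eq_top_iff, Submodule.eq_bot_iff]
      intro k hk
      have h2 : ∀ x, π x k = 0 := fun x => by
        refine ext_inner_left ℂ fun η => ?_
        rw [inner_zero_right, ← star_star x, map_star, ContinuousLinearMap.star_eq_adjoint,
          ContinuousLinearMap.adjoint_inner_right]
        refine hk _ ⟨(Finsupp.single (star x) η, 0), ?_⟩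
        simp [b, s]
      have h3 := hk k ⟨(0, ⟨k, (hK k).2 h2⟩), by simp [b]⟩
      exact inner_self_eq_zero.1 h3
    intro ξ
    have : ξ ∈ Submodule.topologicalClosure (LinearMap.range b) := h1 ▸ Submodule.mem_top
    exact this
  let σ : A → H →L[ℂ] H := fun a => (t a ∘ₗ LinearMap.fst ℂ _ _).extendOfNorm b
  have hσ : ∀ a u k, σ a (b (u, k)) = t a u := fun a u k =>
    LinearMap.extendOfNorm_eq hdense ⟨‖a‖, fun p => hbound a p.1 p.2⟩ (u, k)
  have hσπ : ∀ a x ξ, σ a (π x ξ) = π (α a x) ξ := fun a x ξ => by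
    have := hσ a (Finsupp.single x ξ) 0
    simpa [b, s, t] using this
  have hσK : ∀ a k, (∀ x, π x k = 0) → σ a k = 0 := fun a k hk => by
    have := hσ a 0 ⟨k, (hK k).2 hk⟩
    simpa [b] using this
  -- `star (α (star a) (star x))` is the product `x a` in `I`, expressed through left multiplication
  -- alone.
  have hπσ : ∀ x a, π x * σ a = star (π (α (star a) (star x))) := fun x a => by
    refine ext_of_rep (π := π) (fun y ξ => ?_) fun k hk => ?_
    · rw [mul_apply_eq_comp, hσπ, ← map_star, ← mul_apply_eq_comp, ← mul_apply_eq_comp,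
        ← map_mul, ← map_mul]
      congr 2
      exact hj.1 (by rw [map_mul, map_mul, hα, map_star, hα, map_star, star_mul, star_star, star_star,
        mul_assoc])
    · rw [mul_apply_eq_comp, hσK a k hk, map_zero, ← map_star, hk]
  have hstar : ∀ a, σ (star a) = star (σ a) := fun a => by
    refine ext_of_rep (π := π) (fun x ξ => ?_) fun k hk => ?_
    · have := congrArg star (hπσ (star x) a)
      rw [star_mul, star_star, ← map_star, star_star] at this
      rw [hσπ, ← this]; rfl
    · refine ext_inner_right ℂ fun η => ?_
      rw [hσK _ k hk, inner_zero_left, ContinuousLinearMap.star_eq_adjoint,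
        ContinuousLinearMap.adjoint_inner_left]
      -- The functional `⟨k, σ a ·⟩` vanishes on the essential subspace and on its complement, so
      -- `star (σ a)` kills `k` as well.
      have h1 : (innerSL ℂ k).comp (σ a) = 0 := by
        refine ext_of_rep (π := π) (fun x ξ => ?_) fun k' hk' => by simp [hσK a k' hk']
        have h2 : inner ℂ k (π (α a x) ξ) = inner ℂ (π (star (α a x)) k) ξ := by
          rw [map_star, ContinuousLinearMap.star_eq_adjoint, ContinuousLinearMap.adjoint_inner_left]
        simp [hσπ, h2, hk]
      exact (congrArg (fun T => T η) h1).symm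
  refine ⟨{ toFun := σ, map_smul' := fun z a => ?_, map_zero' := ?_, map_add' := fun a a' => ?_,
            map_mul' := fun a a' => ?_, map_star' := hstar }, fun x => ?_, hσK, ?_⟩
  · refine ext_of_rep (π := π) (fun x ξ => ?_) fun k hk => by simp [hσK _ k hk]
    have : α (z • a) x = z • α a x := hj.1 (by simp [hα, smul_mul_assoc])
    simp [hσπ, this]
  · refine ext_of_rep (π := π) (fun x ξ => ?_) fun k hk => by simp [hσK _ k hk]
    have : α 0 x = 0 := hj.1 (by simp [hα])
    simp [hσπ, this]
  · refine ext_of_rep (π := π) (fun x ξ => ?_) fun k hk => by simp [hσK _ k hk]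
    have : α (a + a') x = α a x + α a' x := hj.1 (by simp [hα, add_mul])
    simp [hσπ, this]
  · refine ext_of_rep (π := π) (fun x ξ => ?_) fun k hk => by simp [hσK _ k hk]
    have : α (a * a') x = α a (α a' x) := hj.1 (by simp [hα, mul_assoc])
    simp [hσπ, this]
  · refine ext_of_rep (π := π) (fun y ξ => ?_) fun k hk => ?_
    · have : α (j.toHom x) y = x * y := hj.1 (by simp [hα])
      change σ _ _ = _
      rw [hσπ, this, map_mul]; rfl
    · exact (hσK _ k hk).trans (hk x).symm
  · intro a x y ξ h
    have : α a x = y := hj.1 (by rw [hα, h])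
    exact (hσπ a x ξ).trans (by rw [this])

variable [IsTopologicalGroup G] [LocallyCompactSpace G] [MeasurableSpace G] [BorelSpace G]

/-- The extension of a covariant representation of an invariant ideal. -/
lemma CovariantRep.exists_extension (hj : j.IsIdealInclusion) (V : CovariantRep I H) :
    ∃ W : CovariantRep A H, (∀ x, W.rep (j.toHom x) = V.rep x) ∧ W.U = V.U ∧
      (∀ a k, (∀ x, V.rep x k = 0) → W.rep a k = 0) ∧
      ∀ a x y ξ, j.toHom y = a * j.toHom x → W.rep a (V.rep x ξ) = V.rep y ξ := by
  obtain ⟨σ, h1, h2, h3⟩ := exists_rep_extension hj V.rep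
  have hcov : ∀ g a, σ (A.act g a) * (V.U g : H →L[ℂ] H) = (V.U g : H →L[ℂ] H) * σ a := by
    intro g a
    refine ext_of_rep (π := V.rep) (fun x ξ => ?_) fun k hk => ?_
    · obtain ⟨y, hy⟩ := (hj.2 a x).1
      rw [mul_apply_eq_comp, mul_apply_eq_comp, h3 a x y ξ hy, ← V.rep_act_apply,
        ← V.rep_act_apply, h3 _ _ (I.act g y)]
      rw [j.map_act, j.map_act, hy, map_mul]
    · rw [mul_apply_eq_comp, mul_apply_eq_comp, h2 a k hk, map_zero, h2]
      -- By covariance the common kernel is invariant under `V.U g`.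
      intro x
      rw [← I.act_act_inv g x, V.rep_act_apply, hk, map_zero]
  refine ⟨⟨σ, V.U, V.continuous_U, fun g a => ?_⟩, h1, rfl, h2, h3⟩
  · rw [← hcov, mul_assoc]
    have : (V.U g : H →L[ℂ] H) * star (V.U g : H →L[ℂ] H) = 1 := Unitary.coe_mul_star_self _
    rw [this, mul_one]
end IdealExtension

/-! ### The ideal property of the reduced crossed product. -/

section ReducedIdeal

variable {G : Type u} [Group G] [TopologicalSpace G] [IsTopologicalGroup G] [LocallyCompactSpace G]
  [MeasurableSpace G] [BorelSpace G] {m : Measure G} [m.IsHaarMeasure]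

/-- Each representation of `I` extends to `A` on the same space, and on `C_c(G, I)` the two regular
representations agree. -/
lemma redNorm_le_of_isIdealInclusion {I A : GAlgebra G} {j : GHom I A} (hj : j.IsIdealInclusion)
    (f : C_c(G, I)) : redNorm m I f ≤ redNorm m A (j.compCc f) := by
  refine Real.sSup_le ?_ (redNorm_nonneg m A _)
  rintro _ ⟨H, _, _, _, π, ξ, hξ, rfl⟩
  obtain ⟨σ, hσ, -⟩ := exists_rep_extension hj π
  refine le_csSup (bddAbove_redNorm_set m A _) ⟨H, _, _, _, σ, ξ, hξ, ?_⟩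
  refine congrArg (l2Norm m) (funext fun s => ?_)
  simp only [regularRep, GHom.compCc_apply, ← j.map_act, hσ]

lemma CrossedProductFunctor.injective_map_of_norm_le (μ : CrossedProductFunctor m)
    {I A : GAlgebra G} {j : GHom I A}
    (h : ∀ f, ‖(μ.obj I).ι f‖ ≤ ‖(μ.obj A).ι (j.compCc f)‖) : Function.Injective (μ.map j) := by
  have h1 : ∀ x, ‖x‖ ≤ ‖μ.map j x‖ := fun x => by
    refine (μ.obj I).dense_ι.induction_on (p := fun x => ‖x‖ ≤ ‖μ.map j x‖) x ?_ fun f => ?_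
    · exact isClosed_le (by fun_prop) (homCLM (μ.map j)).continuous.norm
    · rw [μ.map_ι]; exact h f
  rw [injective_iff_map_eq_zero]
  intro x hx
  have := h1 x
  rw [hx, norm_zero] at this
  exact norm_le_zero_iff.1 this

lemma CrossedProductFunctor.IsReduced.idealProperty {r : CrossedProductFunctor m}
    (hr : r.IsReduced) : r.IdealProperty := fun {I A} j hj =>
  r.injective_map_of_norm_le fun f => by
    rw [hr I f, hr A _]
    exact redNorm_le_of_isIdealInclusion hj f

end ReducedIdeal

/-! ### Equivariant surjections onto the scalars -/

section Unitization

variable {G : Type u} [Group G] [TopologicalSpace G]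

/-- The automorphism of the unitization induced by an automorphism. -/
def unitizationEquiv {C : Type u} [NonUnitalCStarAlgebra C] (φ : C ≃⋆ₐ[ℂ] C) :
    Unitization ℂ C ≃⋆ₐ[ℂ] Unitization ℂ C where
  toFun x := ⟨x.fst, φ x.snd⟩
  invFun x := ⟨x.fst, φ.symm x.snd⟩
  left_inv x := by ext <;> simp
  right_inv x := by ext <;> simp
  map_mul' x y := by ext <;> simp
  map_add' x y := by ext <;> simp
  map_star' x := by ext <;> simp [map_star]
  map_smul' c x := by ext <;> simp

/-- The extension of a character to the unitization. -/
def unitizationChar {C : Type u} [NonUnitalCStarAlgebra C] (χ : C →⋆ₙₐ[ℂ] (PUnit.{u + 1} → ℂ)) :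
    Unitization ℂ C →⋆ₙₐ[ℂ] (PUnit.{u + 1} → ℂ) where
  toFun x := (fun _ => x.fst) + χ x.snd
  map_smul' c x := by funext i; simp [mul_add]
  map_zero' := by funext i; simp
  map_add' x y := by funext i; simp; ring
  map_mul' x y := by funext i; simp; ring
  map_star' x := by funext i; simp [map_star]

/-- The scalar multiples of the unit of the unitization. -/
def unitizationUnit (C : Type u) [NonUnitalCStarAlgebra C] :
    (PUnit.{u + 1} → ℂ) →⋆ₙₐ[ℂ] Unitization ℂ C where
  toFun z := Unitization.inl (z PUnit.unit)
  map_smul' c z := by ext <;> simp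
  map_zero' := by ext <;> simp
  map_add' z w := by ext <;> simp
  map_mul' z w := by ext <;> simp
  map_star' z := by ext <;> simp

lemma unitizationChar_inr {C : Type u} [NonUnitalCStarAlgebra C]
    (χ : C →⋆ₙₐ[ℂ] (PUnit.{u + 1} → ℂ)) (a : C) :
    unitizationChar χ (Unitization.inr a) = χ a := zero_add _

lemma unitizationChar_unit {C : Type u} [NonUnitalCStarAlgebra C]
    (χ : C →⋆ₙₐ[ℂ] (PUnit.{u + 1} → ℂ)) (z : PUnit.{u + 1} → ℂ) :
    unitizationChar χ (unitizationUnit C z) = z := by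
  funext i
  simp [unitizationChar, unitizationUnit]

lemma unitization_isIdeal {C : Type u} [NonUnitalCStarAlgebra C] (a : Unitization ℂ C) (x : C) :
    (∃ y : C, (Unitization.inr y : Unitization ℂ C) = a * Unitization.inr x) ∧
      ∃ y : C, (Unitization.inr y : Unitization ℂ C) = Unitization.inr x * a :=
  ⟨⟨(a * (Unitization.inr x : Unitization ℂ C)).snd, by ext <;> simp⟩,
    ⟨((Unitization.inr x : Unitization ℂ C) * a).snd, by ext <;> simp⟩⟩

/-- The unitization of a `G`-algebra. -/
def GAlgebra.unitization (C : GAlgebra G) : GAlgebra G where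
  carrier := Unitization ℂ C
  act :=
    { toFun := fun g => unitizationEquiv (C.act g)
      map_one' := by
        ext x
        · rfl
        · change C.act 1 x.snd = x.snd
          simp
      map_mul' := fun g h => by
        ext x
        · rfl
        · change C.act (g * h) x.snd = C.act g (C.act h x.snd)
          exact C.act_mul_apply g h _ }
  continuous_act x := by
    have h : ∀ g, (⟨x.fst, C.act g x.snd⟩ : Unitization ℂ C) =
        Unitization.inl x.fst + Unitization.inr (C.act g x.snd) := fun g => by ext <;> simp
    change Continuous fun g => (⟨x.fst, C.act g x.snd⟩ : Unitization ℂ C)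
    simp only [h]
    exact continuous_const.add
      ((Unitization.isometry_inr (𝕜 := ℂ)).continuous.comp (C.continuous_act _))

/-- The inclusion of a `G`-algebra into its unitization. -/
def GAlgebra.inr (C : GAlgebra G) : GHom C C.unitization where
  toHom := Unitization.inrNonUnitalStarAlgHom ℂ C
  map_act g a := by
    change (Unitization.inr (C.act g a) : Unitization ℂ C) = ⟨0, C.act g a⟩
    rfl

lemma GAlgebra.inr_isIdealInclusion (C : GAlgebra G) : C.inr.IsIdealInclusion :=
  ⟨Unitization.inr_injective, unitization_isIdeal⟩

/-- The extension of an equivariant character to the unitization. -/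
def GHom.unitizationLift {C : GAlgebra G} (π : GHom C (scalars G)) :
    GHom C.unitization (scalars G) where
  toHom := unitizationChar (C := C) π.toHom
  map_act g a := by
    have h : π.toHom (C.act g a.snd) = π.toHom a.snd := π.map_act g a.snd
    exact congrArg (fun z : PUnit.{u + 1} → ℂ => (fun _ => a.fst) + z) h

lemma GHom.unitizationLift_inr {C : GAlgebra G} (π : GHom C (scalars G)) (a : C) :
    π.unitizationLift.toHom (C.inr.toHom a) = π.toHom a :=
  unitizationChar_inr (C := C) π.toHom a

/-- The scalar multiples of the unit of the unitization. -/
def GAlgebra.unit (C : GAlgebra G) : GHom (scalars G) C.unitization where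
  toHom := unitizationUnit C
  map_act g a := by
    change (Unitization.inl (a PUnit.unit) : Unitization ℂ C) = ⟨a PUnit.unit, C.act g 0⟩
    ext <;> simp

lemma GHom.unitizationLift_unit {C : GAlgebra G} (π : GHom C (scalars G)) (z : scalars G) :
    π.unitizationLift.toHom (C.unit.toHom z) = z :=
  unitizationChar_unit (C := C) π.toHom z

end Unitization

/-! ### The splitting argument for surjections onto the scalars. -/

section Scalars

variable {G : Type u} [Group G] [TopologicalSpace G] [IsTopologicalGroup G] [LocallyCompactSpace G]
  [MeasurableSpace G] [BorelSpace G] {m : Measure G} [m.IsHaarMeasure]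

/-- An approximate unit of a completion consisting of elements of `C_c(G, A)`. -/
lemma Completion.exists_approximateUnit {A : GAlgebra G} (D : Completion m A) :
    ∃ l : Filter C_c(G, A), l.NeBot ∧ (∀ δ > 0, ∀ᶠ e in l, ‖D.ι e‖ < 1 + δ) ∧
      (∀ x, Tendsto (fun e => D.ι e * x) l (𝓝 x)) ∧ ∀ x, Tendsto (fun e => x * D.ι e) l (𝓝 x) := by
  obtain ⟨l, hl, h1, h2, h3⟩ := CrossedProducts.exists_approximateUnit D
  -- The new filter consists of functions whose images lie near members of `l`. Only open conditions
  -- pass to it, hence the bound `1 + δ` instead of `1`.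
  have mem : ∀ {O : Set D}, IsOpen O → (∀ᶠ e in l, e ∈ O) →
      ∀ᶠ e in comap D.ι (l.bind 𝓝), D.ι e ∈ O := fun {O} hO h =>
    ⟨O, h.mono fun e he => hO.mem_nhds he, fun e he => he⟩
  refine ⟨comap D.ι (l.bind 𝓝), ?_, ?_, ?_, ?_⟩
  · rw [comap_neBot_iff]
    intro t ht
    obtain ⟨x, hx⟩ := Eventually.exists (f := l) (p := fun x => t ∈ 𝓝 x) ht
    obtain ⟨_, hy, f, rfl⟩ := mem_closure_iff_nhds.1 (D.dense_ι x) t hx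
    exact ⟨f, hy⟩
  · intro δ hδ
    exact mem (O := {x | ‖x‖ < 1 + δ}) (isOpen_lt continuous_norm continuous_const)
      (h1.mono fun e he => by simp only [Set.mem_ofPred_eq]; linarith)
  · intro x
    refine (nhds_basis_opens x).tendsto_right_iff.2 fun O hO => ?_
    exact mem (O := {y | y * x ∈ O}) (hO.2.preimage (by fun_prop))
      ((h2 x).eventually_mem (hO.2.mem_nhds hO.1))
  · intro x
    refine (nhds_basis_opens x).tendsto_right_iff.2 fun O hO => ?_
    exact mem (O := {y | x * y ∈ O}) (hO.2.preimage (by fun_prop))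
      ((h3 x).eventually_mem (hO.2.mem_nhds hO.1))

namespace CrossedProductFunctor

variable {μ : CrossedProductFunctor m}

lemma ι_mem_kernelClosure (μ : CrossedProductFunctor m) {C A : GAlgebra G} {π : GHom C A}
    {k : C_c(G, C)} (hk : ∀ s, π.toHom (k s) = 0) : (μ.obj C).ι k ∈ μ.kernelClosure π :=
  Submodule.le_topologicalClosure _ (Submodule.subset_span ⟨k, hk, rfl⟩)

lemma norm_mk_le (μ : CrossedProductFunctor m) {C A : GAlgebra G} {π : GHom C A}
    (F k : C_c(G, C)) (hk : ∀ s, π.toHom (k s) = 0) :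
    ‖(Submodule.Quotient.mk ((μ.obj C).ι F) : μ.obj C ⧸ μ.kernelClosure π)‖ ≤
      ‖(μ.obj C).ι F - (μ.obj C).ι k‖ := by
  have h : (Submodule.Quotient.mk ((μ.obj C).ι F) : μ.obj C ⧸ μ.kernelClosure π) =
      Submodule.Quotient.mk ((μ.obj C).ι F - (μ.obj C).ι k) := by
    rw [Submodule.Quotient.eq]
    simpa using μ.ι_mem_kernelClosure hk
  rw [h]
  exact Submodule.Quotient.norm_mk_le _ _

/-- The product of an element of `C_c(G, ker π~)` with an element of `C_c(G, C)` lies in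
`C_c(G, ker π)`. -/
lemma _root_.CrossedProducts.exists_conv_inr {C : GAlgebra G} (π : GHom C (scalars G))
    (f : C_c(G, C.unitization)) (hf : ∀ s, π.unitizationLift.toHom (f s) = 0) (e : C_c(G, C)) :
    ∃ k : C_c(G, C), (∀ s, π.toHom (k s) = 0) ∧ C.inr.compCc k = conv m f (C.inr.compCc e) := by
  let X := conv m f (C.inr.compCc e)
  have hint := integrable_conv (m := m) f (C.inr.compCc e)
  have hiso : Isometry C.inr.toHom :=
    AddMonoidHomClass.isometry_of_norm C.inr.toHom C.inr_isIdealInclusion.norm_apply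
  have hsnd : ∀ s, C.inr.toHom (X s).snd = X s := fun s => by
    -- The character of the unitization with kernel `C`. It kills the integrand, since `C` is an
    -- ideal, hence the integral; so the convolution takes its values in `C`.
    let χ : C.unitization →⋆ₙₐ[ℂ] scalars G := unitizationChar (C := C) 0
    have h1 := (homCLM χ).integral_comp_comm (hint s)
    have h2 : ∀ t, χ (f t * C.unitization.act t (C.inr.compCc e (t⁻¹ * s))) = 0 := fun t => by
      rw [GHom.compCc_apply, ← C.inr.map_act]
      obtain ⟨y, hy⟩ := (C.inr_isIdealInclusion.2 (f t) (C.act t (e (t⁻¹ * s)))).1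
      rw [← hy]
      exact unitizationChar_inr (C := C) 0 y
    simp only [homCLM_apply, h2, integral_zero] at h1
    have h3 : (X s).fst = 0 := by
      have : χ (X s) = 0 := h1.symm
      have h4 : (X s).fst + 0 = 0 := congrFun this PUnit.unit
      simpa using h4
    change (Unitization.inr (X s).snd : Unitization ℂ C) = X s
    ext
    · exact h3.symm
    · rfl
  let k : C_c(G, C) :=
    { toFun := fun s => (X s).snd
      continuous_toFun := by
        rw [hiso.isEmbedding.continuous_iff]
        simp only [Function.comp_def, hsnd]
        exact X.continuous
      hasCompactSupport' := X.hasCompactSupport.comp_left (g := fun x : Unitization ℂ C => x.snd) rfl }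
  refine ⟨k, fun s => ?_, by ext s : 1; exact hsnd s⟩
  rw [← π.unitizationLift_inr]
  change π.unitizationLift.toHom (C.inr.toHom (X s).snd) = 0
  rw [hsnd]
  have h1 := (homCLM π.unitizationLift.toHom).integral_comp_comm (hint s)
  simp only [homCLM_apply, map_mul, hf, zero_mul, integral_zero] at h1
  exact h1.symm

/-- The `π`-norms on `C_c(G)` are bounded by the norm of `ℂ ⋊_μ G`. -/
lemma IdealProperty.norm_mk_le (hμ : μ.IdealProperty) {C : GAlgebra G} (π : GHom C (scalars G))
    (F : C_c(G, C)) :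
    ‖(Submodule.Quotient.mk ((μ.obj C).ι F) : μ.obj C ⧸ μ.kernelClosure π)‖ ≤
      ‖(μ.obj (scalars G)).ι (π.compCc F)‖ := by
  obtain ⟨l, hl, h1, -, h2⟩ := (μ.obj C).exists_approximateUnit
  -- The ideal property enters here: norms in `C ⋊ G` may be computed over the unitization, where
  -- the scalar part `S` of `F` exists.
  let i := μ.map C.inr
  have hi : ∀ x, ‖i x‖ = ‖x‖ :=
    NonUnitalStarAlgHom.norm_map i (hμ C.inr C.inr_isIdealInclusion)
  let N := ‖(μ.obj (scalars G)).ι (π.compCc F)‖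
  let S := C.unit.compCc (π.compCc F)
  have hS : ‖(μ.obj C.unitization).ι S‖ ≤ N := by
    rw [← μ.map_ι]
    exact NonUnitalStarAlgHom.norm_apply_le _ _
  -- The element subtracted from `F` is `(F - S) * e`, which lies in `C_c(G, ker π)`; what remains
  -- is `(F - F * e) + S * e`.
  have key : ∀ e, ‖(Submodule.Quotient.mk ((μ.obj C).ι F) : μ.obj C ⧸ μ.kernelClosure π)‖ ≤
      ‖(μ.obj C).ι F - (μ.obj C).ι F * (μ.obj C).ι e‖ + N * ‖(μ.obj C).ι e‖ := fun e => by
    obtain ⟨k, hk, hk'⟩ := exists_conv_inr (m := m) π (C.inr.compCc F - S) (fun s => by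
      simp [S, GHom.unitizationLift_inr, GHom.unitizationLift_unit]) e
    refine (μ.norm_mk_le F k hk).trans ?_
    rw [← hi, map_sub, μ.map_ι, μ.map_ι, hk', Completion.ι_conv, map_sub, sub_mul]
    calc _ = ‖i ((μ.obj C).ι F - (μ.obj C).ι F * (μ.obj C).ι e) +
          (μ.obj C.unitization).ι S * i ((μ.obj C).ι e)‖ := by
          rw [map_sub, map_mul, μ.map_ι, μ.map_ι]
          congr 1; abel
      _ ≤ _ := (norm_add_le _ _).trans ?_
    rw [hi]
    gcongr
    refine (norm_mul_le _ _).trans ?_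
    rw [hi]
    gcongr
  refine le_of_forall_pos_le_add fun ε hε => ?_
  have h3 : Tendsto (fun e => ‖(μ.obj C).ι F - (μ.obj C).ι F * (μ.obj C).ι e‖) l (𝓝 0) := by
    have := (tendsto_const_nhds (x := (μ.obj C).ι F)).sub (h2 ((μ.obj C).ι F))
    simpa using this.norm
  have hN : 0 ≤ N := norm_nonneg _
  -- With this `δ` the term `N * ‖e‖` exceeds `N` by at most `ε / 2`; the `+ 1` covers `N = 0`.
  obtain ⟨e, he1, he2⟩ := ((h3.eventually_lt_const (half_pos hε)).and
    (h1 (ε / 2 / (N + 1)) (by positivity))).exists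
  refine (key e).trans ?_
  have h4 : N * (ε / 2 / (N + 1)) ≤ ε / 2 := by
    rw [mul_div_assoc', div_le_iff₀ (by positivity)]
    nlinarith
  nlinarith [mul_le_mul_of_nonneg_left he2.le hN]

/-- Every surjection obeys the splitting estimate, and the identity of `ℂ`, with kernel zero,
attains it. -/
lemma IdealProperty.epsNorm_scalars (hμ : μ.IdealProperty) (f : C_c(G, scalars G)) :
    μ.epsNorm (scalars G) f = ‖(μ.obj (scalars G)).ι f‖ := by
  have h0 : ∀ (C : GAlgebra G) (π : GHom C (scalars G)),
      μ.piNorm π f ≤ ‖(μ.obj (scalars G)).ι f‖ := fun C π => by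
    rw [piNorm]
    let R : Set ℝ := {r : ℝ | ∃ F : C_c(G, C), π.compCc F = f ∧
      r = ‖(Submodule.Quotient.mk ((μ.obj C).ι F) : μ.obj C ⧸ μ.kernelClosure π)‖}
    change sInf R ≤ _
    have hR : BddBelow R := ⟨0, by rintro _ ⟨F, _, rfl⟩; exact norm_nonneg _⟩
    rcases Set.eq_empty_or_nonempty R with h | ⟨r, F, hF, hr⟩
    -- The infimum over the empty set is `0`, so the upper bound does not need a lift of `f`.
    · rw [h, Real.sInf_empty]
      exact norm_nonneg _
    · rw [← hF]
      refine (csInf_le hR ⟨F, hF, rfl⟩).trans (hμ.norm_mk_le π F)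
  have hid : μ.piNorm (GHom.id (scalars G)) f = ‖(μ.obj (scalars G)).ι f‖ := by
    have h1 : μ.kernelClosure (GHom.id (scalars G)) = ⊥ := by
      rw [kernelClosure]
      have : {k : C_c(G, scalars G) | ∀ s, (GHom.id (scalars G)).toHom (k s) = 0} = {0} := by
        ext k
        simp [CompactlySupportedContinuousMap.ext_iff]
      rw [this, Set.image_singleton, map_zero, Submodule.span_zero_singleton]
      exact IsClosed.submodule_topologicalClosure_eq isClosed_singleton
    have h2 : {r : ℝ | ∃ F : C_c(G, scalars G), (GHom.id (scalars G)).compCc F = f ∧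
        r = ‖(Submodule.Quotient.mk ((μ.obj (scalars G)).ι F) :
          μ.obj (scalars G) ⧸ μ.kernelClosure (GHom.id (scalars G)))‖} =
        {‖(μ.obj (scalars G)).ι f‖} := by
      ext r
      simp only [GHom.compCc_id, exists_eq_left, Set.mem_ofPred_eq, Set.mem_singleton_iff]
      have h3 : ‖(Submodule.Quotient.mk ((μ.obj (scalars G)).ι f) :
          μ.obj (scalars G) ⧸ μ.kernelClosure (GHom.id (scalars G)))‖ =
          ‖(μ.obj (scalars G)).ι f‖ := by
        rw [h1]
        refine le_antisymm (Submodule.Quotient.norm_mk_le _ _) ?_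
        refine le_of_forall_pos_le_add fun ε hε => ?_
        obtain ⟨x, hx, hx'⟩ := Submodule.Quotient.norm_mk_lt (S := (⊥ : Submodule ℂ (μ.obj (scalars G))))
          (Submodule.Quotient.mk ((μ.obj (scalars G)).ι f)) hε
        rw [Submodule.Quotient.eq, Submodule.mem_bot, sub_eq_zero] at hx
        rw [hx] at hx'
        exact hx'.le
      rw [h3]
    rw [piNorm, h2, csInf_singleton]
  have hb : ∀ r ∈ {r : ℝ | ∃ (C : GAlgebra G) (π : GHom C (scalars G)),
      Function.Surjective π.toHom ∧ r = μ.piNorm π f}, r ≤ ‖(μ.obj (scalars G)).ι f‖ := by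
    rintro _ ⟨C, π, _, rfl⟩
    exact h0 C π
  refine le_antisymm (Real.sSup_le hb (norm_nonneg _)) ?_
  rw [← hid]
  exact le_csSup ⟨_, hb⟩ ⟨scalars G, GHom.id _, fun z => ⟨z, rfl⟩, rfl⟩

/-- `ℂ ⋊_{E(μ)} G → ℂ ⋊_μ G` is an isomorphism if `μ` has the ideal property. -/
lemma IdealProperty.canonicalMapIsIso (hμ : μ.IdealProperty) :
    (∃ D : Completion m (scalars G), D.IsFor (μ.epsNorm (scalars G))) ∧
      ∀ D : Completion m (scalars G), D.IsFor (μ.epsNorm (scalars G)) →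
        D.CanonicalMapIsIso (μ.obj (scalars G)) :=
  ⟨⟨μ.obj (scalars G), fun f => (hμ.epsNorm_scalars f).symm⟩, fun _ hD =>
    Completion.canonicalMapIsIso_of_norm_eq fun f => (hD f).trans (hμ.epsNorm_scalars f)⟩

end CrossedProductFunctor

end Scalars

/-! ### Norm-controlled lifts and averages -/

section Lifts

/-- A self-adjoint lift is truncated by the functional calculus of the function `k` that clamps to
`[-‖b‖, ‖b‖]`. The truncation commutes with `φ` and fixes `b`. -/
lemma exists_lift_norm_le_of_isSelfAdjoint {A B : Type*} [NonUnitalCStarAlgebra A]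
    [NonUnitalCStarAlgebra B] {φ : A →⋆ₙₐ[ℂ] B} (hφ : Function.Surjective φ) {b : B}
    (hb : IsSelfAdjoint b) : ∃ a, φ a = b ∧ ‖a‖ ≤ ‖b‖ := by
  obtain ⟨a₀, ha₀⟩ := hφ b
  let a : A := (realPart a₀ : A)
  have ha : IsSelfAdjoint a := (realPart a₀).2
  have hab : φ a = b := by
    have h1 : φ (star a₀) = b := by rw [map_star, ha₀, hb.star_eq]
    have h2 : a = (2⁻¹ : ℂ) • (a₀ + star a₀) := by
      simp only [a, realPart_apply_coe]
      rw [← Complex.coe_smul]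
      norm_num
    rw [h2, map_smul, map_add, h1, ha₀, ← two_smul ℂ b, smul_smul]
    norm_num
  let k : ℝ → ℝ := fun x => max (-‖b‖) (min ‖b‖ x)
  have hk0 : k 0 = 0 := by simp [k]
  have hkc : Continuous k := by fun_prop
  refine ⟨cfcₙ k a, ?_, ?_⟩
  · have h1 := NonUnitalStarAlgHom.map_cfcₙ (S := ℂ) (R := ℝ) φ k a hkc.continuousOn hk0
      (homCLM φ).continuous ha (by rw [hab]; exact hb)
    rw [h1, hab]
    conv_rhs => rw [← cfcₙ_id ℝ b]
    refine cfcₙ_congr fun x hx => ?_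
    have h2 : ‖x‖ ≤ ‖b‖ :=
      NonUnitalIsometricContinuousFunctionalCalculus.norm_quasispectrum_le b hx hb
    rw [Real.norm_eq_abs, abs_le] at h2
    simp [k, h2.1, h2.2]
  · refine norm_cfcₙ_le fun x _ => ?_
    rw [Real.norm_eq_abs, abs_le]
    exact ⟨le_max_left _ _, max_le (by linarith [norm_nonneg b]) (min_le_left _ _)⟩

/-- The factor `2` comes from lifting real and imaginary parts separately; any fixed constant would
serve. -/
lemma exists_lift_norm_le {A B : Type*} [NonUnitalCStarAlgebra A] [NonUnitalCStarAlgebra B]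
    {φ : A →⋆ₙₐ[ℂ] B} (hφ : Function.Surjective φ) (b : B) : ∃ a, φ a = b ∧ ‖a‖ ≤ 2 * ‖b‖ := by
  obtain ⟨x, hx, hx'⟩ := exists_lift_norm_le_of_isSelfAdjoint hφ (realPart b).2
  obtain ⟨y, hy, hy'⟩ := exists_lift_norm_le_of_isSelfAdjoint hφ (imaginaryPart b).2
  refine ⟨x + Complex.I • y, ?_, ?_⟩
  · rw [map_add, map_smul, hx, hy, realPart_add_I_smul_imaginaryPart]
  · have h1 : ‖(realPart b : B)‖ ≤ ‖b‖ := realPart.norm_le b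
    have h2 : ‖(imaginaryPart b : B)‖ ≤ ‖b‖ := imaginaryPart.norm_le b
    calc _ ≤ ‖x‖ + ‖Complex.I • y‖ := norm_add_le _ _
      _ ≤ ‖b‖ + ‖b‖ := by
        rw [norm_smul, Complex.norm_I, one_mul]
        exact add_le_add (hx'.trans h1) (hy'.trans h2)
      _ = _ := by ring

/-- A bounded operator with bounded approximate preimages is surjective. -/
lemma surjective_of_approx_preimage {E F : Type*} [NormedAddCommGroup E] [NormedSpace ℂ E]
    [CompleteSpace E] [NormedAddCommGroup F] [NormedSpace ℂ F] (f : E →L[ℂ] F) {M : ℝ}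
    (h : ∀ y, ∃ x, ‖x‖ ≤ M * ‖y‖ ∧ ‖f x - y‖ ≤ 1 / 2 * ‖y‖) : Function.Surjective f := by
  choose g hg1 hg2 using h
  intro y
  let r : F → F := fun z => z - f (g z)
  have hr : ∀ z, ‖r z‖ ≤ 1 / 2 * ‖z‖ := fun z => by
    rw [← norm_neg]; simpa [r] using hg2 z
  have hrn : ∀ n, ‖r^[n] y‖ ≤ (1 / 2) ^ n * ‖y‖ := fun n => by
    induction n with
    | zero => simp
    | succ n ih =>
      rw [Function.iterate_succ_apply', pow_succ']
      calc _ ≤ 1 / 2 * ‖r^[n] y‖ := hr _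
        _ ≤ 1 / 2 * ((1 / 2) ^ n * ‖y‖) := by gcongr
        _ = _ := by ring
  have hs : Summable fun n => g (r^[n] y) := by
    refine Summable.of_norm_bounded (g := fun n => |M| * ((1 / 2) ^ n * ‖y‖))
      (((summable_geometric_of_lt_one (by norm_num) (by norm_num)).mul_right _).mul_left _)
      fun n => ?_
    calc _ ≤ M * ‖r^[n] y‖ := hg1 _
      _ ≤ |M| * ‖r^[n] y‖ := by gcongr; exact le_abs_self M
      _ ≤ _ := by gcongr; exact hrn n
  refine ⟨∑' n, g (r^[n] y), ?_⟩
  have h1 := ((hs.hasSum.mapL f).tendsto_sum_nat)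
  have h2 : ∀ n, ∑ i ∈ Finset.range n, f (g (r^[i] y)) = y - r^[n] y := fun n => by
    induction n with
    | zero => simp
    | succ n ih =>
      rw [Finset.sum_range_succ, ih, Function.iterate_succ_apply']
      simp only [r]
      abel
  simp only [h2] at h1
  have h3 : Tendsto (fun n => r^[n] y) atTop (𝓝 0) := by
    refine squeeze_zero_norm hrn ?_
    simpa using (tendsto_pow_atTop_nhds_zero_of_lt_one (r := (1 / 2 : ℝ)) (by norm_num) (by norm_num)).mul_const ‖y‖
  have h4 := (tendsto_const_nhds (x := y)).sub h3
  rw [sub_zero] at h4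
  exact tendsto_nhds_unique h1 h4

end Lifts

/-! ### Averages over the group action. -/

section Average

variable {G : Type u} [Group G] [TopologicalSpace G] [IsTopologicalGroup G] [LocallyCompactSpace G]
  [MeasurableSpace G] [BorelSpace G] (m : Measure G) [m.IsHaarMeasure]

/-- The average `∫ φ(g) α_g(a) dg`. -/
def avg {A : GAlgebra G} (φ : C_c(G, ℂ)) (a : A) : A := ∫ g, φ g • A.act g a ∂m

lemma integrable_avg {A : GAlgebra G} (φ : C_c(G, ℂ)) {a : G → A} (ha : Continuous a) :
    Integrable (fun g => φ g • a g) m :=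
  (φ.continuous.smul ha).integrable_of_hasCompactSupport φ.hasCompactSupport.smul_right

lemma norm_avg_le {A : GAlgebra G} (φ : C_c(G, ℂ)) (a : A) : ‖avg m φ a‖ ≤ l1 m φ * ‖a‖ := by
  rw [l1, ← integral_mul_const]
  refine norm_integral_le_of_norm_le ((integrable_Cc m φ).norm.mul_const _)
    (Eventually.of_forall fun t => ?_)
  rw [norm_smul, A.norm_act]

lemma avg_sub {A : GAlgebra G} (φ : C_c(G, ℂ)) (a b : A) :
    avg m φ (a - b) = avg m φ a - avg m φ b := by
  simp only [avg, map_sub, smul_sub]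
  exact integral_sub (integrable_avg m φ (A.continuous_act a))
    (integrable_avg m φ (A.continuous_act b))

lemma GHom.map_avg {A B : GAlgebra G} (ρ : GHom A B) (φ : C_c(G, ℂ)) (a : A) :
    ρ.toHom (avg m φ a) = avg m φ (ρ.toHom a) := by
  have := (homCLM ρ.toHom).integral_comp_comm (integrable_avg m φ (A.continuous_act a))
  simp only [homCLM_apply, map_smul, ρ.map_act] at this
  exact this.symm

/-- Since `s α_g(a) = α_g(α_{g⁻¹}(s) a)`, only the translates of `s` over the compact support of `φ`
matter. This lets strict convergence survive averaging. -/
lemma norm_mul_avg_le {A : GAlgebra G} (φ : C_c(G, ℂ)) (s a : A) {ε : ℝ}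
    (h : ∀ g ∈ tsupport φ, ‖A.act g⁻¹ s * a‖ ≤ ε) : ‖s * avg m φ a‖ ≤ l1 m φ * ε := by
  have h1 := (ContinuousLinearMap.mul ℂ A s).integral_comp_comm
    (integrable_avg m φ (A.continuous_act a))
  simp only [ContinuousLinearMap.mul_apply', mul_smul_comm] at h1
  rw [avg, ← h1, l1, ← integral_mul_const]
  refine norm_integral_le_of_norm_le ((integrable_Cc m φ).norm.mul_const _)
    (Eventually.of_forall fun t => ?_)
  rw [norm_smul]
  by_cases ht : t ∈ tsupport φ
  · gcongr
    rw [← A.norm_act t⁻¹, map_mul, A.act_inv_act]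
    exact h t ht
  · simp [image_eq_zero_of_notMem_tsupport ht]

lemma norm_avg_mul_le {A : GAlgebra G} (φ : C_c(G, ℂ)) (s a : A) {ε : ℝ}
    (h : ∀ g ∈ tsupport φ, ‖a * A.act g⁻¹ s‖ ≤ ε) : ‖avg m φ a * s‖ ≤ l1 m φ * ε := by
  have h1 := ((ContinuousLinearMap.mul ℂ A).flip s).integral_comp_comm
    (integrable_avg m φ (A.continuous_act a))
  simp only [ContinuousLinearMap.flip_apply, ContinuousLinearMap.mul_apply', smul_mul_assoc] at h1
  rw [avg, ← h1, l1, ← integral_mul_const]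
  refine norm_integral_le_of_norm_le ((integrable_Cc m φ).norm.mul_const _)
    (Eventually.of_forall fun t => ?_)
  rw [norm_smul]
  by_cases ht : t ∈ tsupport φ
  · gcongr
    rw [← A.norm_act t⁻¹, map_mul, A.act_inv_act]
    exact h t ht
  · simp [image_eq_zero_of_notMem_tsupport ht]

/-- Averages are equicontinuous. -/
lemma norm_act_avg_sub_le {A : GAlgebra G} (φ : C_c(G, ℂ)) (a : A) (h : G) :
    ‖A.act h (avg m φ a) - avg m φ a‖ ≤ (∫ g, ‖φ (h⁻¹ * g) - φ g‖ ∂m) * ‖a‖ := by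
  have h0 : ∀ g, A.act h (A.act g a) = A.act (h * g) a := fun g => (A.act_mul_apply h g a).symm
  have hc : Integrable (fun g => φ (h⁻¹ * g) • A.act g a) m := by
    refine ((φ.continuous.comp (continuous_const.mul continuous_id)).smul
      (A.continuous_act a)).integrable_of_hasCompactSupport ?_
    exact HasCompactSupport.smul_right (φ.hasCompactSupport.comp_homeomorph (Homeomorph.mulLeft h⁻¹))
  have h1 : A.act h (avg m φ a) = ∫ g, φ (h⁻¹ * g) • A.act g a ∂m := by
    have := (homCLM ((A.act h : A ≃⋆ₐ[ℂ] A) : A →⋆ₙₐ[ℂ] A)).integral_comp_comm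
      (integrable_avg m φ (A.continuous_act a))
    have h2 : ∀ x : A, homCLM ((A.act h : A ≃⋆ₐ[ℂ] A) : A →⋆ₙₐ[ℂ] A) x = A.act h x := fun x => rfl
    simp only [h2, map_smul, h0] at this
    rw [avg, ← this, ← integral_mul_left_eq_self (fun g => φ (h⁻¹ * g) • A.act g a) h]
    simp only [inv_mul_cancel_left]
  rw [h1, avg, ← integral_sub hc (integrable_avg m φ (A.continuous_act a)), ← integral_mul_const]
  refine norm_integral_le_of_norm_le (Integrable.mul_const ?_ _) (Eventually.of_forall fun t => ?_)
  · refine ((φ.continuous.comp (continuous_const.mul continuous_id)).sub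
      φ.continuous).norm.integrable_of_hasCompactSupport ?_
    have h3 : HasCompactSupport fun g => φ (h⁻¹ * g) :=
      φ.hasCompactSupport.comp_homeomorph (Homeomorph.mulLeft h⁻¹)
    exact (h3.sub φ.hasCompactSupport).norm
  · rw [← sub_smul, norm_smul, A.norm_act]

lemma tendsto_integral_transl_sub (φ : C_c(G, ℂ)) :
    Tendsto (fun h => ∫ g, ‖φ (h⁻¹ * g) - φ g‖ ∂m) (𝓝 1) (𝓝 0) := by
  have := tendsto_integral_transl m (x₀ := (1 : G)) (p := 1)
    (F := fun g s => φ (g⁻¹ * s) - φ s) ?_ continuous_id φ.hasCompactSupport.isCompact ?_ ?_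
    one_ne_zero
  · simpa using this
  · exact (φ.continuous.comp (continuous_fst.inv.mul continuous_snd)).sub
      (φ.continuous.comp continuous_snd)
  · intro g s h h'
    rw [id_eq] at h
    rw [image_eq_zero_of_notMem_tsupport h, image_eq_zero_of_notMem_tsupport (f := φ) h', sub_zero]
  · intro s; simp

/-- Averages approximate. -/
lemma exists_avg_sub_lt {A : GAlgebra G} (a : A) {ε : ℝ} (hε : 0 < ε) :
    ∃ φ : C_c(G, ℂ), l1 m φ = 1 ∧ ‖avg m φ a - a‖ ≤ ε := by
  let O : Set G := {g | ‖A.act g a - a‖ < ε}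
  have hO : IsOpen O := isOpen_lt ((A.continuous_act a).sub continuous_const).norm continuous_const
  have h1O : (1 : G) ∈ O := by simp [O, hε]
  obtain ⟨ψ, hψ1, hψ0, hψc, hψ⟩ := exists_continuous_one_zero_of_isCompact
    (isCompact_singleton (x := (1 : G)))
    hO.isClosed_compl (by simpa using h1O)
  have hpos : 0 < ∫ x, ψ x ∂m :=
    ψ.continuous.integral_pos_of_hasCompactSupport_nonneg_nonzero hψc (fun x => (hψ x).1)
      (x := 1) (by rw [hψ1 rfl]; exact one_ne_zero)
  let c := ∫ x, ψ x ∂m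
  let φ : C_c(G, ℂ) :=
    { toFun := fun g => ((c⁻¹ * ψ g : ℝ) : ℂ)
      continuous_toFun := by fun_prop
      hasCompactSupport' := hψc.comp_left (g := fun x : ℝ => ((c⁻¹ * x : ℝ) : ℂ)) (by simp) }
  have hφ : ∀ g, φ g = ((c⁻¹ * ψ g : ℝ) : ℂ) := fun g => rfl
  have hφn : ∀ g, ‖φ g‖ = c⁻¹ * ψ g := fun g => by
    rw [hφ, Complex.norm_real, Real.norm_of_nonneg (mul_nonneg (inv_nonneg.2 hpos.le) (hψ g).1)]
  have hl1 : l1 m φ = 1 := by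
    simp only [l1, hφn]
    rw [integral_const_mul]
    exact inv_mul_cancel₀ hpos.ne'
  have hint : ∫ g, φ g ∂m = 1 := by
    simp only [hφ]
    rw [integral_complex_ofReal, integral_const_mul]
    exact_mod_cast inv_mul_cancel₀ hpos.ne'
  refine ⟨φ, hl1, ?_⟩
  have h2 : a = ∫ g, φ g • a ∂m := by rw [integral_smul_const, hint, one_smul]
  have h3 : avg m φ a - a = ∫ g, φ g • (A.act g a - a) ∂m := by
    conv_lhs => rw [h2, ← h2]
    conv_lhs => enter [2]; rw [h2]
    rw [avg, ← integral_sub (integrable_avg m φ (A.continuous_act a))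
      (integrable_avg m φ continuous_const)]
    simp only [smul_sub]
  rw [h3, ← one_mul ε, ← hl1, l1, ← integral_mul_const]
  refine norm_integral_le_of_norm_le ((integrable_Cc m φ).norm.mul_const _)
    (Eventually.of_forall fun g => ?_)
  rw [norm_smul]
  by_cases hg : g ∈ O
  · gcongr
    exact hg.le
  · have : ψ g = 0 := hψ0 hg
    simp [hφn, this]

end Average

/-! ### Algebras of strictly convergent families -/

section StrictFamilies

open scoped ENNReal

/-- A Lipschitz bound uniform in the index allows an `ε / 2` exchange. It makes asymptotic
conditions on bounded families norm-closed. -/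
lemma isClosed_setOf_tendsto_zero {Λ X E : Type*} [SeminormedAddCommGroup X]
    [SeminormedAddCommGroup E] {T : Λ → X → E} {M : ℝ}
    (hT : ∀ i x y, ‖T i x - T i y‖ ≤ M * ‖x - y‖) (l : Filter Λ) :
    IsClosed {x | Tendsto (fun i => T i x) l (𝓝 0)} := by
  refine isClosed_of_closure_subset fun x hx => ?_
  refine Metric.tendsto_nhds.2 fun ε hε => ?_
  have hM : 0 < |M| + 1 := by positivity
  obtain ⟨y, hy, hxy⟩ := Metric.mem_closure_iff.1 hx (ε / 2 / (|M| + 1)) (by positivity)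
  filter_upwards [Metric.tendsto_nhds.1 hy (ε / 2) (by positivity)] with i hi
  rw [dist_zero_right] at hi ⊢
  rw [dist_eq_norm, lt_div_iff₀ hM] at hxy
  calc ‖T i x‖ = ‖(T i x - T i y) + T i y‖ := by simp
    _ ≤ M * ‖x - y‖ + ‖T i y‖ := (norm_add_le _ _).trans (by gcongr; exact hT i x y)
    _ ≤ |M| * ‖x - y‖ + ‖T i y‖ := by gcongr; exact le_abs_self M
    _ < ε := by nlinarith [norm_nonneg (x - y)]

/-- Coordinatewise application of ⋆-homomorphisms to bounded families. -/
def lpMap {Λ : Type*} {E F : Λ → Type*} [∀ i, NonUnitalCStarAlgebra (E i)]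
    [∀ i, NonUnitalCStarAlgebra (F i)] (φ : ∀ i, E i →⋆ₙₐ[ℂ] F i) : lp E ∞ →⋆ₙₐ[ℂ] lp F ∞ where
  toFun c := ⟨fun i => φ i (c i), memℓp_infty ⟨‖c‖, by
    rintro _ ⟨i, rfl⟩
    exact (NonUnitalStarAlgHom.norm_apply_le _ _).trans
      (lp.norm_apply_le_norm ENNReal.top_ne_zero c i)⟩⟩
  map_smul' z c := by ext1; funext i; exact map_smul (φ i) z (c i)
  map_zero' := by ext1; funext i; exact map_zero (φ i)
  map_add' c d := by ext1; funext i; exact map_add (φ i) (c i) (d i)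
  map_mul' c d := by ext1; funext i; exact map_mul (φ i) (c i) (d i)
  map_star' c := by ext1; funext i; exact map_star (φ i) (c i)

/-- Evaluation of bounded families at an index. -/
def lpEval {Λ : Type*} (E : Λ → Type*) [∀ i, NonUnitalCStarAlgebra (E i)] (i : Λ) :
    lp E ∞ →⋆ₙₐ[ℂ] E i where
  toFun c := c i
  map_smul' _ _ := rfl
  map_zero' := rfl
  map_add' _ _ := rfl
  map_mul' _ _ := rfl
  map_star' _ := rfl

variable {G : Type u} [Group G] [TopologicalSpace G]

/-- An invariant closed ⋆-subalgebra with continuous action as a `G`-algebra. -/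
def GAlgebra.ofSubalgebra {X : Type u} [NonUnitalCStarAlgebra X] (β : G → X →⋆ₙₐ[ℂ] X)
    (h1 : ∀ x, β 1 x = x) (hmul : ∀ g h x, β (g * h) x = β g (β h x))
    (S : NonUnitalStarSubalgebra ℂ X) [IsClosed (S : Set X)] (hS : ∀ g, ∀ x ∈ S, β g x ∈ S)
    (hc : ∀ x ∈ S, Continuous fun g => β g x) : GAlgebra G where
  carrier := S
  act :=
    { toFun := fun g =>
        { toFun := fun x => ⟨β g x, hS g x x.2⟩
          invFun := fun x => ⟨β g⁻¹ x, hS g⁻¹ x x.2⟩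
          left_inv := fun x => Subtype.ext (by simp [← hmul, h1])
          right_inv := fun x => Subtype.ext (by simp [← hmul, h1])
          map_mul' := fun x y => Subtype.ext (map_mul (β g) (x : X) (y : X))
          map_add' := fun x y => Subtype.ext (map_add (β g) (x : X) (y : X))
          map_star' := fun x => Subtype.ext (map_star (β g) (x : X))
          map_smul' := fun z x => Subtype.ext (map_smul (β g) z (x : X)) }
      map_one' := by ext x : 1; exact Subtype.ext (h1 x)
      map_mul' := fun g h => by ext x : 1; exact Subtype.ext (hmul g h x) }
  continuous_act x := (hc x x.2).subtype_mk _

/-- A ⋆-closed invariant ideal, as a set. -/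
structure IsInvariantIdeal {A : GAlgebra G} (S : Set A) : Prop where
  mul_left : ∀ a, ∀ s ∈ S, a * s ∈ S
  mul_right : ∀ a, ∀ s ∈ S, s * a ∈ S
  star_mem : ∀ s ∈ S, star s ∈ S
  act_mem : ∀ g : G, ∀ s ∈ S, A.act g s ∈ S

lemma IsInvariantIdeal.univ (A : GAlgebra G) : IsInvariantIdeal (Set.univ : Set A) :=
  ⟨by simp, by simp, by simp, by simp⟩

lemma GHom.IsIdealInclusion.isInvariantIdeal {I A : GAlgebra G} {j : GHom I A}
    (hj : j.IsIdealInclusion) : IsInvariantIdeal (Set.range j.toHom) := by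
  refine ⟨?_, ?_, ?_, ?_⟩
  · rintro a _ ⟨x, rfl⟩; exact (hj.2 a x).1
  · rintro a _ ⟨x, rfl⟩; exact (hj.2 a x).2
  · rintro _ ⟨x, rfl⟩; exact ⟨star x, map_star _ _⟩
  · rintro g _ ⟨x, rfl⟩; exact ⟨I.act g x, j.map_act g x⟩

section Family

variable {Λ : Type u} {C : Λ → GAlgebra G} {A B : GAlgebra G} (ρ : ∀ i, GHom (C i) B)
  (φ : GHom A B)

/-- The coordinatewise action on bounded families. -/
def famAct (C : Λ → GAlgebra G) (A : GAlgebra G) (g : G) :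
    (lp (fun i => C i) ∞ × A) →⋆ₙₐ[ℂ] (lp (fun i => C i) ∞ × A) :=
  NonUnitalStarAlgHom.prod
    ((lpMap fun i => (((C i).act g : C i ≃⋆ₐ[ℂ] C i) : C i →⋆ₙₐ[ℂ] C i)).comp
      (NonUnitalStarAlgHom.fst ℂ _ _))
    (((A.act g : A ≃⋆ₐ[ℂ] A) : A →⋆ₙₐ[ℂ] A).comp (NonUnitalStarAlgHom.snd ℂ _ _))

lemma famAct_fst (g : G) (x : lp (fun i => C i) ∞ × A) (i : Λ) :
    (famAct C A g x).1 i = (C i).act g (x.1 i) := rfl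

lemma famAct_snd (g : G) (x : lp (fun i => C i) ∞ × A) :
    (famAct C A g x).2 = A.act g x.2 := rfl

lemma famAct_one (x : lp (fun i => C i) ∞ × A) : famAct C A 1 x = x := by
  refine Prod.ext ?_ (A.act_one_apply _)
  ext1; funext i
  exact (C i).act_one_apply _

lemma famAct_mul (g h : G) (x : lp (fun i => C i) ∞ × A) :
    famAct C A (g * h) x = famAct C A g (famAct C A h x) := by
  refine Prod.ext ?_ (A.act_mul_apply _ _ _)
  ext1; funext i
  exact (C i).act_mul_apply _ _ _

lemma norm_famAct (g : G) (x : lp (fun i => C i) ∞ × A) : ‖famAct C A g x‖ = ‖x‖ := by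
  refine le_antisymm (NonUnitalStarAlgHom.norm_apply_le _ _) ?_
  conv_lhs => rw [← famAct_one x, ← inv_mul_cancel g, famAct_mul]
  exact NonUnitalStarAlgHom.norm_apply_le _ _

/-- The difference `ρ_i(c_i) - φ(a)`. -/
def famDiff (i : Λ) : (lp (fun i => C i) ∞ × A) →ₗ[ℂ] B where
  toFun x := (ρ i).toHom (x.1 i) - φ.toHom x.2
  map_add' x y := by simp; abel
  map_smul' z x := by simp [smul_sub]

lemma famDiff_apply (i : Λ) (x : lp (fun i => C i) ∞ × A) :
    famDiff ρ φ i x = (ρ i).toHom (x.1 i) - φ.toHom x.2 := rfl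

lemma norm_fam_fst_le (i : Λ) (x : lp (fun i => C i) ∞ × A) : ‖(ρ i).toHom (x.1 i)‖ ≤ ‖x‖ :=
  ((ρ i).norm_apply_le _).trans ((lp.norm_apply_le_norm ENNReal.top_ne_zero x.1 i).trans
    (norm_fst_le x))

lemma norm_famDiff_le (i : Λ) (x : lp (fun i => C i) ∞ × A) : ‖famDiff ρ φ i x‖ ≤ 2 * ‖x‖ := by
  rw [famDiff_apply, two_mul]
  exact (norm_sub_le _ _).trans (add_le_add (norm_fam_fst_le ρ i x)
    ((φ.norm_apply_le _).trans (norm_snd_le x)))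

/-- Two product rules are needed. In this one a left factor `s ∈ S` meets `φ(x)` and `s φ(x)` is
again in `S`; `famDiff_mul'` does the same for right factors. -/
lemma famDiff_mul (i : Λ) (x y : lp (fun i => C i) ∞ × A) :
    famDiff ρ φ i (x * y) = famDiff ρ φ i x * (ρ i).toHom (y.1 i) + φ.toHom x.2 * famDiff ρ φ i y := by
  simp only [famDiff_apply, Prod.fst_mul, Prod.snd_mul, lp.infty_coeFn_mul, Pi.mul_apply, map_mul,
    sub_mul, mul_sub]
  abel

lemma famDiff_mul' (i : Λ) (x y : lp (fun i => C i) ∞ × A) :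
    famDiff ρ φ i (x * y) = (ρ i).toHom (x.1 i) * famDiff ρ φ i y + famDiff ρ φ i x * φ.toHom y.2 := by
  simp only [famDiff_apply, Prod.fst_mul, Prod.snd_mul, lp.infty_coeFn_mul, Pi.mul_apply, map_mul,
    sub_mul, mul_sub]
  abel

lemma famDiff_star (i : Λ) (x : lp (fun i => C i) ∞ × A) :
    famDiff ρ φ i (star x) = star (famDiff ρ φ i x) := by
  simp only [famDiff_apply, Prod.fst_star, Prod.snd_star, lp.star_apply, map_star, star_sub]

lemma famDiff_act (g : G) (i : Λ) (x : lp (fun i => C i) ∞ × A) :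
    famDiff ρ φ i (famAct C A g x) = B.act g (famDiff ρ φ i x) := by
  simp only [famDiff_apply, famAct_fst, famAct_snd, map_sub, (ρ i).map_act,
    φ.map_act]

variable {S : Set B} (hS : IsInvariantIdeal S) (l : Filter Λ)

lemma tendsto_mul_bounded {E : Type*} [NonUnitalNormedRing E] {u v : Λ → E} {l : Filter Λ}
    {M : ℝ} (hu : Tendsto u l (𝓝 0)) (hv : ∀ i, ‖v i‖ ≤ M) :
    Tendsto (fun i => u i * v i) l (𝓝 0) ∧ Tendsto (fun i => v i * u i) l (𝓝 0) := by
  have h : Tendsto (fun i => M * ‖u i‖) l (𝓝 0) := by simpa using hu.norm.const_mul M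
  refine ⟨squeeze_zero_norm (fun i => ?_) h, squeeze_zero_norm (fun i => ?_) h⟩
  · rw [mul_comm M]
    exact (norm_mul_le _ _).trans (by gcongr; exact hv i)
  · exact (norm_mul_le _ _).trans (by gcongr; exact hv i)

/-- The bounded families `(c_i)` with continuous orbit map such that `ρ_i(c_i)` converges to `φ(a)`
strictly with respect to the ideal `S`. -/
def strictSubalgebra : NonUnitalStarSubalgebra ℂ (lp (fun i => C i) ∞ × A) where
  carrier := {x | (∀ s ∈ S, Tendsto (fun i => s * famDiff ρ φ i x) l (𝓝 0)) ∧
    (∀ s ∈ S, Tendsto (fun i => famDiff ρ φ i x * s) l (𝓝 0)) ∧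
      Continuous fun g => famAct C A g x}
  add_mem' {x y} hx hy := by
    refine ⟨fun s hs => ?_, fun s hs => ?_, ?_⟩
    · simpa [mul_add] using (hx.1 s hs).add (hy.1 s hs)
    · simpa [add_mul] using (hx.2.1 s hs).add (hy.2.1 s hs)
    · simp only [map_add]
      exact hx.2.2.add hy.2.2
  zero_mem' := ⟨fun s _ => by simpa using tendsto_const_nhds,
    fun s _ => by simpa using tendsto_const_nhds,
    by simp only [map_zero]; exact continuous_const⟩
  mul_mem' {x y} hx hy := by
    refine ⟨fun s hs => ?_, fun s hs => ?_, ?_⟩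
    · have h1 := (tendsto_mul_bounded (hx.1 s hs) (norm_fam_fst_le ρ · y)).1
      have h2 := hy.1 (s * φ.toHom x.2) (hS.mul_right _ _ hs)
      simpa [famDiff_mul, mul_add, mul_assoc] using h1.add h2
    · have h1 := (tendsto_mul_bounded (hy.2.1 s hs) (norm_fam_fst_le ρ · x)).2
      have h2 := hx.2.1 (φ.toHom y.2 * s) (hS.mul_left _ _ hs)
      simpa [famDiff_mul', add_mul, mul_assoc] using h1.add h2
    · simp only [map_mul]
      exact hx.2.2.mul hy.2.2
  smul_mem' z x hx := by
    refine ⟨fun s hs => ?_, fun s hs => ?_, ?_⟩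
    · simpa [mul_smul_comm] using (hx.1 s hs).const_smul z
    · simpa [smul_mul_assoc] using (hx.2.1 s hs).const_smul z
    · simp only [map_smul]
      exact hx.2.2.const_smul z
  star_mem' {x} hx := by
    refine ⟨fun s hs => ?_, fun s hs => ?_, ?_⟩
    · simpa [famDiff_star] using (hx.2.1 (star s) (hS.star_mem s hs)).star
    · simpa [famDiff_star] using (hx.1 (star s) (hS.star_mem s hs)).star
    · simp only [map_star]
      exact hx.2.2.star

lemma mem_strictSubalgebra {x : lp (fun i => C i) ∞ × A} : x ∈ strictSubalgebra ρ φ hS l ↔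
    (∀ s ∈ S, Tendsto (fun i => s * famDiff ρ φ i x) l (𝓝 0)) ∧
      (∀ s ∈ S, Tendsto (fun i => famDiff ρ φ i x * s) l (𝓝 0)) ∧
        Continuous fun g => famAct C A g x := Iff.rfl

lemma isClosed_setOf_continuous_famAct :
    IsClosed {x : lp (fun i => C i) ∞ × A | Continuous fun g => famAct C A g x} := by
  have h : {x : lp (fun i => C i) ∞ × A | Continuous fun g => famAct C A g x} =
      ⋂ g₀, {x | Tendsto (fun g => famAct C A g x - famAct C A g₀ x) (𝓝 g₀) (𝓝 0)} := by
    ext x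
    simp only [Set.mem_ofPred_eq, Set.mem_iInter, continuous_iff_continuousAt, ContinuousAt]
    refine forall_congr' fun g₀ => ?_
    rw [tendsto_sub_nhds_zero_iff]
  rw [h]
  refine isClosed_iInter fun g₀ => isClosed_setOf_tendsto_zero (M := 2) (fun g x y => ?_) _
  have : famAct C A g x - famAct C A g₀ x - (famAct C A g y - famAct C A g₀ y) =
      famAct C A g (x - y) - famAct C A g₀ (x - y) := by simp only [map_sub]; abel
  rw [this]
  refine (norm_sub_le _ _).trans ?_
  rw [norm_famAct, norm_famAct, two_mul]

lemma isClosed_strictSubalgebra :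
    IsClosed (strictSubalgebra ρ φ hS l : Set (lp (fun i => C i) ∞ × A)) := by
  have h : (strictSubalgebra ρ φ hS l : Set (lp (fun i => C i) ∞ × A)) =
      (⋂ s ∈ S, {x | Tendsto (fun i => s * famDiff ρ φ i x) l (𝓝 0)}) ∩
        ((⋂ s ∈ S, {x | Tendsto (fun i => famDiff ρ φ i x * s) l (𝓝 0)}) ∩
          {x | Continuous fun g => famAct C A g x}) := by
    ext x
    simp only [SetLike.mem_coe, mem_strictSubalgebra, Set.mem_inter_iff, Set.mem_iInter₂,
      Set.mem_ofPred_eq]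
  rw [h]
  refine (isClosed_biInter fun s _ => ?_).inter ((isClosed_biInter fun s _ => ?_).inter
    isClosed_setOf_continuous_famAct)
  · refine isClosed_setOf_tendsto_zero (M := ‖s‖ * 2) (fun i x y => ?_) _
    rw [← mul_sub, ← map_sub, mul_assoc]
    exact (norm_mul_le _ _).trans (by gcongr; exact norm_famDiff_le ρ φ i _)
  · refine isClosed_setOf_tendsto_zero (M := 2 * ‖s‖) (fun i x y => ?_) _
    rw [← sub_mul, ← map_sub, mul_right_comm]
    exact (norm_mul_le _ _).trans (by gcongr; exact norm_famDiff_le ρ φ i _)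

variable [IsTopologicalGroup G]

lemma famAct_mem_strictSubalgebra (g : G) {x : lp (fun i => C i) ∞ × A}
    (hx : x ∈ strictSubalgebra ρ φ hS l) : famAct C A g x ∈ strictSubalgebra ρ φ hS l := by
  have hc : Tendsto (B.act g) (𝓝 0) (𝓝 0) := by
    have : Continuous (B.act g) := (StarAlgEquiv.isometry (B.act g)).continuous
    simpa using this.tendsto 0
  refine ⟨fun s hs => ?_, fun s hs => ?_, ?_⟩
  · have := hc.comp (hx.1 (B.act g⁻¹ s) (hS.act_mem _ s hs))
    refine this.congr fun i => ?_
    rw [Function.comp_apply, map_mul, B.act_act_inv, famDiff_act]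
  · have := hc.comp (hx.2.1 (B.act g⁻¹ s) (hS.act_mem _ s hs))
    refine this.congr fun i => ?_
    rw [Function.comp_apply, map_mul, B.act_act_inv, famDiff_act]
  · simp only [← famAct_mul]
    exact hx.2.2.comp (continuous_mul_const g)

/-- The `G`-algebra of strictly convergent families. -/
def strictFamilies : GAlgebra G :=
  haveI := isClosed_strictSubalgebra ρ φ hS l
  GAlgebra.ofSubalgebra (famAct C A) famAct_one famAct_mul (strictSubalgebra ρ φ hS l)
    (fun g _ hx => famAct_mem_strictSubalgebra ρ φ hS l g hx) fun _ hx => hx.2.2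

/-- The limit of a strictly convergent family. -/
def strictFamilies.lim : GHom (strictFamilies ρ φ hS l) A where
  toHom := (NonUnitalStarAlgHom.snd ℂ _ _).comp
    (NonUnitalStarSubalgebraClass.subtype (strictSubalgebra ρ φ hS l))
  map_act _ _ := rfl

/-- The members of a strictly convergent family. -/
def strictFamilies.eval (i : Λ) : GHom (strictFamilies ρ φ hS l) (C i) where
  toHom := ((lpEval (fun i => C i) i).comp (NonUnitalStarAlgHom.fst ℂ _ _)).comp
    (NonUnitalStarSubalgebraClass.subtype (strictSubalgebra ρ φ hS l))
  map_act _ _ := rfl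

lemma strictFamilies.tendsto (x : strictFamilies ρ φ hS l) {s : B} (hs : s ∈ S) :
    Tendsto (fun i => s * ((ρ i).toHom ((strictFamilies.eval ρ φ hS l i).toHom x) -
      φ.toHom ((strictFamilies.lim ρ φ hS l).toHom x))) l (𝓝 0) :=
  x.2.1 s hs

variable [LocallyCompactSpace G] [MeasurableSpace G] [BorelSpace G] (m : Measure G)
  [m.IsHaarMeasure]

include m in
/-- If every element of `A` is the strict limit of a bounded family, then it is the limit of a
bounded family with continuous orbit map. -/
lemma strictFamilies.lim_surjective {K : ℝ}
    (h : ∀ a : A, ∃ c : ∀ i, C i, (∀ i, ‖c i‖ ≤ K * ‖a‖) ∧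
      (∀ s ∈ S, Tendsto (fun i => s * ((ρ i).toHom (c i) - φ.toHom a)) l (𝓝 0)) ∧
        ∀ s ∈ S, Tendsto (fun i => ((ρ i).toHom (c i) - φ.toHom a) * s) l (𝓝 0)) :
    Function.Surjective (strictFamilies.lim ρ φ hS l).toHom := by
  -- A bounded family with strict limit `a` need not have a continuous orbit in the supremum norm,
  -- but its average over `ψ` does. The limit then changes to `avg m ψ a`, within `‖a‖ / 2` of `a`,
  -- and successive approximation removes the error.
  refine surjective_of_approx_preimage (homCLM (strictFamilies.lim ρ φ hS l).toHom)
    (M := max K 1) fun a => ?_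
  rcases eq_or_ne a 0 with rfl | ha
  · exact ⟨0, by simp, by simp⟩
  obtain ⟨ψ, hψ, hψa⟩ := exists_avg_sub_lt m a (ε := 1 / 2 * ‖a‖) (by positivity)
  obtain ⟨c, hc, hc1, hc2⟩ := h a
  have hcb : ∀ i, ‖avg m ψ (c i)‖ ≤ K * ‖a‖ := fun i => by
    refine (norm_avg_le m ψ (c i)).trans ?_
    rw [hψ, one_mul]
    exact hc i
  let y : lp (fun i => C i) ∞ × A := (⟨fun i => avg m ψ (c i), memℓp_infty
    ⟨K * ‖a‖, by rintro _ ⟨i, rfl⟩; exact hcb i⟩⟩, avg m ψ a)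
  have hd : ∀ i, famDiff ρ φ i y = avg m ψ ((ρ i).toHom (c i) - φ.toHom a) := fun i => by
    rw [avg_sub, ← GHom.map_avg, ← GHom.map_avg]; rfl
  have hdb : ∀ i, ‖(ρ i).toHom (c i) - φ.toHom a‖ ≤ (K + 1) * ‖a‖ := fun i => by
    rw [add_mul, one_mul]
    exact (norm_sub_le _ _).trans
      (add_le_add (((ρ i).norm_apply_le _).trans (hc i)) (φ.norm_apply_le a))
  have hKs : ∀ s, IsCompact ((fun g => B.act g⁻¹ s) '' tsupport ψ) := fun s =>
    ψ.hasCompactSupport.isCompact.image ((B.continuous_act s).comp continuous_inv)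
  have hK0 : 0 ≤ max K 1 * ‖a‖ := mul_nonneg (zero_le_one.trans (le_max_right K 1)) (norm_nonneg a)
  have hmem : y ∈ strictSubalgebra ρ φ hS l := by
    refine ⟨fun s hs => ?_, fun s hs => ?_, ?_⟩
    -- Convergence holds at every translate of `s`, hence uniformly on the compact set of translates
    -- over `tsupport ψ`, and so for the average.
    · refine Metric.tendsto_nhds.2 fun ε hε => ?_
      filter_upwards [eventually_forall_norm_lt_of_isCompact (l := l) (M := (K + 1) * ‖a‖)
        (L := fun i (x : B) => x * ((ρ i).toHom (c i) - φ.toHom a)) (fun i x x' => by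
          rw [← sub_mul, mul_comm _ ‖x - x'‖]
          exact (norm_mul_le _ _).trans (by gcongr; exact hdb i)) (hKs s) (by
          rintro _ ⟨g, _, rfl⟩
          exact hc1 _ (hS.act_mem _ _ hs)) (half_pos hε)] with i hi
      rw [dist_zero_right, hd]
      refine (norm_mul_avg_le m ψ s _ (ε := ε / 2) fun g hg => (hi _ ⟨g, hg, rfl⟩).le).trans_lt ?_
      rw [hψ]; linarith
    · refine Metric.tendsto_nhds.2 fun ε hε => ?_
      filter_upwards [eventually_forall_norm_lt_of_isCompact (l := l) (M := (K + 1) * ‖a‖)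
        (L := fun i (x : B) => ((ρ i).toHom (c i) - φ.toHom a) * x) (fun i x x' => by
          rw [← mul_sub]
          exact (norm_mul_le _ _).trans (by gcongr; exact hdb i)) (hKs s) (by
          rintro _ ⟨g, _, rfl⟩
          exact hc2 _ (hS.act_mem _ _ hs)) (half_pos hε)] with i hi
      rw [dist_zero_right, hd]
      refine (norm_avg_mul_le m ψ s _ (ε := ε / 2) fun g hg => (hi _ ⟨g, hg, rfl⟩).le).trans_lt ?_
      rw [hψ]; linarith
    -- The modulus of continuity of an averaged orbit depends on `ψ` and a norm bound only, so it is
    -- common to all coordinates.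
    · have h1 : Tendsto (fun g => famAct C A g y - y) (𝓝 1) (𝓝 0) := by
        have h2 : Tendsto (fun h => (∫ g, ‖ψ (h⁻¹ * g) - ψ g‖ ∂m) * (max K 1 * ‖a‖)) (𝓝 1) (𝓝 0) := by
          simpa using (tendsto_integral_transl_sub m ψ).mul_const (max K 1 * ‖a‖)
        refine squeeze_zero_norm (fun g => ?_) h2
        have h0 : 0 ≤ ∫ t, ‖ψ (g⁻¹ * t) - ψ t‖ ∂m := integral_nonneg fun _ => norm_nonneg _
        rw [Prod.norm_def]
        refine max_le (lp.norm_le_of_forall_le (mul_nonneg h0 hK0) fun i => ?_) ?_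
        · refine (norm_act_avg_sub_le m ψ (c i) g).trans ?_
          gcongr
          exact (hc i).trans (by gcongr; exact le_max_left _ _)
        · refine (norm_act_avg_sub_le m ψ a g).trans ?_
          gcongr
          exact le_mul_of_one_le_left (norm_nonneg a) (le_max_right _ _)
      refine continuous_iff_continuousAt.2 fun g₀ => ?_
      rw [ContinuousAt, ← tendsto_sub_nhds_zero_iff, tendsto_zero_iff_norm_tendsto_zero]
      have h3 : Tendsto (fun g => g₀⁻¹ * g) (𝓝 g₀) (𝓝 1) := by
        simpa using (continuous_const_mul g₀⁻¹).tendsto g₀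
      refine ((tendsto_zero_iff_norm_tendsto_zero.1 h1).comp h3).congr fun g => ?_
      rw [Function.comp_apply, ← norm_famAct g₀, map_sub, ← famAct_mul, mul_inv_cancel_left]
  refine ⟨⟨y, hmem⟩, ?_, hψa⟩
  change ‖y‖ ≤ _
  rw [Prod.norm_def]
  refine max_le (lp.norm_le_of_forall_le hK0 fun i => (hcb i).trans ?_) ?_
  · gcongr; exact le_max_left _ _
  · refine (norm_avg_le m ψ a).trans ?_
    rw [hψ]
    gcongr; exact le_max_right _ _

end Family

end StrictFamilies

/-! ### Covariant representations bounded by the reduced norms of extensions -/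

section FibreProduct

variable {G : Type u} [Group G] [TopologicalSpace G] [IsTopologicalGroup G] [LocallyCompactSpace G]
  [MeasurableSpace G] [BorelSpace G] (m : Measure G) [m.IsHaarMeasure]

include m in
/-- Fibre products: equivariant surjections `C_i → B` pull back along `A → B` to a common equivariant
surjection onto `A`. -/
lemma exists_fibreProduct {Λ : Type u} {C : Λ → GAlgebra G} {A B : GAlgebra G}
    (ρ : ∀ i, GHom (C i) B) (hρ : ∀ i, Function.Surjective (ρ i).toHom) (φ : GHom A B) :
    ∃ (D : GAlgebra G) (π : GHom D A) (e : ∀ i, GHom D (C i)), Function.Surjective π.toHom ∧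
      ∀ i x, (ρ i).toHom ((e i).toHom x) = φ.toHom (π.toHom x) := by
  -- With all of `B` as ideal and `⊤` as filter, strict convergence is equality in every coordinate:
  -- taking `s = star y` for the difference `y` gives `star y * y = 0`.
  have hS := IsInvariantIdeal.univ B
  refine ⟨strictFamilies ρ φ hS ⊤, strictFamilies.lim ρ φ hS ⊤, strictFamilies.eval ρ φ hS ⊤, ?_,
    fun i x => ?_⟩
  · refine strictFamilies.lim_surjective ρ φ hS ⊤ m (K := 2) fun a => ?_
    choose c hc hc' using fun i => exists_lift_norm_le (hρ i) (φ.toHom a)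
    refine ⟨c, fun i => (hc' i).trans (by gcongr; exact φ.norm_apply_le a), fun s _ => ?_,
      fun s _ => ?_⟩ <;> simpa [hc] using tendsto_const_nhds
  · let y : B := (ρ i).toHom ((strictFamilies.eval ρ φ hS ⊤ i).toHom x) -
      φ.toHom ((strictFamilies.lim ρ φ hS ⊤).toHom x)
    have h := (strictFamilies.tendsto ρ φ hS ⊤ x (Set.mem_univ (star y))).mono_left
      (le_top (a := pure i))
    rw [tendsto_pure_left] at h
    have h1 : star y * y = 0 := tendsto_nhds_unique (f := fun _ : Λ => star y * y) (l := pure i)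
      tendsto_const_nhds (tendsto_pure_left.2 h)
    exact sub_eq_zero.1 (CStarRing.star_mul_self_eq_zero_iff _ |>.1 h1)

/-- The covariant representations of `A` which, for some equivariant surjection `C → A`, are bounded
on `C_c(G, C)` by the reduced norm. -/
def epsReps (A : GAlgebra G) : Set (Rep A) :=
  {ρ | ∃ (C : GAlgebra G) (π : GHom C A), Function.Surjective π.toHom ∧
    ∀ F, ‖ρ.V.op m (π.compCc F)‖ ≤ redNorm m C F}

lemma regularReps_subset_epsReps (A : GAlgebra G) : regularReps m A ⊆ epsReps m A :=
  fun _ hρ => ⟨A, GHom.id A, Function.surjective_id, fun F => norm_op_le_redNorm m hρ F⟩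

/-- The fibre product of `C` and `A` over `B` surjects onto `A`, and the reduced norm does not
increase under its projection to `C`. -/
lemma pullback_mem_epsReps {A B : GAlgebra G} (φ : GHom A B) {ρ : Rep B} (hρ : ρ ∈ epsReps m B) :
    (⟨ρ.H, ρ.V.pullback φ⟩ : Rep A) ∈ epsReps m A := by
  obtain ⟨C, π, hπ, h⟩ := hρ
  obtain ⟨D, σ, e, hσ, he⟩ := exists_fibreProduct m (Λ := PUnit.{u + 1}) (C := fun _ => C)
    (fun _ => π) (fun _ => hπ) φ
  refine ⟨D, σ, hσ, fun F => ?_⟩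
  have h1 : φ.compCc (σ.compCc F) = π.compCc ((e PUnit.unit).compCc F) := by
    ext s
    exact (he PUnit.unit (F s)).symm
  change ‖ρ.V.op m (φ.compCc (σ.compCc F))‖ ≤ _
  rw [h1]
  exact (h _).trans (redNorm_compCc_le m _ F)

/-- The crossed-product functor defined by the covariant representations in `epsReps`. -/
lemma exists_epsFunctor : ∃ μ : CrossedProductFunctor m, ∀ A,
    (∀ ρ ∈ epsReps m A, ∀ f, ‖ρ.V.op m f‖ ≤ ‖(μ.obj A).ι f‖) ∧
      ∀ f c, 0 ≤ c → (∀ ρ ∈ epsReps m A, ‖ρ.V.op m f‖ ≤ c) → ‖(μ.obj A).ι f‖ ≤ c :=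
  exists_functor m (epsReps m)
    (fun A _ _ hc h => redNorm_le_of_forall m hc fun ρ hρ => h ρ (regularReps_subset_epsReps m A hρ))
    fun φ _ _ _ h _ hρ => h _ (pullback_mem_epsReps m φ hρ)

end FibreProduct

/-! ### Extension of dominated representations from an ideal. -/

section IdealExtension

variable {G : Type u} [Group G] [TopologicalSpace G] [IsTopologicalGroup G] [LocallyCompactSpace G]
  [MeasurableSpace G] [BorelSpace G] (m : Measure G) [m.IsHaarMeasure]

/-- The projection onto `K` agrees with the identity on the essential subspace and on its
complement. -/
lemma mem_of_forall_rep_mem {I : GAlgebra G} {H : Type u} [NormedAddCommGroup H]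
    [InnerProductSpace ℂ H] [CompleteSpace H] {π : I →⋆ₙₐ[ℂ] (H →L[ℂ] H)} {K : Submodule ℂ H}
    (hK : IsClosed (K : Set H)) (h1 : ∀ x ξ, π x ξ ∈ K) (h2 : ∀ k, (∀ x, π x k = 0) → k ∈ K)
    (ξ : H) : ξ ∈ K := by
  have : CompleteSpace K := hK.completeSpace_coe
  have h : K.starProjection = ContinuousLinearMap.id ℂ H := ext_of_rep (π := π)
    (fun x ξ => K.starProjection_eq_self_iff.2 (h1 x ξ))
    fun k hk => K.starProjection_eq_self_iff.2 (h2 k hk)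
  exact K.starProjection_eq_self_iff.1 (congrArg (fun T : H →L[ℂ] H => T ξ) h)

/-- Pointwise convergence is made uniform twice by compactness: over the values of `F`, then over
the vectors `U_t η` with `t` in the support of `F`. -/
lemma CovariantRep.tendsto_integral_rep {A C : GAlgebra G} {H : Type u} [NormedAddCommGroup H]
    [InnerProductSpace ℂ H] [CompleteSpace H] (W : CovariantRep A H) {Λ : Type*} {l : Filter Λ}
    {d : Λ → C →ₗ[ℂ] A} {M : ℝ} (hd : ∀ i c, ‖d i c‖ ≤ M * ‖c‖)
    (h : ∀ c ζ, Tendsto (fun i => W.rep (d i c) ζ) l (𝓝 0)) (F : C_c(G, C)) (η : H) :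
    Tendsto (fun i => ∫ t, W.rep (d i (F t)) ((W.U t : H →L[ℂ] H) η) ∂m) l (𝓝 0) := by
  obtain ⟨R, hR⟩ := F.hasCompactSupport.exists_bound_of_continuous F.continuous
  have hR0 : 0 ≤ R := (norm_nonneg _).trans (hR 1)
  -- The factor `𝓟 Set.univ` encodes uniformity in `t`.
  have h1 : ∀ ζ, Tendsto (fun p : Λ × G => W.rep (d p.1 (F p.2)) ζ) (l ×ˢ 𝓟 Set.univ) (𝓝 0) := by
    intro ζ
    refine Metric.tendsto_nhds.2 fun ε hε => ?_
    have := eventually_forall_norm_lt_of_isCompact (l := l) (L := fun i c => W.rep (d i c) ζ)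
      (M := M * ‖ζ‖) (fun i x y => by
        rw [← sub_apply, ← map_sub, ← map_sub, mul_right_comm]
        exact (W.norm_rep_apply_le _ _).trans (by gcongr; exact hd i _))
      (F.hasCompactSupport.isCompact_range F.continuous) (fun c _ => h c ζ) hε
    refine (this.prod_inl (𝓟 Set.univ)).mono fun p hp => ?_
    rw [dist_zero_right]
    exact hp _ ⟨p.2, rfl⟩
  have h2 : ∀ ε > 0, ∀ᶠ i in l, ∀ t, ∀ ζ ∈ (fun t => (W.U t : H →L[ℂ] H) η) '' tsupport F,
      ‖W.rep (d i (F t)) ζ‖ < ε := fun ε hε => by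
    have := eventually_forall_norm_lt_of_isCompact (l := l ×ˢ 𝓟 Set.univ)
      (L := fun (p : Λ × G) ζ => W.rep (d p.1 (F p.2)) ζ) (M := |M| * R) (fun p x y => by
        rw [← map_sub]
        refine (W.norm_rep_apply_le _ _).trans ?_
        gcongr
        exact (hd _ _).trans (mul_le_mul (le_abs_self M) (hR _) (norm_nonneg _) (abs_nonneg M)))
      (F.hasCompactSupport.isCompact.image (W.continuous_U η)) (fun ζ _ => h1 ζ) hε
    rw [eventually_prod_principal_iff] at this
    exact this.mono fun i hi t => hi t trivial
  refine Metric.tendsto_nhds.2 fun ε hε => ?_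
  have hm : 0 ≤ m.real (tsupport F) := measureReal_nonneg
  filter_upwards [h2 (ε / (m.real (tsupport F) + 1)) (by positivity)] with i hi
  rw [dist_zero_right, ← setIntegral_eq_integral_of_forall_compl_eq_zero (s := tsupport F)
    fun t ht => by simp [image_eq_zero_of_notMem_tsupport ht]]
  refine (norm_setIntegral_le_of_norm_le_const F.hasCompactSupport.isCompact.measure_lt_top
    fun t ht => (hi t _ ⟨t, ht, rfl⟩).le).trans_lt ?_
  rw [div_mul_eq_mul_div, div_lt_iff₀ (by positivity)]
  nlinarith

/-- The canonical extension to `A` of a representation in `epsReps` of an ideal of `A`. -/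
lemma extension_mem_epsReps {I A : GAlgebra G} {j : GHom I A} (hj : j.IsIdealInclusion)
    {ρ : Rep I} (hρ : ρ ∈ epsReps m I) {W : CovariantRep A ρ.H}
    (h1 : ∀ x, W.rep (j.toHom x) = ρ.V.rep x) (h2 : W.U = ρ.V.U)
    (h3 : ∀ a k, (∀ x, ρ.V.rep x k = 0) → W.rep a k = 0) :
    (⟨ρ.H, W⟩ : Rep A) ∈ epsReps m A := by
  obtain ⟨C, π, hπ, hF⟩ := hρ
  obtain ⟨l, hl, hl1, hll, hlr⟩ := exists_approximateUnit I
  have hS := hj.isInvariantIdeal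
  -- There is one copy of `C` for each `e ∈ I`. An element `a ∈ A` is the strict limit of the
  -- products `a e`, which lie in `I` and lift to `C`.
  let σ : I → GHom C A := fun _ => j.comp π
  have hsurj : Function.Surjective (strictFamilies.lim σ (GHom.id A) hS l).toHom := by
    refine strictFamilies.lim_surjective σ (GHom.id A) hS l m (K := 2) fun a => ?_
    choose y hy using fun e => (hj.2 a e).1
    -- Lifts of `a e` are bounded uniformly only for `‖e‖ ≤ 1`. Elsewhere `0` is taken, which the
    -- filter `l` does not see.
    have hc : ∀ e : I, ∃ c : C, ‖c‖ ≤ 2 * ‖a‖ ∧ (‖e‖ ≤ 1 → j.toHom (π.toHom c) = a * j.toHom e) := by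
      intro e
      by_cases he : ‖e‖ ≤ 1
      · obtain ⟨c, hc, hc'⟩ := exists_lift_norm_le hπ (y e)
        refine ⟨c, hc'.trans ?_, fun _ => by rw [hc, hy]⟩
        gcongr
        rw [← hj.norm_apply, hy]
        refine (norm_mul_le _ _).trans (mul_le_of_le_one_right (norm_nonneg a) ?_)
        rwa [hj.norm_apply]
      · exact ⟨0, by simp, fun h => absurd h he⟩
    choose c hc1 hc2 using hc
    have hjc := j.continuous_toHom
    refine ⟨c, hc1, ?_, ?_⟩
    · rintro _ ⟨x, rfl⟩
      obtain ⟨z, hz⟩ := (hj.2 a x).2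
      have : Tendsto (fun e => j.toHom (z * e - z)) l (𝓝 0) := by
        have := (hjc.tendsto 0).comp (tendsto_sub_nhds_zero_iff.2 (hlr z))
        simpa only [map_zero, Function.comp_def] using this
      refine this.congr' (hl1.mono fun e he => ?_)
      change _ = j.toHom x * (j.toHom (π.toHom (c e)) - a)
      rw [map_sub, map_mul, hz, hc2 e he, mul_sub, mul_assoc]
    · rintro _ ⟨x, rfl⟩
      have : Tendsto (fun e => a * j.toHom (e * x - x)) l (𝓝 0) := by
        have := ((hjc.tendsto 0).comp (tendsto_sub_nhds_zero_iff.2 (hll x))).const_mul a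
        simpa only [map_zero, Function.comp_def, mul_zero] using this
      refine this.congr' (hl1.mono fun e he => ?_)
      change _ = (j.toHom (π.toHom (c e)) - a) * j.toHom x
      rw [map_sub, map_mul, hc2 e he, sub_mul, mul_sub, mul_assoc]
  refine ⟨_, _, hsurj, fun F => ?_⟩
  let L := strictFamilies.lim σ (GHom.id A) hS l
  let E := strictFamilies.eval σ (GHom.id A) hS l
  let d : I → strictFamilies σ (GHom.id A) hS l →ₗ[ℂ] A := fun i =>
    (homCLM ((σ i).comp (E i)).toHom - homCLM L.toHom).toLinearMap
  have hdc : ∀ i c, d i c = j.toHom (π.toHom ((E i).toHom c)) - L.toHom c := fun i c => rfl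
  have hdb : ∀ i c, ‖d i c‖ ≤ 2 * ‖c‖ := fun i c => by
    rw [hdc, two_mul]
    exact (norm_sub_le _ _).trans (add_le_add (((j.comp π).comp (E i)).norm_apply_le c)
      (L.norm_apply_le c))
  -- Strict convergence gives this on the essential subspace of `ρ.V.rep`; on its complement `h3`
  -- makes every term zero.
  have hd0 : ∀ c ζ, Tendsto (fun i => W.rep (d i c) ζ) l (𝓝 0) := by
    intro c ζ
    let K : Submodule ℂ ρ.H :=
      { carrier := {ζ | Tendsto (fun i => W.rep (d i c) ζ) l (𝓝 0)}
        add_mem' := fun {x y} hx hy => by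
          rw [Set.mem_ofPred_eq] at hx hy ⊢
          simpa using hx.add hy
        zero_mem' := by simp
        smul_mem' := fun z x hx => by
          rw [Set.mem_ofPred_eq] at hx ⊢
          simpa using hx.const_smul z }
    have hK : IsClosed (K : Set ρ.H) := by
      refine isClosed_setOf_tendsto_zero (M := 2 * ‖c‖) (fun i x y => ?_) _
      rw [← map_sub]
      exact (W.norm_rep_apply_le _ _).trans (by gcongr; exact hdb i c)
    refine mem_of_forall_rep_mem (K := K) (π := ρ.V.rep) hK (fun x ξ => ?_) (fun k hk => ?_) ζ
    · have hx : Tendsto (fun i => d i c * j.toHom x) l (𝓝 0) := c.2.2.1 _ ⟨x, rfl⟩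
      change Tendsto (fun i => W.rep (d i c) (ρ.V.rep x ξ)) l (𝓝 0)
      have : Tendsto (fun i => ‖d i c * j.toHom x‖ * ‖ξ‖) l (𝓝 0) := by
        simpa using hx.norm.mul_const ‖ξ‖
      refine squeeze_zero_norm (fun i => ?_) this
      rw [← h1, ← mul_apply_eq_comp, ← map_mul]
      exact W.norm_rep_apply_le _ _
    · change Tendsto (fun i => W.rep (d i c) k) l (𝓝 0)
      simp only [h3 _ k hk]
      exact tendsto_const_nhds
  refine ContinuousLinearMap.opNorm_le_bound _ (redNorm_nonneg m _ F) fun η => ?_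
  -- The extended operator is a strong limit of operators `ρ.V.op m (π.compCc ((E i).compCc F))`,
  -- each bounded by the reduced norm of `F`.
  have hT : Tendsto (fun i => ρ.V.op m (π.compCc ((E i).compCc F)) η) l
      (𝓝 (W.op m (L.compCc F) η)) := by
    rw [← tendsto_sub_nhds_zero_iff]
    refine (W.tendsto_integral_rep m hdb hd0 F η).congr fun i => ?_
    have h4 : ρ.V.op m (π.compCc ((E i).compCc F)) η =
        W.op m (j.compCc (π.compCc ((E i).compCc F))) η := by
      simp only [CovariantRep.op_apply, GHom.compCc_apply, h1, h2]
    rw [h4, ← sub_apply, ← map_sub, CovariantRep.op_apply]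
    rfl
  refine le_of_tendsto hT.norm (Eventually.of_forall fun i => ?_)
  refine (ContinuousLinearMap.le_opNorm _ _).trans ?_
  gcongr
  exact (hF _).trans (redNorm_compCc_le m (E i) F)

end IdealExtension

/-! ### Ultraproducts of covariant representations -/

section Ultraproduct

open scoped ENNReal

lemma _root_.Ultrafilter.exists_tendsto_of_norm_le {Λ : Type*} (ω : Ultrafilter Λ) {f : Λ → ℂ}
    {M : ℝ} (h : ∀ i, ‖f i‖ ≤ M) : ∃ z, Tendsto f ω (𝓝 z) := by
  obtain ⟨z, -, hz⟩ := (isCompact_closedBall (0 : ℂ) M).ultrafilter_le_nhds (ω.map f)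
    (by rw [le_principal_iff]; exact Filter.univ_mem' (s := f ⁻¹' _) fun i => by simpa using h i)
  exact ⟨z, hz⟩

/-- Coordinatewise application of a bounded family of operators to bounded families. -/
def lpOp {Λ : Type*} {E : Λ → Type*} [∀ i, NormedAddCommGroup (E i)] [∀ i, NormedSpace ℂ (E i)]
    (T : ∀ i, E i →L[ℂ] E i) {M : ℝ} (hM : 0 ≤ M) (hT : ∀ i x, ‖T i x‖ ≤ M * ‖x‖) :
    lp E ∞ →L[ℂ] lp E ∞ :=
  have hx : ∀ (x : lp E ∞) i, ‖T i (x i)‖ ≤ M * ‖x‖ := fun x i => (hT i (x i)).trans (by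
    gcongr; exact lp.norm_apply_le_norm ENNReal.top_ne_zero x i)
  LinearMap.mkContinuous
    { toFun := fun x => ⟨fun i => T i (x i), memℓp_infty ⟨M * ‖x‖, by
        rintro _ ⟨i, rfl⟩
        exact hx x i⟩⟩
      map_add' := fun x y => by ext1; funext i; exact map_add (T i) (x i) (y i)
      map_smul' := fun z x => by ext1; funext i; exact map_smul (T i) z (x i) } M
    fun x => lp.norm_le_of_forall_le (by positivity) (hx x)

variable {G : Type u} [Group G] [TopologicalSpace G] [IsTopologicalGroup G] [LocallyCompactSpace G]
  [MeasurableSpace G] [BorelSpace G] {A : GAlgebra G} {Λ : Type u} (V : Λ → Rep A)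

/-- The coordinatewise action of `A` on bounded families of vectors. -/
def famRep (a : A) : lp (fun i => (V i).H) ∞ →L[ℂ] lp (fun i => (V i).H) ∞ :=
  lpOp (fun i => (V i).V.rep a) (norm_nonneg a) fun i x => (V i).V.norm_rep_apply_le a x

/-- The coordinatewise action of `G` on bounded families of vectors. -/
def famU (g : G) : lp (fun i => (V i).H) ∞ →L[ℂ] lp (fun i => (V i).H) ∞ :=
  lpOp (fun i => ((V i).V.U g : (V i).H →L[ℂ] (V i).H)) zero_le_one fun i x => by simp

lemma famU_apply (g : G) (x : lp (fun i => (V i).H) ∞) (i : Λ) :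
    famU V g x i = ((V i).V.U g : (V i).H →L[ℂ] (V i).H) (x i) := rfl

lemma norm_famRep_le (a : A) (x : lp (fun i => (V i).H) ∞) : ‖famRep V a x‖ ≤ ‖a‖ * ‖x‖ :=
  lp.norm_le_of_forall_le (by positivity) fun i => ((V i).V.norm_rep_apply_le a (x i)).trans (by
    gcongr; exact lp.norm_apply_le_norm ENNReal.top_ne_zero x i)

lemma famRep_sub (a a' : A) (x : lp (fun i => (V i).H) ∞) :
    famRep V (a - a') x = famRep V a x - famRep V a' x := by
  ext1; funext i
  change (V i).V.rep (a - a') (x i) = (V i).V.rep a (x i) - (V i).V.rep a' (x i)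
  rw [map_sub]; rfl

lemma famU_famRep (g : G) (a : A) (x : lp (fun i => (V i).H) ∞) :
    famU V g (famRep V a x) = famRep V (A.act g a) (famU V g x) := by
  ext1; funext i
  exact ((V i).V.rep_act_apply g a (x i)).symm

lemma famU_mul (g h : G) (x : lp (fun i => (V i).H) ∞) :
    famU V (g * h) x = famU V g (famU V h x) := by
  ext1; funext i
  exact (V i).V.U_mul_apply g h (x i)

lemma famU_one (x : lp (fun i => (V i).H) ∞) : famU V 1 x = x := by
  ext1; funext i
  rw [famU_apply, map_one]; rfl

lemma norm_famU (g : G) (x : lp (fun i => (V i).H) ∞) : ‖famU V g x‖ = ‖x‖ := by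
  have h : ∀ (g : G) x, ‖famU V g x‖ ≤ ‖x‖ := fun g x =>
    lp.norm_le_of_forall_le (norm_nonneg x) fun i => by
      rw [famU_apply, CovariantRep.norm_U_apply]
      exact lp.norm_apply_le_norm ENNReal.top_ne_zero x i
  refine le_antisymm (h g x) ?_
  conv_lhs => rw [← famU_one V x, ← inv_mul_cancel g, famU_mul]
  exact h _ _

variable {S : Set A} (hS : IsInvariantIdeal S) (l : Filter Λ)

variable (S)

/-- The bounded families of vectors with continuous orbit map which are asymptotically annihilated
by an ideal. -/
def nullFamilies : Submodule ℂ (lp (fun i => (V i).H) ∞) where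
  carrier := {x | Tendsto (fun g => famU V g x - x) (𝓝 1) (𝓝 0) ∧
    ∀ s ∈ S, Tendsto (fun i => ‖(V i).V.rep s (x i)‖) l (𝓝 0)}
  add_mem' {x y} hx hy := by
    refine ⟨?_, fun s hs => ?_⟩
    · simpa [add_sub_add_comm] using hx.1.add hy.1
    · have h := (hx.2 s hs).add (hy.2 s hs)
      rw [add_zero] at h
      refine squeeze_zero (fun _ => norm_nonneg _) (fun i => ?_) h
      change ‖(V i).V.rep s (x i + y i)‖ ≤ _
      rw [map_add]
      exact norm_add_le _ _
  zero_mem' := by simpa using fun _ _ => tendsto_const_nhds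
  smul_mem' z x hx := by
    refine ⟨?_, fun s hs => ?_⟩
    · simpa [smul_sub] using hx.1.const_smul z
    · have h := (hx.2 s hs).const_mul ‖z‖
      rw [mul_zero] at h
      refine h.congr fun i => ?_
      change _ = ‖(V i).V.rep s (z • x i)‖
      rw [map_smul, norm_smul]

variable {V l S}

lemma mem_nullFamilies {x : lp (fun i => (V i).H) ∞} : x ∈ nullFamilies V S l ↔
    Tendsto (fun g => famU V g x - x) (𝓝 1) (𝓝 0) ∧
      ∀ s ∈ S, Tendsto (fun i => ‖(V i).V.rep s (x i)‖) l (𝓝 0) := Iff.rfl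

/-- Makes the space of families complete, so that integrals over `G` can be formed inside it. -/
lemma isClosed_nullFamilies : IsClosed (nullFamilies V S l : Set (lp (fun i => (V i).H) ∞)) := by
  have h : (nullFamilies V S l : Set (lp (fun i => (V i).H) ∞)) =
      {x | Tendsto (fun g => famU V g x - x) (𝓝 1) (𝓝 0)} ∩
        ⋂ s ∈ S, {x | Tendsto (fun i => ‖(V i).V.rep s (x i)‖) l (𝓝 0)} := by
    ext x
    simp only [SetLike.mem_coe, mem_nullFamilies, Set.mem_inter_iff, Set.mem_iInter₂,
      Set.mem_ofPred_eq]
  rw [h]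
  refine (isClosed_setOf_tendsto_zero (M := 2) (fun g x y => ?_) _).inter
    (isClosed_biInter fun s _ => isClosed_setOf_tendsto_zero (M := ‖s‖) (fun i x y => ?_) _)
  · have : famU V g x - x - (famU V g y - y) = famU V g (x - y) - (x - y) := by
      rw [map_sub]; abel
    rw [this, two_mul]
    exact (norm_sub_le _ _).trans_eq (by rw [norm_famU])
  · refine (abs_norm_sub_norm_le _ _).trans ?_
    rw [← map_sub]
    refine ((V i).V.norm_rep_apply_le _ _).trans ?_
    gcongr
    exact lp.norm_apply_le_norm ENNReal.top_ne_zero (x - y) i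

lemma continuous_famU {x : lp (fun i => (V i).H) ∞} (hx : x ∈ nullFamilies V S l) :
    Continuous fun g => famU V g x := by
  refine continuous_iff_continuousAt.2 fun g₀ => ?_
  rw [ContinuousAt, ← tendsto_sub_nhds_zero_iff, tendsto_zero_iff_norm_tendsto_zero]
  have h3 : Tendsto (fun g => g₀⁻¹ * g) (𝓝 g₀) (𝓝 1) := by
    simpa using (continuous_const_mul g₀⁻¹).tendsto g₀
  refine ((tendsto_zero_iff_norm_tendsto_zero.1 hx.1).comp h3).congr fun g => ?_
  rw [Function.comp_apply, ← norm_famU V g₀, map_sub, ← famU_mul, mul_inv_cancel_left]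

include hS

lemma famRep_mem_nullFamilies (a : A) {x : lp (fun i => (V i).H) ∞} (hx : x ∈ nullFamilies V S l) :
    famRep V a x ∈ nullFamilies V S l := by
  refine ⟨?_, fun s hs => ?_⟩
  · have h1 : Tendsto (fun g => ‖a‖ * ‖famU V g x - x‖ + ‖A.act g a - a‖ * ‖x‖) (𝓝 1) (𝓝 0) := by
      have h2 := (tendsto_zero_iff_norm_tendsto_zero.1 hx.1).const_mul ‖a‖
      have h3 : Tendsto (fun g => ‖A.act g a - a‖ * ‖x‖) (𝓝 1) (𝓝 0) := by
        have := (((A.continuous_act a).sub (continuous_const (y := a))).norm.tendsto 1).mul_const ‖x‖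
        simpa using this
      simpa using h2.add h3
    refine squeeze_zero_norm (fun g => ?_) h1
    have : famU V g (famRep V a x) - famRep V a x =
        famRep V (A.act g a) (famU V g x - x) + famRep V (A.act g a - a) x := by
      rw [famU_famRep, map_sub, famRep_sub]; abel
    rw [this]
    refine (norm_add_le _ _).trans (add_le_add ?_ (norm_famRep_le V _ _))
    simpa only [A.norm_act] using norm_famRep_le V (A.act g a) (famU V g x - x)
  · refine (hx.2 _ (hS.mul_right a s hs)).congr fun i => ?_
    rw [map_mul]; rfl

lemma famU_mem_nullFamilies (g : G) {x : lp (fun i => (V i).H) ∞} (hx : x ∈ nullFamilies V S l) :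
    famU V g x ∈ nullFamilies V S l := by
  refine ⟨?_, fun s hs => ?_⟩
  · have h := (continuous_famU hx).comp (continuous_mul_const g)
    have h1 := h.tendsto 1
    rw [← tendsto_sub_nhds_zero_iff] at h1
    simpa [famU_mul, famU_one] using h1
  · refine (hx.2 _ (hS.act_mem g⁻¹ s hs)).congr fun i => ?_
    rw [famU_apply, ← CovariantRep.norm_U_apply (V i).V g, ← CovariantRep.rep_act_apply,
      A.act_act_inv]

/-- The ultraproduct of a family of covariant representations, restricted to the families of vectors
with continuous orbit map which are asymptotically annihilated by an ideal. -/
lemma exists_ultraproduct (ω : Ultrafilter Λ) :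
    ∃ (H : Type u) (_ : NormedAddCommGroup H) (_ : InnerProductSpace ℂ H) (_ : CompleteSpace H)
      (W : CovariantRep A H) (b : nullFamilies V S ω →L[ℂ] H), DenseRange b ∧
        (∀ x, Tendsto (fun i => ‖x.1 i‖) ω (𝓝 ‖b x‖)) ∧
        (∀ a x, W.rep a (b x) = b ⟨famRep V a x, famRep_mem_nullFamilies hS a x.2⟩) ∧
        ∀ g x, (W.U g : H →L[ℂ] H) (b x) = b ⟨famU V g x, famU_mem_nullFamilies hS g x.2⟩ := by
  have hbd : ∀ x y : nullFamilies V S ω, ∃ z : ℂ,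
      Tendsto (fun i => inner ℂ (x.1 i) (y.1 i)) ω (𝓝 z) := fun x y =>
    ω.exists_tendsto_of_norm_le (M := ‖x.1‖ * ‖y.1‖) fun i => (norm_inner_le_norm _ _).trans (by
      gcongr <;> exact lp.norm_apply_le_norm ENNReal.top_ne_zero _ i)
  choose φ hφ using hbd
  -- The inner product is the ultralimit of the coordinate inner products; families with norms
  -- tending to zero along `ω` become null.
  let c : PreInnerProductSpace.Core ℂ (nullFamilies V S ω) :=
    { inner := φ
      conj_inner_symm := fun x y => by
        refine tendsto_nhds_unique ((Complex.continuous_conj.tendsto _).comp (hφ y x)) ?_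
        simpa [Function.comp_def] using hφ x y
      re_inner_nonneg := fun x => by
        refine ge_of_tendsto' ((Complex.continuous_re.tendsto _).comp (hφ x x)) fun i => ?_
        exact inner_self_nonneg (𝕜 := ℂ)
      add_left := fun x y z => by
        refine tendsto_nhds_unique (hφ (x + y) z) ?_
        refine ((hφ x z).add (hφ y z)).congr fun i => ?_
        exact (inner_add_left (x.1 i) (y.1 i) (z.1 i)).symm
      smul_left := fun x y r => by
        refine tendsto_nhds_unique (hφ (r • x) y) ?_
        refine ((hφ x y).const_mul _).congr fun i => ?_
        exact (inner_smul_left (x.1 i) (y.1 i) r).symm }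
  obtain ⟨H, _, _, _, b, hb, hin⟩ := exists_hilbert_of_core c
  have hin' : ∀ x y, Tendsto (fun i => inner ℂ (x.1 i) (y.1 i)) ω (𝓝 (inner ℂ (b x) (b y))) :=
    fun x y => by rw [hin]; exact hφ x y
  have hnorm : ∀ x, Tendsto (fun i => ‖x.1 i‖) ω (𝓝 ‖b x‖) := fun x => by
    have h := ((Complex.continuous_re.tendsto _).comp (hin' x x)).sqrt
    have h2 : √((inner ℂ (b x) (b x) : ℂ).re) = ‖b x‖ := (norm_eq_sqrt_re_inner (𝕜 := ℂ) _).symm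
    rw [h2] at h
    exact h.congr fun i => (norm_eq_sqrt_re_inner (𝕜 := ℂ) _).symm
  have hle : ∀ x, ‖b x‖ ≤ 1 * ‖x‖ := fun x => by
    rw [one_mul]
    exact le_of_tendsto' (hnorm x) fun i => lp.norm_apply_le_norm ENNReal.top_ne_zero x.1 i
  let R : A → nullFamilies V S ω →ₗ[ℂ] nullFamilies V S ω := fun a =>
    (famRep V a).toLinearMap.restrict fun _ hx => famRep_mem_nullFamilies hS a hx
  let U : G → nullFamilies V S ω →ₗ[ℂ] nullFamilies V S ω := fun g =>
    (famU V g).toLinearMap.restrict fun _ hx => famU_mem_nullFamilies hS g hx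
  have ext : ∀ x y : nullFamilies V S ω, (∀ i, x.1 i = y.1 i) → b x = b y := fun x y h =>
    congrArg b (Subtype.ext (lp.ext (funext h)))
  obtain ⟨W, hW, hWU⟩ := exists_covariantRep_of_dense (A := A) b hb R U
    (fun a a' x => by
      rw [← map_add]
      exact ext _ _ fun i => congrArg (fun T : (V i).H →L[ℂ] (V i).H => T (x.1 i))
        (map_add (V i).V.rep a a'))
    (fun z a x => by
      rw [← map_smul]
      exact ext _ _ fun i => congrArg (fun T : (V i).H →L[ℂ] (V i).H => T (x.1 i))
        (map_smul (V i).V.rep z a))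
    (fun a a' x => ext _ _ fun i => congrArg (fun T : (V i).H →L[ℂ] (V i).H => T (x.1 i))
        (map_mul (V i).V.rep a a'))
    (fun a x y => by
      refine tendsto_nhds_unique (hin' _ _) ((hin' _ _).congr fun i => ?_)
      change inner ℂ (x.1 i) ((V i).V.rep a (y.1 i)) = inner ℂ ((V i).V.rep (star a) (x.1 i)) (y.1 i)
      rw [map_star, ContinuousLinearMap.star_eq_adjoint, ContinuousLinearMap.adjoint_inner_left])
    (fun a x => le_of_tendsto_of_tendsto' (hnorm _) ((hnorm x).const_mul ‖a‖) fun i =>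
      (V i).V.norm_rep_apply_le a (x.1 i))
    (fun x => congrArg b (Subtype.ext (famU_one V x.1)))
    (fun g h x => congrArg b (Subtype.ext (famU_mul V g h x.1)))
    (fun g x => tendsto_nhds_unique (hnorm _) ((hnorm x).congr fun i =>
      ((V i).V.norm_U_apply g (x.1 i)).symm))
    (fun x => by
      refine squeeze_zero (fun _ => norm_nonneg _) (fun g => ?_)
        (tendsto_zero_iff_norm_tendsto_zero.1 x.2.1)
      rw [← map_sub]
      exact (hle _).trans_eq (one_mul _))
    (fun g a x => congrArg b (Subtype.ext (famU_famRep V g a x.1).symm))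
  exact ⟨H, _, _, _, W, LinearMap.mkContinuous b 1 hle, hb, hnorm, hW, hWU⟩

/-- A bounded family of vectors with equicontinuous orbit maps which is asymptotically annihilated
by an ideal defines a vector in a representation that annihilates the ideal. -/
lemma exists_covariantRep_of_family (m : Measure G) [m.IsHaarMeasure] (ω : Ultrafilter Λ)
    (η : ∀ i, (V i).H) {M : ℝ} (hM : ∀ i, ‖η i‖ ≤ M)
    (hη : ∀ ε > 0, ∀ᶠ g in 𝓝 (1 : G), ∀ i, ‖((V i).V.U g : (V i).H →L[ℂ] (V i).H) (η i) - η i‖ ≤ ε)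
    (hηS : ∀ s ∈ S, Tendsto (fun i => ‖(V i).V.rep s (η i)‖) ω (𝓝 0)) :
    ∃ (ρ : Rep A) (w : ρ.H), (∀ s ∈ S, ρ.V.rep s = 0) ∧
      (∀ f c, 0 ≤ c → (∀ i, ‖(V i).V.op m f‖ ≤ c) → ‖ρ.V.op m f‖ ≤ c) ∧
      (∀ f, Tendsto (fun i => ‖(V i).V.op m f (η i)‖) ω (𝓝 ‖ρ.V.op m f w‖)) ∧
        Tendsto (fun i => ‖η i‖) ω (𝓝 ‖w‖) := by
  obtain ⟨H, _, _, _, W, b, hb, hn, hR, hU⟩ := exists_ultraproduct hS (V := V) ω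
  let x : lp (fun i => (V i).H) ∞ := ⟨η, memℓp_infty ⟨M, by rintro _ ⟨i, rfl⟩; exact hM i⟩⟩
  have hx : x ∈ nullFamilies V S ω := by
    refine ⟨Metric.tendsto_nhds.2 fun ε hε => ?_, hηS⟩
    filter_upwards [hη (ε / 2) (half_pos hε)] with g hg
    rw [dist_zero_right]
    exact (lp.norm_le_of_forall_le (half_pos hε).le hg).trans_lt (half_lt_self hε)
  have : CompleteSpace (nullFamilies V S ω) := isClosed_nullFamilies.completeSpace_coe
  -- One integral in `nullFamilies` serves both sides: `b` carries it to the operator of the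
  -- ultraproduct, and evaluation at `i` to the operator of `V i`.
  have hop : ∀ f (y : nullFamilies V S ω), ∃ z : nullFamilies V S ω, W.op m f (b y) = b z ∧
      ∀ i, z.1 i = (V i).V.op m f (y.1 i) := by
    intro f y
    let F : G → nullFamilies V S ω := fun t => ⟨famRep V (f t) (famU V t y),
      famRep_mem_nullFamilies hS _ (famU_mem_nullFamilies hS t y.2)⟩
    have hF : Continuous F := by
      refine Continuous.subtype_mk ?_ _
      refine continuous_iff_continuousAt.2 fun t₀ => ?_
      rw [ContinuousAt, ← tendsto_sub_nhds_zero_iff]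
      have h1 : Tendsto (fun t => ‖f t‖ * ‖famU V t y - famU V t₀ y‖ + ‖f t - f t₀‖ * ‖famU V t₀ y‖)
          (𝓝 t₀) (𝓝 0) := by
        have h2 := (f.continuous.norm.tendsto t₀).mul
          (((continuous_famU y.2).sub (continuous_const (y := famU V t₀ y))).norm.tendsto t₀)
        have h3 := ((f.continuous.sub (continuous_const (y := f t₀))).norm.tendsto t₀).mul_const
          ‖famU V t₀ y‖
        simpa using h2.add h3
      refine squeeze_zero_norm (fun t => ?_) h1
      have : famRep V (f t) (famU V t y) - famRep V (f t₀) (famU V t₀ y) =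
          famRep V (f t) (famU V t y - famU V t₀ y) + famRep V (f t - f t₀) (famU V t₀ y) := by
        rw [famRep_sub, map_sub]; abel
      rw [this]
      exact (norm_add_le _ _).trans (add_le_add (norm_famRep_le V _ _) (norm_famRep_le V _ _))
    have hFi : Integrable F m := hF.integrable_of_hasCompactSupport
      (HasCompactSupport.intro' f.hasCompactSupport.isCompact (isClosed_tsupport f) fun t ht => by
        refine Subtype.ext (norm_le_zero_iff.1 ?_)
        refine (norm_famRep_le V _ _).trans ?_
        simp [image_eq_zero_of_notMem_tsupport ht])
    refine ⟨∫ t, F t ∂m, ?_, fun i => ?_⟩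
    · rw [← b.integral_comp_comm hFi, CovariantRep.op_apply]
      simp only [hU, hR, F]
    · exact (((lp.evalCLM ℂ (fun i => (V i).H) ∞ i).comp
        (nullFamilies V S ω).subtypeL).integral_comp_comm hFi).symm
  refine ⟨⟨H, W⟩, b ⟨x, hx⟩, fun s hs => ?_, fun f c hc h => ?_, fun f => ?_, hn ⟨x, hx⟩⟩
  · refine ContinuousLinearMap.ext fun ξ => congrFun (hb.equalizer (W.rep s).continuous
      (0 : H →L[ℂ] H).continuous (funext fun y => ?_)) ξ
    simp only [Function.comp_apply, zero_apply]
    rw [← norm_eq_zero]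
    change ‖W.rep s (b y)‖ = 0
    rw [hR]
    exact tendsto_nhds_unique (hn _) (y.2.2 s hs)
  · refine ContinuousLinearMap.opNorm_le_bound _ hc fun ξ => ?_
    refine hb.induction_on (p := fun ξ => ‖W.op m f ξ‖ ≤ c * ‖ξ‖) ξ
      (isClosed_le (by fun_prop) (by fun_prop)) fun y => ?_
    obtain ⟨z, hz, hz'⟩ := hop f y
    rw [hz]
    refine le_of_tendsto_of_tendsto' (hn z) ((hn y).const_mul c) fun i => ?_
    rw [hz']
    exact ((V i).V.op m f).le_of_opNorm_le (h i) _
  · obtain ⟨z, hz, hz'⟩ := hop f ⟨x, hx⟩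
    change Tendsto _ (ω : Filter Λ) (𝓝 ‖W.op m f (b ⟨x, hx⟩)‖)
    rw [hz]
    exact (hn z).congr fun i => by rw [hz']

end Ultraproduct

/-! ### Representations that factor through a quotient. -/

section Factor

variable {G : Type u} [Group G] [TopologicalSpace G] [IsTopologicalGroup G] [LocallyCompactSpace G]
  [MeasurableSpace G] [BorelSpace G]

lemma CovariantRep.exists_factorization {A B : GAlgebra G} {p : GHom A B}
    (hp : Function.Surjective p.toHom) {H : Type u} [NormedAddCommGroup H] [InnerProductSpace ℂ H]
    [CompleteSpace H] (W : CovariantRep A H) (hW : ∀ a, p.toHom a = 0 → W.rep a = 0) :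
    ∃ W' : CovariantRep B H, W'.pullback p = W := by
  choose q hq using hp
  have h : ∀ a a', p.toHom a = p.toHom a' → W.rep a = W.rep a' := fun a a' h => by
    rw [← sub_eq_zero, ← map_sub]
    exact hW _ (by rw [map_sub, h, sub_self])
  let rep : B →⋆ₙₐ[ℂ] (H →L[ℂ] H) :=
    { toFun := fun b => W.rep (q b)
      map_smul' := fun z x => by
        simp only [MonoidHom.id_apply]
        rw [← map_smul]; exact h _ _ (by simp [hq])
      map_zero' := hW _ (hq 0)
      map_add' := fun x y => by rw [← map_add]; exact h _ _ (by simp [hq])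
      map_mul' := fun x y => by rw [← map_mul]; exact h _ _ (by simp [hq])
      map_star' := fun x => by rw [← map_star]; exact h _ _ (by simp [hq, map_star]) }
  let W' : CovariantRep B H :=
    { rep := rep
      U := W.U
      continuous_U := W.continuous_U
      covariant := fun g x => by
        change W.rep (q _) = _ * W.rep (q x) * _
        rw [← W.covariant]
        exact h _ _ (by simp [hq, p.map_act]) }
  have h1 : W'.rep.comp p.toHom = W.rep := by
    ext1 a
    exact h _ _ (hq _)
  refine ⟨W', ?_⟩
  cases W
  simp only [CovariantRep.pullback]
  congr

end Factor

/-! ### Density of compactly supported functions with liftable values -/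

section Density

variable {G : Type u} [Group G] [TopologicalSpace G] [IsTopologicalGroup G] [LocallyCompactSpace G]
  [MeasurableSpace G] [BorelSpace G] (m : Measure G) [m.IsHaarMeasure]

/-- By a partition of unity, `h` is uniformly close on a compact set to `∑ φᵢ h(sᵢ)`, and only the
finitely many values `h(sᵢ)` have to be lifted. The cutoff `χ`, equal to one on the support of `h`,
restores compact support. -/
lemma exists_compCc_sub_le [T2Space G] {A B : GAlgebra G} {p : GHom A B}
    (hp : Function.Surjective p.toHom) (h : C_c(G, B)) {ε : ℝ} (hε : 0 < ε) :
    ∃ f : C_c(G, A), l1 m (p.compCc f - h) ≤ ε := by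
  obtain ⟨χ, hχ1, -, hχc, hχ⟩ := exists_continuous_one_zero_of_isCompact
    h.hasCompactSupport.isCompact isClosed_empty (Set.disjoint_empty _)
  set W := tsupport χ
  have hW : IsCompact W := hχc
  have hm : 0 ≤ m.real W := measureReal_nonneg
  -- The `+ 1` keeps the quotient meaningful when `W` has measure zero.
  let r := ε / (m.real W + 1)
  have hr : 0 < r := by positivity
  let O : G → Set G := fun s => {t | ‖h s - h t‖ < r}
  have hO : ∀ s, IsOpen (O s) := fun s =>
    isOpen_lt (continuous_const.sub h.continuous).norm continuous_const
  obtain ⟨T, hT⟩ := hW.elim_finite_subcover O hO fun t _ => Set.mem_iUnion.2 ⟨t, by simp [O, hr]⟩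
  let s : Fin T.card → G := fun i => (T.equivFin.symm i : G)
  have hs : W ⊆ ⋃ i, O (s i) := fun t ht => by
    obtain ⟨x, hx, hxt⟩ := Set.mem_iUnion₂.1 (hT ht)
    exact Set.mem_iUnion.2 ⟨T.equivFin ⟨x, hx⟩, by simpa [s] using hxt⟩
  obtain ⟨φ, hφO, hφ1, hφ, -⟩ := exists_continuous_sum_one_of_isOpen_isCompact
    (fun i => hO (s i)) hW hs
  choose a ha using fun i => hp (h (s i))
  let f : C_c(G, A) :=
    { toFun := fun t => (χ t : ℂ) • ∑ i, (φ i t : ℂ) • a i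
      continuous_toFun := by fun_prop
      hasCompactSupport' := by
        refine HasCompactSupport.smul_right ?_
        exact hχc.comp_left (g := fun x : ℝ => (x : ℂ)) Complex.ofReal_zero }
  refine ⟨f, ?_⟩
  have hzero : ∀ t, t ∉ W → h t = 0 := fun t ht => by
    by_contra h0
    have h1 : χ t = 1 := hχ1 (subset_tsupport _ h0)
    exact ht (subset_tsupport _ (by simp [h1]))
  have hb : ∀ t ∈ W, ‖(p.compCc f - h) t‖ ≤ r := fun t ht => by
    have h1 : ∑ i, φ i t = 1 := by simpa using hφ1 ht
    have h2 : (χ t : ℂ) • h t = h t := by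
      by_cases h0 : h t = 0
      · simp [h0]
      · have h1 : χ t = 1 := hχ1 (subset_tsupport _ h0)
        simp [h1]
    have h3 : ∑ i, (φ i t : ℂ) • h t = h t := by
      rw [← Finset.sum_smul, ← Complex.ofReal_sum, h1, Complex.ofReal_one, one_smul]
    have h4 : (p.compCc f - h) t = (χ t : ℂ) • ∑ i, (φ i t : ℂ) • (h (s i) - h t) := by
      change p.toHom ((χ t : ℂ) • ∑ i, (φ i t : ℂ) • a i) - h t = _
      simp only [smul_sub, Finset.sum_sub_distrib, h3, h2, map_smul, map_sum, ha]
    rw [h4, norm_smul, Complex.norm_real]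
    have h5 : ‖∑ i, (φ i t : ℂ) • (h (s i) - h t)‖ ≤ r := by
      calc _ ≤ ∑ i, φ i t * r := norm_sum_le_of_le _ fun i _ => by
            rw [norm_smul, Complex.norm_real, Real.norm_of_nonneg (hφ i t).1]
            by_cases h0 : φ i t = 0
            · simp [h0]
            · gcongr
              · exact (hφ i t).1
              · exact (hφO i (subset_tsupport _ h0) : _ < r).le
        _ = r := by rw [← Finset.sum_mul, h1, one_mul]
    calc _ ≤ 1 * r := by
          gcongr
          rw [Real.norm_of_nonneg (hχ t).1]
          exact (hχ t).2
      _ = r := one_mul r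
  rw [l1, ← setIntegral_eq_integral_of_forall_compl_eq_zero (s := W) fun t ht => by
    have : χ t = 0 := image_eq_zero_of_notMem_tsupport ht
    have h1 : (p.compCc f - h) t = p.toHom ((χ t : ℂ) • ∑ i, (φ i t : ℂ) • a i) - h t := rfl
    rw [h1, this, hzero t ht]; simp]
  have h6 : ∀ t ∈ W, ‖‖(p.compCc f - h) t‖‖ ≤ r := fun t ht => (norm_norm _).le.trans (hb t ht)
  refine (Real.le_norm_self _).trans ((norm_setIntegral_le_of_norm_le_const hW.measure_lt_top
    h6).trans ?_)
  rw [div_mul_eq_mul_div, div_le_iff₀ (by positivity)]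
  nlinarith

lemma tendsto_l1_transl_sub {A : GAlgebra G} (f : C_c(G, A)) :
    Tendsto (fun g => l1 m (transl g f - f)) (𝓝 1) (𝓝 0) := by
  have := tendsto_integral_transl m (x₀ := (1 : G)) (p := 1)
    (F := fun g s => A.act g (f (g⁻¹ * s)) - f s) ?_ continuous_id f.hasCompactSupport.isCompact ?_ ?_
    one_ne_zero
  · refine this.congr fun g => ?_
    simp only [pow_one]
    rfl
  · exact (GAlgebra.continuous_act_comp continuous_fst
      (f.continuous.comp (continuous_fst.inv.mul continuous_snd))).sub
      (f.continuous.comp continuous_snd)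
  · intro g s h h'
    rw [image_eq_zero_of_notMem_tsupport h', show f (g⁻¹ * s) = 0 from image_eq_zero_of_notMem_tsupport h]
    simp
  · intro s
    simp

end Density

/-! ### Functions with values in an ideal. -/

section IdealValued

variable {G : Type u} [Group G] [TopologicalSpace G] {I A : GAlgebra G} {j : GHom I A}

lemma GHom.IsIdealInclusion.exists_compCc_eq (hj : j.IsIdealInclusion) (F : C_c(G, A))
    (hF : ∀ s, F s ∈ Set.range j.toHom) : ∃ k, j.compCc k = F := by
  choose k hk using hF
  have hiso : Isometry j.toHom := AddMonoidHomClass.isometry_of_norm j.toHom hj.norm_apply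
  refine ⟨⟨⟨k, ?_⟩, ?_⟩, by ext s; exact hk s⟩
  · rw [hiso.isEmbedding.continuous_iff]
    exact F.continuous.congr fun s => (hk s).symm
  · refine HasCompactSupport.intro' F.hasCompactSupport.isCompact (isClosed_tsupport F) fun s hs => ?_
    refine hj.1 ?_
    rw [map_zero]
    exact (hk s).trans (image_eq_zero_of_notMem_tsupport hs)

variable [IsTopologicalGroup G] [LocallyCompactSpace G]
  [MeasurableSpace G] [BorelSpace G] (m : Measure G) [m.IsHaarMeasure]

/-- For each `s` the integrand has values in `I`, so its integral can be taken in `I` itself. -/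
lemma GHom.IsIdealInclusion.exists_compCc_eq_conv (hj : j.IsIdealInclusion) (f : C_c(G, A))
    (e : C_c(G, I)) : ∃ k, j.compCc k = conv m f (j.compCc e) := by
  refine hj.exists_compCc_eq _ fun s => ?_
  let X : C_c(G, A) :=
    { toFun := fun t => f t * A.act t (j.compCc e (t⁻¹ * s))
      continuous_toFun := f.continuous.mul (GAlgebra.continuous_act_comp continuous_id
        ((j.compCc e).continuous.comp (continuous_inv.mul continuous_const)))
      hasCompactSupport' := f.hasCompactSupport.mul_right }
  obtain ⟨k, hk⟩ := hj.exists_compCc_eq X fun t => by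
    obtain ⟨y, hy⟩ := (hj.2 (f t) (I.act t (e (t⁻¹ * s)))).1
    exact ⟨y, by rw [hy, j.map_act]; rfl⟩
  refine ⟨∫ t, k t ∂m, ?_⟩
  rw [conv_apply]
  change _ = ∫ t, X t ∂m
  rw [← hk]
  exact ((homCLM j.toHom).integral_comp_comm (integrable_Cc m k)).symm

end IdealValued

/-! ### Exactness -/

section Exactness

variable {G : Type u} [Group G] [TopologicalSpace G] [IsTopologicalGroup G] [LocallyCompactSpace G]
  [MeasurableSpace G] [BorelSpace G] {m : Measure G} [m.IsHaarMeasure] {μ : CrossedProductFunctor m}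
  {I A B : GAlgebra G} {j : GHom I A} {p : GHom A B}

lemma IsShortExact.isIdealInclusion (h : IsShortExact j p) : j.IsIdealInclusion := by
  refine ⟨h.1, fun a x => ⟨(h.2.1 _).1 ?_, (h.2.1 _).1 ?_⟩⟩ <;>
  rw [map_mul, (h.2.1 (j.toHom x)).2 ⟨x, rfl⟩] <;> simp

/-- Every representation in `epsReps` of `I` is the restriction of one in `epsReps` of `A`. -/
lemma norm_map_ι_le_of_isIdealInclusion
    (hμ : ∀ A, (∀ ρ ∈ epsReps m A, ∀ f, ‖ρ.V.op m f‖ ≤ ‖(μ.obj A).ι f‖) ∧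
      ∀ f c, 0 ≤ c → (∀ ρ ∈ epsReps m A, ‖ρ.V.op m f‖ ≤ c) → ‖(μ.obj A).ι f‖ ≤ c)
    (hj : j.IsIdealInclusion) (f : C_c(G, I)) :
    ‖(μ.obj I).ι f‖ ≤ ‖(μ.obj A).ι (j.compCc f)‖ := by
  refine (hμ I).2 f _ (norm_nonneg _) fun ρ hρ => ?_
  obtain ⟨W, h1, h2, h3, -⟩ := ρ.V.exists_extension hj
  have h4 := (hμ A).1 _ (extension_mem_epsReps m hj hρ h1 h2 h3) (j.compCc f)
  have h5 : W.op m (j.compCc f) = ρ.V.op m f := by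
    ext η
    simp only [CovariantRep.op_apply, GHom.compCc_apply, h1, h2]
  rwa [h5] at h4

/-- A covariant representation of `A` which annihilates the kernel of `A → B` and is bounded by
representations in `epsReps` induces a representation of `B` in `epsReps`. -/
lemma norm_op_le_of_annihilates (hp : Function.Surjective p.toHom) {Λ : Type u} {V : Λ → Rep A}
    (hV : ∀ i, V i ∈ epsReps m A) {ρ : Rep A} (h0 : ∀ a, p.toHom a = 0 → ρ.V.rep a = 0)
    (hρ : ∀ f c, 0 ≤ c → (∀ i, ‖(V i).V.op m f‖ ≤ c) → ‖ρ.V.op m f‖ ≤ c) :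
    ∃ σ ∈ epsReps m B, ∀ f, ‖σ.V.op m (p.compCc f)‖ = ‖ρ.V.op m f‖ := by
  obtain ⟨W, hW⟩ := ρ.V.exists_factorization hp h0
  have hWf : ∀ f, W.op m (p.compCc f) = ρ.V.op m f := fun f => by
    rw [← CovariantRep.op_pullback, hW]
  choose C π hπ hC using hV
  -- A single surjection `D → A` factoring through all the `C i` bounds all the `V i` at once, and
  -- therefore `ρ`.
  obtain ⟨D, σ, e, hσ, he⟩ := exists_fibreProduct m π hπ (GHom.id A)
  refine ⟨⟨ρ.H, W⟩, ⟨D, p.comp σ, hp.comp hσ, fun F => ?_⟩, fun f => congrArg norm (hWf f)⟩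
  rw [GHom.compCc_comp]
  change ‖W.op m _‖ ≤ _
  rw [hWf]
  refine hρ _ _ (redNorm_nonneg m D F) fun i => ?_
  have h1 : σ.compCc F = (π i).compCc ((e i).compCc F) := by
    ext s
    exact (he i (F s)).symm
  rw [h1]
  exact (hC i _).trans (redNorm_compCc_le m _ F)

/-- The distance of `f ∈ C_c(G, A)` to `I ⋊ G` is controlled by the norm of its image in `B ⋊ G`. -/
lemma exists_norm_ι_sub_lt
    (hμ : ∀ A, (∀ ρ ∈ epsReps m A, ∀ f, ‖ρ.V.op m f‖ ≤ ‖(μ.obj A).ι f‖) ∧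
      ∀ f c, 0 ≤ c → (∀ ρ ∈ epsReps m A, ‖ρ.V.op m f‖ ≤ c) → ‖(μ.obj A).ι f‖ ≤ c)
    (h : IsShortExact j p) (f : C_c(G, A)) {δ : ℝ} (hδ : 6 * ‖(μ.obj B).ι (p.compCc f)‖ < δ) :
    ∃ k : C_c(G, I), ‖(μ.obj A).ι (f - j.compCc k)‖ < δ := by
  by_contra! hk
  have hδ0 : 0 < δ := lt_of_le_of_lt (by positivity) hδ
  have hj := h.isIdealInclusion
  obtain ⟨l₀, hl₀, hb, hl, hr⟩ := (μ.obj I).exists_approximateUnit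
  let Λ := {e : C_c(G, I) // ‖(μ.obj I).ι e‖ < 2}
  let val : Λ → C_c(G, I) := Subtype.val
  have hev : ∀ᶠ e in l₀, e ∈ Set.range val := (hb 1 one_pos).mono fun e he =>
    ⟨⟨e, he.trans_eq (by norm_num)⟩, rfl⟩
  have hne : (comap val l₀).NeBot := comap_neBot_iff_frequently.2 hev.frequently
  let ω : Ultrafilter Λ := Ultrafilter.of (comap val l₀)
  have hω : Tendsto val ω l₀ := tendsto_comap.mono_left (Ultrafilter.of_le _)
  -- `f * e` lies in `C_c(G, I)`, so `‖f - f * e‖ ≥ δ` by assumption; passing to `δ / 2` makes room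
  -- for a vector of norm below one.
  have hex : ∀ e : Λ, ∃ ρ ∈ epsReps m A, ∃ ξ : ρ.H, ‖ξ‖ < 1 ∧
      δ / 2 < ‖ρ.V.op m (f - conv m f (j.compCc e.1)) ξ‖ := fun e => by
    obtain ⟨k, hk'⟩ := hj.exists_compCc_eq_conv m f e.1
    by_contra! hcon
    have h1 := (hμ A).2 (f - conv m f (j.compCc e.1)) (δ / 2) (by positivity) fun ρ hρ => by
      by_contra! h2
      obtain ⟨ξ, hξ, hξ'⟩ := ContinuousLinearMap.exists_lt_apply_of_lt_opNorm _ h2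
      exact absurd hξ' (hcon ρ hρ ξ hξ).not_gt
    have h2 := hk k
    rw [hk'] at h2
    linarith
  choose V hV ξ hξ hξ' using hex
  -- `ζ e = (1 - e) ξ e` has norm at most `1 + 2 = 3`, and `η e = f ζ e` equals `(f - f * e) ξ e`,
  -- of norm at least `δ / 2`.
  let ζ : ∀ e : Λ, (V e).H := fun e => ξ e - (V e).V.op m (j.compCc e.1) (ξ e)
  let η : ∀ e : Λ, (V e).H := fun e => (V e).V.op m f (ζ e)
  have hVj : ∀ e k, ‖(V e).V.op m (j.compCc k)‖ ≤ ‖(μ.obj I).ι k‖ := fun e k =>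
    (hμ I).1 _ (pullback_mem_epsReps m j (hV e)) k
  have hζ : ∀ e, ‖ζ e‖ ≤ 3 := fun e => by
    have h1 : ‖(V e).V.op m (j.compCc e.1) (ξ e)‖ ≤ 2 * 1 :=
      ((V e).V.op m (j.compCc e.1)).le_of_opNorm_le_of_le ((hVj e _).trans e.2.le) (hξ e).le
    exact (norm_sub_le _ _).trans (by linarith [hξ e])
  have hopζ : ∀ e k, ‖(V e).V.op m k (ζ e)‖ ≤ l1 m k * 3 := fun e k =>
    ((V e).V.op m k).le_of_opNorm_le_of_le ((V e).V.norm_op_le m k) (hζ e)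
  have hηδ : ∀ e, δ / 2 ≤ ‖η e‖ := fun e => by
    have h1 := hξ' e
    rw [map_sub, CovariantRep.op_conv] at h1
    refine h1.le.trans_eq (congrArg norm ?_)
    simp only [η, ζ, map_sub, sub_apply, mul_apply_eq_comp]
  obtain ⟨ρ, w, hρ0, hρ, hρf, hw⟩ := exists_covariantRep_of_family hj.isInvariantIdeal m ω η
    (fun e => hopζ e f)
    (fun ε hε => by
      filter_upwards [(tendsto_l1_transl_sub m f).eventually_lt_const (show 0 < ε / 3 by positivity)]
        with g hg e
      have h1 : ((V e).V.U g : (V e).H →L[ℂ] (V e).H) (η e) - η e =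
          (V e).V.op m (transl g f - f) (ζ e) := by
        have h0 : (V e).V.op m (transl g f - f) =
            ((V e).V.U g : (V e).H →L[ℂ] (V e).H) * (V e).V.op m f - (V e).V.op m f := by
          rw [map_sub, CovariantRep.U_mul_op]
        rw [h0]; rfl
      rw [h1]
      exact (hopζ e _).trans (by linarith))
    (by
      rintro _ ⟨x, rfl⟩
      -- For `x ∈ I` put `k = x f ∈ C_c(G, I)`. Then `x η e = (k - k * e) ξ e`, which tends to zero
      -- along the approximate unit.
      obtain ⟨k, hk'⟩ := hj.exists_compCc_eq (lmul (j.toHom x) f) fun s => (hj.2 (f s) x).2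
      have h1 : Tendsto (fun e : Λ => ‖(μ.obj I).ι k - (μ.obj I).ι k * (μ.obj I).ι e.1‖) ω (𝓝 0) := by
        have := ((hr ((μ.obj I).ι k)).const_sub ((μ.obj I).ι k)).norm.comp hω
        rw [sub_self, norm_zero] at this
        exact this
      refine squeeze_zero (fun _ => norm_nonneg _) (fun e => ?_) h1
      have h2 : (V e).V.rep (j.toHom x) (η e) =
          (V e).V.op m (j.compCc (k - conv m k e.1)) (ξ e) := by
        rw [j.compCc_sub, j.compCc_conv, hk', map_sub, CovariantRep.op_conv,
          ← CovariantRep.rep_mul_op]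
        simp only [η, ζ, map_sub, sub_apply, mul_apply_eq_comp]
      rw [h2, ← Completion.ι_conv, ← map_sub]
      simpa using ((V e).V.op m _).le_of_opNorm_le_of_le (hVj e (k - conv m k e.1)) (hξ e).le)
  obtain ⟨σ, hσ, hσρ⟩ := norm_op_le_of_annihilates h.2.2 hV
    (fun a ha => hρ0 a ((h.2.1 a).1 ha)) hρ
  have h1 : ‖ρ.V.op m (invol f)‖ ≤ ‖(μ.obj B).ι (p.compCc f)‖ := by
    rw [CovariantRep.op_invol, norm_star, ← hσρ]
    exact (hμ B).1 σ hσ _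
  -- From `‖η‖² = ⟨ζ, f⋆ η⟩ ≤ 3 ‖f⋆ η‖` the limit vector satisfies `‖w‖² ≤ 3 ‖p ∘ f‖ ‖w‖`. With `‖w‖
  -- ≥ δ / 2` this contradicts `δ > 6 ‖p ∘ f‖`.
  have h2 : ∀ e, ‖η e‖ ^ 2 ≤ 3 * ‖(V e).V.op m (invol f) (η e)‖ := fun e => by
    have h3 : inner ℂ (ζ e) ((V e).V.op m (invol f) (η e)) = inner ℂ (η e) (η e) := by
      rw [CovariantRep.op_invol, ContinuousLinearMap.star_eq_adjoint,
        ContinuousLinearMap.adjoint_inner_right]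
    have h4 := norm_inner_le_norm (𝕜 := ℂ) (ζ e) ((V e).V.op m (invol f) (η e))
    rw [h3, inner_self_eq_norm_sq_to_K, norm_pow, RCLike.norm_ofReal, abs_norm] at h4
    exact h4.trans (by gcongr; exact hζ e)
  have h3 := le_of_tendsto_of_tendsto' (hw.pow 2) ((hρf (invol f)).const_mul 3) h2
  have h4 : δ / 2 ≤ ‖w‖ := ge_of_tendsto' hw hηδ
  have h5 := (ρ.V.op m (invol f)).le_of_opNorm_le h1 w
  nlinarith

lemma isExact_of_epsReps [T2Space G]
    (hμ : ∀ A, (∀ ρ ∈ epsReps m A, ∀ f, ‖ρ.V.op m f‖ ≤ ‖(μ.obj A).ι f‖) ∧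
      ∀ f c, 0 ≤ c → (∀ ρ ∈ epsReps m A, ‖ρ.V.op m f‖ ≤ c) → ‖(μ.obj A).ι f‖ ≤ c) :
    μ.IsExact := by
  intro I A B j p h
  have hinj : Function.Injective (μ.map j) := μ.injective_map_of_norm_le
    (norm_map_ι_le_of_isIdealInclusion hμ h.isIdealInclusion)
  refine ⟨hinj, fun y => ⟨fun hy => ?_, ?_⟩, ?_⟩
  · have hcl : IsClosed (Set.range (μ.map j)) :=
      (AddMonoidHomClass.isometry_of_norm (μ.map j)
        (NonUnitalStarAlgHom.norm_map _ hinj)).isClosedEmbedding.isClosed_range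
    rw [← hcl.closure_eq]
    refine Metric.mem_closure_iff.2 fun ε hε => ?_
    obtain ⟨f, hf⟩ := (μ.obj A).dense_ι.exists_dist_lt y (show 0 < ε / 8 by positivity)
    have h1 : ‖(μ.obj B).ι (p.compCc f)‖ < ε / 8 := by
      rw [← μ.map_ι, ← sub_zero (μ.map p _), ← hy, ← map_sub]
      refine (NonUnitalStarAlgHom.norm_apply_le _ _).trans_lt ?_
      rwa [norm_sub_rev, ← dist_eq_norm]
    -- The norm in `B ⋊ G` is below `ε / 8`, and `6 / 8 < 7 / 8`; the remaining `ε / 8` is the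
    -- distance from `y` to `f`.
    obtain ⟨k, hk⟩ := exists_norm_ι_sub_lt hμ h f (δ := 7 * ε / 8) (by linarith)
    refine ⟨_, ⟨(μ.obj I).ι k, rfl⟩, ?_⟩
    rw [μ.map_ι]
    refine (dist_triangle _ ((μ.obj A).ι f) _).trans_lt ?_
    rw [dist_eq_norm ((μ.obj A).ι f), ← map_sub]
    linarith
  · rintro ⟨x, rfl⟩
    refine (μ.obj I).dense_ι.induction_on (p := fun x => μ.map p (μ.map j x) = 0) x
      (isClosed_eq ((homCLM (μ.map p)).continuous.comp (homCLM (μ.map j)).continuous)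
        continuous_const) fun f => ?_
    rw [μ.map_ι, μ.map_ι]
    have : p.compCc (j.compCc f) = 0 := by
      ext s
      exact (h.2.1 _).2 ⟨f s, rfl⟩
    rw [this, map_zero]
  · refine surjective_of_approx_preimage (homCLM (μ.map p)) (M := 10) fun y => ?_
    rcases eq_or_ne y 0 with rfl | hy
    · exact ⟨0, by simp, by simp⟩
    have hy' : 0 < ‖y‖ := norm_pos_iff.2 hy
    obtain ⟨g, hg⟩ := (μ.obj B).dense_ι.exists_dist_lt y (show 0 < ‖y‖ / 4 by positivity)
    obtain ⟨f, hf⟩ := exists_compCc_sub_le m h.2.2 g (show 0 < ‖y‖ / 4 by positivity)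
    have h1 : ‖(μ.obj B).ι (p.compCc f) - y‖ ≤ 1 / 2 * ‖y‖ := by
      have h2 : ‖(μ.obj B).ι (p.compCc f - g)‖ ≤ ‖y‖ / 4 :=
        ((hμ B).2 _ _ (l1_nonneg m _) fun ρ _ => ρ.V.norm_op_le m _).trans hf
      rw [map_sub] at h2
      rw [dist_comm, dist_eq_norm] at hg
      refine (norm_sub_le_norm_sub_add_norm_sub _ ((μ.obj B).ι g) _).trans ?_
      linarith
    have h2 : ‖(μ.obj B).ι (p.compCc f)‖ ≤ 3 / 2 * ‖y‖ := by
      have := norm_le_norm_add_norm_sub' ((μ.obj B).ι (p.compCc f)) y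
      linarith
    -- `6 * (3 / 2) = 9 < 10`. Subtracting `k` leaves the image in `B ⋊ G` unchanged and bounds the
    -- norm of the approximate preimage.
    obtain ⟨k, hk⟩ := exists_norm_ι_sub_lt hμ h f (δ := 10 * ‖y‖) (by linarith)
    refine ⟨(μ.obj A).ι (f - j.compCc k), hk.le, ?_⟩
    have h3 : p.compCc (f - j.compCc k) = p.compCc f := by
      ext s
      have : p.toHom (j.toHom (k s)) = 0 := (h.2.1 _).2 ⟨k s, rfl⟩
      simp [this]
    rw [homCLM_apply, μ.map_ι, h3]
    exact h1

end Exactness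

/-! ### The group algebra of the smallest exact crossed product -/

section SmallestExact

variable {G : Type u} [Group G] [TopologicalSpace G] [IsTopologicalGroup G] [LocallyCompactSpace G]
  [MeasurableSpace G] [BorelSpace G] {m : Measure G} [m.IsHaarMeasure]

/-- Functions with values in `ker π` do not change `π ∘ F`, so the bound by the reduced norm may be
minimised over `F + C_c(G, ker π)` and then over its closure. -/
lemma norm_op_le_norm_mk {r : CrossedProductFunctor m} (hr : r.IsReduced) {C A : GAlgebra G}
    {π : GHom C A} {ρ : Rep A} (hρ : ∀ F, ‖ρ.V.op m (π.compCc F)‖ ≤ redNorm m C F) (F : C_c(G, C)) :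
    ‖ρ.V.op m (π.compCc F)‖ ≤
      ‖(Submodule.Quotient.mk ((r.obj C).ι F) : r.obj C ⧸ r.kernelClosure π)‖ := by
  let K : Submodule ℂ C_c(G, C) :=
    { carrier := {k | ∀ s, π.toHom (k s) = 0}
      add_mem' := fun {x y} hx hy s => by
        rw [CompactlySupportedContinuousMap.add_apply, map_add, hx s, hy s, add_zero]
      zero_mem' := fun s => map_zero _
      smul_mem' := fun z x hx s => by
        rw [CompactlySupportedContinuousMap.smul_apply, map_smul, hx s, smul_zero] }
  have hspan : Submodule.span ℂ ((r.obj C).ι '' {k | ∀ s, π.toHom (k s) = 0}) =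
      K.map (r.obj C).ι := by
    rw [← Submodule.span_eq (K.map (r.obj C).ι)]
    rfl
  have h1 : ∀ z ∈ r.kernelClosure π, ‖ρ.V.op m (π.compCc F)‖ ≤ ‖(r.obj C).ι F - z‖ := by
    intro z hz
    have hz' : z ∈ closure (K.map (r.obj C).ι : Set (r.obj C)) := by
      rw [← hspan]; exact hz
    refine closure_minimal (t := {z | ‖ρ.V.op m (π.compCc F)‖ ≤ ‖(r.obj C).ι F - z‖}) ?_
      (isClosed_le continuous_const (by fun_prop)) hz'
    rintro _ ⟨k, hk, rfl⟩
    have h2 := hρ (F - k)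
    have h3 : π.compCc (F - k) = π.compCc F := by
      ext s
      have : π.toHom (k s) = 0 := hk s
      simp [this]
    rw [h3, ← hr C, map_sub] at h2
    exact h2
  refine le_of_forall_pos_le_add fun ε hε => ?_
  obtain ⟨y, hy, hy'⟩ := Submodule.Quotient.norm_mk_lt
    (Submodule.Quotient.mk ((r.obj C).ι F) : r.obj C ⧸ r.kernelClosure π) hε
  refine le_trans ?_ hy'.le
  have := h1 ((r.obj C).ι F - y) ((Submodule.Quotient.eq _).1 hy.symm)
  simpa using this

/-- Over the scalars one preimage of `1` lifts all functions at once. -/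
lemma exists_compCc_eq_of_surjective_scalars {C : GAlgebra G} {π : GHom C (scalars G)}
    (hπ : Function.Surjective π.toHom) (f : C_c(G, scalars G)) : ∃ F, π.compCc F = f := by
  obtain ⟨c, hc⟩ := hπ (fun _ => 1)
  let φ : C_c(G, ℂ) :=
    { toFun := fun s => f s PUnit.unit
      continuous_toFun := (continuous_apply PUnit.unit).comp f.continuous
      hasCompactSupport' := f.hasCompactSupport.comp_left
        (g := fun z : PUnit.{u + 1} → ℂ => z PUnit.unit) rfl }
  refine ⟨tensor φ c, ?_⟩
  ext s : 1
  change π.toHom (f s PUnit.unit • c) = f s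
  rw [map_smul, hc]
  funext x
  exact mul_one _

/-- The splitting estimate for the reduced functor, applied to the surjection that dominates `ρ`. -/
lemma norm_op_le_redNorm_of_mem_epsReps {ρ : Rep (scalars G)} (hρ : ρ ∈ epsReps m (scalars G))
    (f : C_c(G, scalars G)) : ‖ρ.V.op m f‖ ≤ redNorm m (scalars G) f := by
  obtain ⟨r, hr⟩ := exists_reduced m
  obtain ⟨C, π, hπ, h⟩ := hρ
  obtain ⟨F, rfl⟩ := exists_compCc_eq_of_surjective_scalars hπ f
  rw [← hr]
  exact (norm_op_le_norm_mk hr h F).trans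
    (CrossedProductFunctor.IdealProperty.norm_mk_le hr.idealProperty π F)

/-- Minimality places `ν` below the exact functor built from `epsReps`, whose norm on the scalars is
at most the reduced one; every functor lies above the reduced norm. -/
lemma CrossedProductFunctor.IsSmallestExact.canonicalMapIsIso [T2Space G]
    {ν r : CrossedProductFunctor m} (hν : ν.IsSmallestExact) (hr : r.IsReduced) :
    (ν.obj (scalars G)).CanonicalMapIsIso (r.obj (scalars G)) := by
  obtain ⟨μ, hμ⟩ := exists_epsFunctor m
  refine Completion.canonicalMapIsIso_of_norm_eq fun f => ?_
  rw [hr]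
  refine le_antisymm ?_ (ν.redNorm_le _ f)
  exact (hν.2 μ (isExact_of_epsReps hμ) _ f).trans ((hμ _).2 f _ (redNorm_nonneg m _ f)
    fun ρ hρ => norm_op_le_redNorm_of_mem_epsReps hρ f)

end SmallestExact

end CrossedProducts

end

open CrossedProducts in
theorem proposition2p5 {G : Type u} [Group G] [TopologicalSpace G] [IsTopologicalGroup G]
    [LocallyCompactSpace G] [T2Space G] [MeasurableSpace G] [BorelSpace G]
    (m : Measure G) [m.IsHaarMeasure] [m.Regular] :
    -- `ℂ ⋊_{E(μ)} G → ℂ ⋊_μ G` is an isomorphism if `μ` has the ideal property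
    (∀ μ : CrossedProductFunctor m, μ.IdealProperty →
      (∃ D : Completion m (scalars G), D.IsFor (μ.epsNorm (scalars G))) ∧
      ∀ D : Completion m (scalars G), D.IsFor (μ.epsNorm (scalars G)) →
        D.CanonicalMapIsIso (μ.obj (scalars G))) ∧
    -- the reduced crossed-product functor `r` exists and `ℂ ⋊_{E(r)} G` is the reduced group algebra
    (∃ r : CrossedProductFunctor m, r.IsReduced) ∧
    (∀ r : CrossedProductFunctor m, r.IsReduced →
      (∃ D : Completion m (scalars G), D.IsFor (r.epsNorm (scalars G))) ∧
      ∀ D : Completion m (scalars G), D.IsFor (r.epsNorm (scalars G)) →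
        D.CanonicalMapIsIso (r.obj (scalars G))) ∧
    -- the group algebra of the smallest exact crossed product is the reduced group algebra
    (∀ ν r : CrossedProductFunctor m, ν.IsSmallestExact → r.IsReduced →
      (ν.obj (scalars G)).CanonicalMapIsIso (r.obj (scalars G))) := by
  obtain ⟨r₀, hr₀⟩ := exists_reduced m
  exact ⟨fun μ hμ => CrossedProductFunctor.IdealProperty.canonicalMapIsIso hμ, ⟨r₀, hr₀⟩,
    fun r hr => CrossedProductFunctor.IdealProperty.canonicalMapIsIso hr.idealProperty,
    fun ν r hν hr => hν.canonicalMapIsIso hr⟩
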